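/- Let $p$ be a prime, $n\ge 1$, $G=\mathrm{GL}_{2n}$, $H=\mathrm{GL}_n\times\mathrm{GL}_n$ embedded in $G$ by $\iota(h_1,h_2)=\mathrm{diag}(h_1,h_2)$. Let $N,\overline N,T\subset G$ be the upper unipotent, lower unipotent and diagonal matrices, $\mathrm{Iw}=\{g\in G(\mathbb Z_p): g \bmod p \text{ upper triangular}\}$, $u=\begin{pmatrix}1&w_n\\0&1\end{pmatrix}$ with $w_n$ the antidiagonal permutation matrix, $N^\beta=N(p^\beta\mathbb Z_p)u$, $\mathrm{Iw}^\beta=\overline N(p\mathbb Z_p)T(\mathbb Z_p)N^\beta$ and $\mathrm{Iw}_H^1=H(\mathbb Z_p)\cap u^{-1}\mathrm{Iw}^1$. Let $L/\mathbb Q_p$ be a complete valued extension (for instance a finite one), and let $\Omega$ be an affinoid over $L$, with ring of functions $\mathcal O_\Omega$, over the pure weight space of $G$; that is, $\Omega$ carries a continuous character $\chi_\Omega=(\chi_1,\dots,\chi_{2n}):T(\mathbb Z_p)\to\mathcal O_\Omega^\times$ with $\chi_i\chi_{2n+1-i}=\mathsf w_\Omega$ for all $i$ and a character $\mathsf w_\Omega$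 of $\mathbb Z_p^\times$. (For instance, $\Omega$ may be an $(n+1)$-dimensional affinoid in this space, or a point.) Let $\mathcal A_\Omega$ be the space of locally analytic $f:\mathrm{Iw}\to\mathcal O_\Omega$ with $f(\overline n t g)=\chi_\Omega(t)f(g)$ for $\overline n\in\overline N(p\mathbb Z_p)$, $t\in T(\mathbb Z_p)$, let $\mathcal D_\Omega$ be its continuous $\mathcal O_\Omega$-linear dual, and let $\mathcal D_\Omega^1\subset\mathcal D_\Omega$ be the $\mu$ with $\mu(f)=\mu(f|_{\mathrm{Iw}^1})$ for all $f$ (with $f|_{\mathrm{Iw}^1}$ extended by zero). Let $\mathcal A(\mathbb Z_p^\times,\mathcal O_\Omega)$ and $\mathcal D(\mathbb Z_p^\times,\mathcal O_\Omega)$ be the locally analytic functions and distributions on $\mathbb Z_p^\times$. For a dominant $\lambda=(\lambda_1\ge\dots\ge\lambda_{2n})\in\mathbb Z^{2n}$ that is pure ($\lambda_i+\lambda_{2n+1-i}=\mathsf w$ for all $i$), let $V_\lambda(L)$ be the space of algebraic $f:G(\mathbb Z_p)\to L$ with $f(\overline n t g)=\lambda(t)f(g)$ for $\overline n\in\overline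 N(\mathbb Z_p)$, $t\in T(\mathbb Z_p)$, on which $G(\mathbb Z_p)$ acts by right translation, $V_\lambda^\vee(L)$ its dual, and $\mathrm{Crit}(\lambda)=\{j\in\mathbb Z:-\lambda_n\le j\le-\lambda_{n+1}\}$. Write $\mathcal A_\lambda,\mathcal D_\lambda,\mathcal D_\lambda^1$ for the objects over $L$ attached to the character $\lambda$. All duals carry the dual action; $\mathrm{Iw}$ acts on $\mathcal A_\Omega$ by right translation, and $h=(h_1,h_2)\in H(\mathbb Z_p)$ acts on $\mathcal A(\mathbb Z_p^\times,\mathcal O_\Omega)$ by $(h*f)(z)=\mathsf w_\Omega(\det h_2)\,f\big(\tfrac{\det h_2}{\det h_1}z\big)$ (over $L$ and for $\lambda$: with $z\mapsto z^{\mathsf w}$ in place of $\mathsf w_\Omega$). (1) Let $\alpha_i=(1^i,0^{2n-2i},(-1)^i)$ for $1\le i\le n-1$ and $\alpha_n=(1^n,0^n)$. There are unique $v_{(i)}\in V_{\alpha_i}(\mathbb Q_p)$ $(1\le i\le n-1)$ fixed by $H(\mathbb Z_p)$ and $v_{(n),1},v_{(n),2}\in V_{\alpha_n}(\mathbb Q_p)$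 on which $(h_1,h_2)\in H(\mathbb Z_p)$ acts by $\det h_1$, respectively $\det h_2$, all normalised to take the value $1$ at $u$. They map $N^\beta$ into $1+p^\beta\mathbb Z_p$ for all $\beta\ge1$. For every pure dominant $\lambda$ of purity weight $\mathsf w$ and every $j\in\mathrm{Crit}(\lambda)$, the function $$v_{\lambda,j}=\prod_{i=1}^{n-1}v_{(i)}^{\lambda_i-\lambda_{i+1}}\cdot v_{(n),1}^{-\lambda_{n+1}-j}\cdot v_{(n),2}^{\lambda_n+j}\cdot\det{}^{\lambda_{n+1}}$$ is a basis of the line of vectors in $V_\lambda(L)$ on which $(h_1,h_2)\in H(\mathbb Z_p)$ acts by $\det(h_1)^{-j}\det(h_2)^{\mathsf w+j}$. Let $\kappa_{\lambda,j}:V_\lambda^\vee(L)\to L$, $\mu\mapsto\mu(v_{\lambda,j})$. (2) There is a unique $\mathcal O_\Omega$-linear map $v_\Omega:\mathcal A(\mathbb Z_p^\times,\mathcal O_\Omega)\to\mathcal A_\Omega$ such that, for all $f$, on $N(\mathbb Z_p)$ the function $v_\Omega(f)$ is zero outside $N^1$ and, for $g\in N^1$, $$v_\Omega(f)(g)=w_\Omega(g)\,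 f\Big(\tfrac{v_{(n),2}(g)}{v_{(n),1}(g)}\Big),\qquad w_\Omega(g)=\chi_{n+1}(\det g)\prod_{i=1}^{n-1}\frac{\chi_i(v_{(i)}(g))}{\chi_{i+1}(v_{(i)}(g))}\cdot\chi_{n+1}(v_{(n),1}(g))^{-1}\,\chi_n(v_{(n),2}(g)).$$ Its dual $\kappa_\Omega:\mathcal D_\Omega\to\mathcal D(\mathbb Z_p^\times,\mathcal O_\Omega)$, $\kappa_\Omega(\mu)(f)=\mu(v_\Omega(f))$, is well defined. (3) Let $\lambda$ be a classical point of $\Omega$: a pure dominant integral weight, of purity weight $\mathsf w$, with an $L$-algebra map $\mathrm{sp}_\lambda:\mathcal O_\Omega\to L$ such that $\mathrm{sp}_\lambda\circ\chi_\Omega=\lambda$. Then the map $\kappa_\lambda$ (the map $\kappa_\Omega$ for $\Omega=\{\lambda\}$), the specialisation maps $\mathrm{sp}_\lambda$ on $\mathcal D_\Omega$ and on $\mathcal D(\mathbb Z_p^\times,\mathcal O_\Omega)$, and the map $r_\lambda:\mathcal D_\lambda\to V_\lambda^\vee(L)$ dual to $V_\lambda(L)\subset\mathcal A_\lambda$ are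 well defined, $\mathrm{sp}_\lambda$ maps $\mathcal D_\Omega^1$ to $\mathcal D_\lambda^1$, and for every $j\in\mathrm{Crit}(\lambda)$ the diagram $$\begin{array}{ccccc}\mathcal D_\Omega^1&\xrightarrow{\ \mathrm{sp}_\lambda\ }&\mathcal D_\lambda^1&\xrightarrow{\ r_\lambda\ }&V_\lambda^\vee(L)\\ \downarrow{\scriptstyle\kappa_\Omega}&&\downarrow{\scriptstyle\kappa_\lambda}&&\downarrow{\scriptstyle\kappa_{\lambda,j}}\\ \mathcal D(\mathbb Z_p^\times,\mathcal O_\Omega)&\xrightarrow{\ \mathrm{sp}_\lambda\ }&\mathcal D(\mathbb Z_p^\times,L)&\xrightarrow{\ \mu\mapsto\mu(z^j)\ }&L\end{array}$$ commutes (its left-hand square already on $\mathcal D_\Omega$). The group $\mathrm{Iw}_H^1$ preserves $\mathcal D_\Omega^1$ and $\mathcal D_\lambda^1$, and every map in the diagram is $\mathrm{Iw}_H^1$-equivariant, where $H(\mathbb Z_p)$ acts on the bottom right term $L$ by $\det(h_1)^{j}\det(h_2)^{-\mathsf w-j}$. -/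

import Mathlib

open Filter Topology

noncomputable section

namespace BranchingLaw

/-! ### Affinoid algebras -/

/-- The Banach `L`-algebra `A` is an affinoid algebra: for some power-bounded `a₁, …, aₘ ∈ A`, every
element of `A` is the value at `(a₁, …, aₘ)` of a restricted power series (an element of the Tate
algebra `L⟨T₁, …, Tₘ⟩`); that is, `A` is the image of a continuous surjection `L⟨T₁, …, Tₘ⟩ → A`. -/
def IsAffinoidAlgebra (L A : Type*) [NormedField L] [NormedCommRing A] [NormedAlgebra L A] : Prop :=
  ∃ (m : ℕ) (a : Fin m → A), (∀ i, ∃ C : ℝ, ∀ k : ℕ, ‖a i ^ k‖ ≤ C) ∧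
    ∀ x : A, ∃ P : MvPowerSeries (Fin m) L, P.IsRestricted (fun _ => (1 : ℝ)) ∧
      HasSum (fun ν : Fin m →₀ ℕ => MvPowerSeries.coeff ν P • ν.prod fun i k => a i ^ k) x

/-! ### Locally analytic functions and distributions -/

section LocallyAnalytic

variable (p : ℕ) [Fact p.Prime] {X E A : Type*}
  [NormedAddCommGroup E] [NormedSpace ℚ_[p] E] [NormedCommRing A] [NormedAlgebra ℚ_[p] A]

/-- Let `e : X → E` be the inclusion of a compact open subset of a finite-dimensional `ℚ_p`-space.
`f : X → A` is `p^k`-analytic of norm at most `C`: around each point `x`, it is given on the ball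
of radius `p^{-k}` by a power series `∑ₘ qₘ(y - x, …, y - x)` whose homogeneous terms satisfy
`‖qₘ‖ p^{-km} ≤ C` and `‖qₘ‖ p^{-km} → 0`. (For ultrametric `A` the norm of a multilinear form is
the maximum of the norms of its coefficients, so the bound is on the Gauss norm on the ball.) -/
def AnalyticBound (e : X → E) (k : ℕ) (C : ℝ) (f : X → A) : Prop :=
  ∀ x, ∃ q : FormalMultilinearSeries ℚ_[p] E A,
    (∀ m, ‖q m‖ * (((p : ℝ)⁻¹) ^ k) ^ m ≤ C) ∧
    Tendsto (fun m => ‖q m‖ * (((p : ℝ)⁻¹) ^ k) ^ m) atTop (𝓝 0) ∧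
    ∀ y, ‖e y - e x‖ ≤ ((p : ℝ)⁻¹) ^ k → HasSum (fun m => q m fun _ => e y - e x) (f y)

variable {p}

lemma AnalyticBound.mono {e : X → E} {k k' : ℕ} {C : ℝ} {f : X → A} (hk : k ≤ k')
    (h : AnalyticBound p e k C f) : AnalyticBound p e k' C f := by
  intro x
  obtain ⟨q, h1, h2, h3⟩ := h x
  have hp : (0 : ℝ) ≤ (p : ℝ)⁻¹ := by positivity
  have hp1 : (p : ℝ)⁻¹ ≤ 1 :=
    inv_le_one_of_one_le₀ (by exact_mod_cast (Fact.out : p.Prime).one_lt.le)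
  have hle : ((p : ℝ)⁻¹) ^ k' ≤ ((p : ℝ)⁻¹) ^ k := pow_le_pow_of_le_one hp hp1 hk
  have key : ∀ m, ‖q m‖ * (((p : ℝ)⁻¹) ^ k') ^ m ≤ ‖q m‖ * (((p : ℝ)⁻¹) ^ k) ^ m := fun m => by
    gcongr
  exact ⟨q, fun m => (key m).trans (h1 m),
    squeeze_zero (fun m => by positivity) key h2, fun y hy => h3 y (hy.trans hle)⟩

lemma AnalyticBound.add {e : X → E} {k : ℕ} {C C' : ℝ} {f f' : X → A}
    (h : AnalyticBound p e k C f) (h' : AnalyticBound p e k C' f') :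
    AnalyticBound p e k (C + C') (f + f') := by
  intro x
  obtain ⟨q, h1, h2, h3⟩ := h x
  obtain ⟨q', h1', h2', h3'⟩ := h' x
  have key : ∀ m, ‖(q + q') m‖ * (((p : ℝ)⁻¹) ^ k) ^ m ≤
      ‖q m‖ * (((p : ℝ)⁻¹) ^ k) ^ m + ‖q' m‖ * (((p : ℝ)⁻¹) ^ k) ^ m := fun m => by
    rw [← add_mul]
    gcongr
    exact norm_add_le (q m) (q' m)
  refine ⟨q + q', fun m => (key m).trans (add_le_add (h1 m) (h1' m)),
    squeeze_zero (fun m => by positivity) key (by simpa using h2.add h2'), fun y hy => ?_⟩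
  exact (h3 y hy).add (h3' y hy)

lemma AnalyticBound.smul {e : X → E} {k : ℕ} {C : ℝ} {f : X → A} (a : A)
    (h : AnalyticBound p e k C f) : AnalyticBound p e k (‖a‖ * C) (a • f) := by
  intro x
  obtain ⟨q, h1, h2, h3⟩ := h x
  let M := ContinuousLinearMap.mul ℚ_[p] A a
  have key : ∀ m, ‖M.compFormalMultilinearSeries q m‖ * (((p : ℝ)⁻¹) ^ k) ^ m ≤
      ‖a‖ * (‖q m‖ * (((p : ℝ)⁻¹) ^ k) ^ m) := fun m => by
    rw [← mul_assoc]
    gcongr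
    refine (M.norm_compContinuousMultilinearMap_le (q m)).trans ?_
    gcongr
    exact ContinuousLinearMap.opNorm_mul_apply_le ℚ_[p] A a
  refine ⟨M.compFormalMultilinearSeries q, fun m => (key m).trans (by gcongr; exact h1 m),
    squeeze_zero (fun m => by positivity) key (by simpa using h2.const_mul ‖a‖), fun y hy => ?_⟩
  exact (h3 y hy).map M M.continuous

lemma AnalyticBound.comp {e : X → E} {k : ℕ} {C : ℝ} {f : X → A} (φ : X → X) (T : E →L[ℚ_[p]] E)
    (hT : ‖T‖ ≤ 1) (hφ : ∀ x, e (φ x) = T (e x)) (h : AnalyticBound p e k C f) :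
    AnalyticBound p e k C (f ∘ φ) := by
  intro x
  obtain ⟨q, h1, h2, h3⟩ := h (φ x)
  have key : ∀ m, ‖q.compContinuousLinearMap T m‖ * (((p : ℝ)⁻¹) ^ k) ^ m ≤
      ‖q m‖ * (((p : ℝ)⁻¹) ^ k) ^ m := fun m => by
    gcongr
    refine ((q m).norm_compContinuousLinearMap_le (fun _ => T)).trans ?_
    refine mul_le_of_le_one_right (norm_nonneg _) ?_
    exact Finset.prod_le_one (fun _ _ => norm_nonneg _) (fun _ _ => hT)
  refine ⟨q.compContinuousLinearMap T, fun m => (key m).trans (h1 m),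
    squeeze_zero (fun m => by positivity) key h2, fun y hy => ?_⟩
  have hy' : ‖e (φ y) - e (φ x)‖ ≤ ((p : ℝ)⁻¹) ^ k := by
    rw [hφ, hφ, ← map_sub]
    refine (T.le_opNorm _).trans ((mul_le_of_le_one_left (norm_nonneg _) hT).trans hy)
  have := h3 (φ y) hy'
  simp only [hφ, ← map_sub] at this
  exact this

variable (p) in
/-- The `A`-module of locally analytic functions `X → A`. -/
def locAn (e : X → E) (A : Type*) [NormedCommRing A] [NormedAlgebra ℚ_[p] A] :
    Submodule A (X → A) where
  carrier := {f | ∃ k C, AnalyticBound p e k C f}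
  zero_mem' := ⟨0, 0, fun _ => ⟨0, by simp, by simp, fun y _ => by simp⟩⟩
  add_mem' := by
    rintro f f' ⟨k, C, h⟩ ⟨k', C', h'⟩
    exact ⟨max k k', C + C', (h.mono (le_max_left _ _)).add (h'.mono (le_max_right _ _))⟩
  smul_mem' := by
    rintro a f ⟨k, C, h⟩
    exact ⟨k, _, h.smul a⟩

variable (p) in
/-- The continuous `A`-linear functionals on a module `S` of locally analytic functions, for the
inductive limit topology of the Banach spaces of `p^k`-analytic functions: a functional is
continuous if and only if its restriction to the `p^k`-analytic functions is bounded for all `k`. -/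
def Dist (e : X → E) (S : Submodule A (X → A)) : Submodule A (S →ₗ[A] A) where
  carrier := {μ | ∀ k, ∃ C : ℝ, ∀ (f : S) (B : ℝ), AnalyticBound p e k B f.1 → ‖μ f‖ ≤ C * B}
  zero_mem' := fun k => ⟨0, by simp⟩
  add_mem' := by
    intro μ ν hμ hν k
    obtain ⟨C, hC⟩ := hμ k
    obtain ⟨C', hC'⟩ := hν k
    refine ⟨C + C', fun f B hB => ?_⟩
    rw [add_mul]
    exact (norm_add_le _ _).trans (add_le_add (hC f B hB) (hC' f B hB))
  smul_mem' := by
    intro a μ hμ k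
    obtain ⟨C, hC⟩ := hμ k
    refine ⟨‖a‖ * C, fun f B hB => ?_⟩
    rw [mul_assoc]
    exact (norm_mul_le _ _).trans (by gcongr; exact hC f B hB)

/-- The dual of a bounded endomorphism `Φ` of `S`. -/
def Dist.dual {e : X → E} {S : Submodule A (X → A)} (Φ : S →ₗ[A] S) (c : ℝ)
    (hΦ : ∀ k B (f : S), AnalyticBound p e k B f.1 → AnalyticBound p e k (c * B) (Φ f).1) :
    Dist p e S →ₗ[A] Dist p e S where
  toFun μ := ⟨μ.1 ∘ₗ Φ, fun k => by
    obtain ⟨C, hC⟩ := μ.2 k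
    refine ⟨C * c, fun f B hB => ?_⟩
    rw [mul_assoc]
    exact hC (Φ f) _ (hΦ k B f hB)⟩
  map_add' _ _ := rfl
  map_smul' _ _ := rfl

/-- `sp` is the specialisation of `A`-valued distributions along `x : A → A'`, the map
`D_A → D_A ⊗_A A' ≅ D_{A'}`: it satisfies `sp(μ)(x ∘ F) = x(μ(F))`. -/
def IsSpecialisation {A' : Type*} [NormedCommRing A'] [NormedAlgebra ℚ_[p] A'] (x : A →+* A')
    {e : X → E} {S : Submodule A (X → A)} {S' : Submodule A' (X → A')}
    (sp : Dist p e S →ₛₗ[x] Dist p e S') : Prop :=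
  ∀ (μ : Dist p e S) (F : S) (f : S'), (∀ g, f.1 g = x (F.1 g)) → (sp μ).1 f = x (μ.1 F)

end LocallyAnalytic

/-! ### Matrix groups -/

section Groups

variable (p : ℕ) [Fact p.Prime] (n : ℕ)

/-- `GL_{2n}(ℤ_p)`. -/
abbrev G : Type := Matrix.GeneralLinearGroup (Fin (n + n)) ℤ_[p]

/-- `GL_n(ℤ_p)`; the group `H(ℤ_p)` is `GL_n(ℤ_p) × GL_n(ℤ_p)`. -/
abbrev Gn : Type := Matrix.GeneralLinearGroup (Fin n) ℤ_[p]

/-- The group of invertible upper triangular matrices over a field. -/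
def borel (m : ℕ) (F : Type*) [Field F] : Subgroup (Matrix.GeneralLinearGroup (Fin m) F) where
  carrier := {g | ∀ i j, j < i → g.1 i j = 0}
  one_mem' := fun i j h => by simp [h.ne']
  mul_mem' := fun {a b} ha hb => by
    have h1 : Matrix.BlockTriangular a.1 id := fun i j h => ha i j h
    have h2 : Matrix.BlockTriangular b.1 id := fun i j h => hb i j h
    exact fun i j h => (h1.mul h2) h
  inv_mem' := fun {a} ha => by
    have h1 : Matrix.BlockTriangular a.1 id := fun i j h => ha i j h
    let : Invertible a.1 := a.invertible
    have h2 := Matrix.blockTriangular_inv_of_blockTriangular h1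
    intro i j h
    rw [Matrix.coe_units_inv]
    exact h2 h

/-- The Iwahori subgroup: the `g ∈ GL_{2n}(ℤ_p)` with `g mod p` upper triangular. -/
def Iw : Subgroup (G p n) :=
  (borel (n + n) (ZMod p)).comap (Matrix.GeneralLinearGroup.map PadicInt.toZMod)

variable {p n}

lemma coe_sum_mul {ι : Type*} [Fintype ι] (a b : ι → ℤ_[p]) :
    ((∑ l, a l * b l : ℤ_[p]) : ℚ_[p]) = ∑ l, (a l : ℚ_[p]) * (b l : ℚ_[p]) := by
  change PadicInt.Coe.ringHom _ = _
  rw [map_sum]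
  exact Finset.sum_congr rfl fun l _ => map_mul PadicInt.Coe.ringHom _ _

lemma mem_Iw_iff (g : G p n) : g ∈ Iw p n ↔ ∀ i j, j < i → (p : ℤ_[p]) ∣ g.1 i j := by
  have : ∀ z : ℤ_[p], PadicInt.toZMod z = 0 ↔ (p : ℤ_[p]) ∣ z := fun z => by
    rw [← RingHom.mem_ker, PadicInt.ker_toZMod, PadicInt.maximalIdeal_eq_span_p,
      Ideal.mem_span_singleton]
  simp only [← this]
  rfl

/-- The block matrix `[a, b; c, d]` of size `2n`. -/
def blk (a b c d : Matrix (Fin n) (Fin n) ℤ_[p]) : Matrix (Fin (n + n)) (Fin (n + n)) ℤ_[p] :=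
  Matrix.reindex finSumFinEquiv finSumFinEquiv (Matrix.fromBlocks a b c d)

lemma blk_mul (a b c d a' b' c' d' : Matrix (Fin n) (Fin n) ℤ_[p]) :
    blk a b c d * blk a' b' c' d' =
      blk (a * a' + b * c') (a * b' + b * d') (c * a' + d * c') (c * b' + d * d') := by
  simp [blk, Matrix.fromBlocks_multiply, Matrix.submatrix_mul_equiv]

lemma blk_one : blk (1 : Matrix (Fin n) (Fin n) ℤ_[p]) 0 0 1 = 1 := by
  simp [blk, Matrix.fromBlocks_one]

/-- The embedding `ι : H = GL_n × GL_n → GL_{2n}`. -/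
def iota (h : Gn p n × Gn p n) : G p n where
  val := blk h.1.1 0 0 h.2.1
  inv := blk h.1⁻¹.1 0 0 h.2⁻¹.1
  val_inv := by rw [blk_mul]; simp [blk_one]
  inv_val := by rw [blk_mul]; simp [blk_one]

variable (p n) in
/-- The antidiagonal permutation matrix `w_n`. -/
def antidiag : Matrix (Fin n) (Fin n) ℤ_[p] := Matrix.of fun i j => if j = Fin.rev i then 1 else 0

variable (p n) in
/-- The open orbit element `u = [1, w_n; 0, 1]`. -/
def uElt : G p n where
  val := blk 1 (antidiag p n) 0 1
  inv := blk 1 (-antidiag p n) 0 1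
  val_inv := by rw [blk_mul]; simp [blk_one]
  inv_val := by rw [blk_mul]; simp [blk_one]

/-- The diagonal matrix with entries `t`, an element of `T(ℤ_p)`. -/
def torus (t : Fin (n + n) → ℤ_[p]ˣ) : G p n :=
  Units.map (Matrix.diagonalRingHom (Fin (n + n)) ℤ_[p]).toMonoidHom (MulEquiv.piUnits.symm t)

variable (p n) in
/-- `N(p^β ℤ_p)`: upper triangular unipotent, entries above the diagonal divisible by `p^β`. -/
def upperUnip (β : ℕ) : Set (G p n) :=
  {g | (∀ i, g.1 i i = 1) ∧ (∀ i j, j < i → g.1 i j = 0) ∧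
    ∀ i j, i < j → (p : ℤ_[p]) ^ β ∣ g.1 i j}

variable (p n) in
/-- `N̄(p^β ℤ_p)`: lower triangular unipotent, entries below the diagonal divisible by `p^β`. -/
def lowerUnip (β : ℕ) : Set (G p n) :=
  {g | (∀ i, g.1 i i = 1) ∧ (∀ i j, i < j → g.1 i j = 0) ∧
    ∀ i j, j < i → (p : ℤ_[p]) ^ β ∣ g.1 i j}

variable (p n) in
/-- `N^β(ℤ_p) = N(p^β ℤ_p) · u`. -/
def unipCoset (β : ℕ) : Set (G p n) := {g | ∃ m ∈ upperUnip p n β, g = m * uElt p n}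

variable (p n) in
/-- `Iw^β = N̄(p ℤ_p) · T(ℤ_p) · N^β(ℤ_p)`. -/
def iwSet (β : ℕ) : Set (G p n) :=
  {g | ∃ k ∈ lowerUnip p n 1, ∃ t, ∃ m ∈ unipCoset p n β, g = k * torus t * m}

variable (p n) in
/-- `Iw_H^β = H(ℤ_p) ∩ u⁻¹ Iw^β`. -/
def iwH (β : ℕ) : Set (Gn p n × Gn p n) := {h | uElt p n * iota h ∈ iwSet p n β}

lemma mem_Iw_of_upper {g : G p n} (h : ∀ i j, j < i → g.1 i j = 0) : g ∈ Iw p n :=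
  (mem_Iw_iff g).2 fun i j hij => by simp [h i j hij]

lemma uElt_mem_Iw : uElt p n ∈ Iw p n := by
  refine mem_Iw_of_upper fun i j hij => ?_
  induction i using Fin.addCases with
  | left i =>
    induction j using Fin.addCases with
    | left j =>
      have : i ≠ j := fun h => by simp [h] at hij
      change blk _ _ _ _ _ _ = _
      simp [blk, this]
    | right j =>
      exfalso
      simp only [Fin.lt_def, Fin.val_castAdd, Fin.val_natAdd] at hij
      omega
  | right i =>
    induction j using Fin.addCases with
    | left j =>
      change Matrix.fromBlocks _ _ _ _ (finSumFinEquiv.symm _) (finSumFinEquiv.symm _) = _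
      rw [finSumFinEquiv_symm_apply_natAdd, finSumFinEquiv_symm_apply_castAdd]
      rfl
    | right j =>
      have : i ≠ j := fun h => by simp [h] at hij
      change Matrix.fromBlocks _ _ _ _ (finSumFinEquiv.symm _) (finSumFinEquiv.symm _) = _
      rw [finSumFinEquiv_symm_apply_natAdd, finSumFinEquiv_symm_apply_natAdd]
      simp [this]

lemma iota_mem_Iw {h : Gn p n × Gn p n} (hh : h ∈ iwH p n 1) : iota h ∈ Iw p n := by
  obtain ⟨k, hk, t, m, ⟨m', hm', rfl⟩, e⟩ := hh
  have e' : iota h = (uElt p n)⁻¹ * (k * torus t * (m' * uElt p n)) := by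
    rw [← e]; group
  rw [e']
  have h1 : k ∈ Iw p n := (mem_Iw_iff k).2 fun i j hij => by simpa using hk.2.2 i j hij
  have h2 : torus t ∈ Iw p n := mem_Iw_of_upper fun i j hij => by
    simp [torus, Matrix.diagonal_apply_ne _ hij.ne']
  have h3 : m' ∈ Iw p n := mem_Iw_of_upper hm'.2.1
  exact mul_mem (inv_mem uElt_mem_Iw) (mul_mem (mul_mem h1 h2) (mul_mem h3 uElt_mem_Iw))

/-- The matrix coordinates on `Iw`. -/
def iwCoord (g : Iw p n) : Fin (n + n) → Fin (n + n) → ℚ_[p] :=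
  fun i j => ((g.1.1 i j : ℤ_[p]) : ℚ_[p])

variable (p) in
/-- The coordinate on `ℤ_p^×`. -/
def zpCoord (z : ℤ_[p]ˣ) : ℚ_[p] := ((z : ℤ_[p]) : ℚ_[p])

/-- Right multiplication by an integral matrix. -/
def rightMulCLM {m : ℕ} (k : Matrix (Fin m) (Fin m) ℤ_[p]) :
    (Fin m → Fin m → ℚ_[p]) →L[ℚ_[p]] (Fin m → Fin m → ℚ_[p]) :=
  LinearMap.mkContinuous
    { toFun := fun M i j => ∑ l, M i l * ((k l j : ℤ_[p]) : ℚ_[p])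
      map_add' := fun M M' => by ext i j; simp [add_mul, Finset.sum_add_distrib]
      map_smul' := fun c M => by ext i j; simp [Finset.mul_sum, mul_assoc] } 1 (fun M => by
    rw [one_mul]
    refine (pi_norm_le_iff_of_nonneg (norm_nonneg _)).2 fun i =>
      (pi_norm_le_iff_of_nonneg (norm_nonneg _)).2 fun j => ?_
    change ‖∑ l, M i l * ((k l j : ℤ_[p]) : ℚ_[p])‖ ≤ ‖M‖
    refine IsUltrametricDist.norm_sum_le_of_forall_le_of_nonneg (norm_nonneg M) fun l _ => ?_
    rw [norm_mul]
    exact (mul_le_of_le_one_right (norm_nonneg _) (PadicInt.norm_le_one _)).trans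
      ((norm_le_pi_norm (M i) l).trans (norm_le_pi_norm M i)))

lemma norm_rightMulCLM_le {m : ℕ} (k : Matrix (Fin m) (Fin m) ℤ_[p]) : ‖rightMulCLM k‖ ≤ 1 :=
  LinearMap.mkContinuous_norm_le _ zero_le_one _

lemma iwCoord_mul (g k : Iw p n) : iwCoord (g * k) = rightMulCLM k.1.1 (iwCoord g) := by
  funext i j
  change ((((g.1.1 * k.1.1 : Matrix _ _ ℤ_[p]) i j : ℤ_[p])) : ℚ_[p]) =
    ∑ l, ((g.1.1 i l : ℤ_[p]) : ℚ_[p]) * ((k.1.1 l j : ℤ_[p]) : ℚ_[p])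
  rw [Matrix.mul_apply]
  exact coe_sum_mul _ _

end Groups

/-! ### Characters, analytic induction and distributions -/

section Induction

variable {p : ℕ} [Fact p.Prime] {n : ℕ} {A : Type*} [NormedCommRing A] [NormedAlgebra ℚ_[p] A]

/-- The analytic induction `𝒜_χ`: locally analytic `f : Iw → A` with `f(k t g) = χ(t) f(g)` for
`k ∈ N̄(pℤ_p)`, `t ∈ T(ℤ_p)`, where `χ = (χ₁, …, χ_{2n})` is a character of `T(ℤ_p)`. -/
def anInd (χ : Fin (n + n) → (ℤ_[p]ˣ →* Aˣ)) : Submodule A (Iw p n → A) where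
  carrier := {f | f ∈ locAn p (iwCoord (p := p) (n := n)) A ∧
    ∀ k ∈ lowerUnip p n 1, ∀ (t : Fin (n + n) → ℤ_[p]ˣ) (g g' : Iw p n),
      g'.1 = k * torus t * g.1 → f g' = ((∏ i, χ i (t i) : Aˣ) : A) * f g}
  zero_mem' := ⟨zero_mem _, by simp⟩
  add_mem' := fun {f f'} h h' => ⟨add_mem h.1 h'.1, fun k hk t g g' e => by
    simp only [Pi.add_apply, h.2 k hk t g g' e, h'.2 k hk t g g' e, mul_add]⟩
  smul_mem' := fun a f h => ⟨Submodule.smul_mem _ a h.1, fun k hk t g g' e => by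
    simp only [Pi.smul_apply, smul_eq_mul, h.2 k hk t g g' e]; ring⟩

/-- `𝒟_χ`, the continuous `A`-linear dual of `𝒜_χ`. -/
abbrev DistIw (χ : Fin (n + n) → (ℤ_[p]ˣ →* Aˣ)) : Submodule A (anInd χ →ₗ[A] A) :=
  Dist p (iwCoord (p := p) (n := n)) (anInd χ)

variable (p A) in
/-- `𝒜(ℤ_p^×, A)`. -/
abbrev AnZp : Submodule A (ℤ_[p]ˣ → A) := locAn p (zpCoord p) A

variable (p A) in
/-- `𝒟(ℤ_p^×, A)`. -/
abbrev DistZp : Submodule A (AnZp p A →ₗ[A] A) := Dist p (zpCoord p) (AnZp p A)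

/-- The action of `k ∈ Iw` on `𝒜_χ` by `(k * f)(g) = f(g k)`. -/
def iwAct (χ : Fin (n + n) → (ℤ_[p]ˣ →* Aˣ)) (k : Iw p n) : anInd χ →ₗ[A] anInd χ where
  toFun f := ⟨fun g => f.1 (g * k), by
    obtain ⟨⟨r, C, h⟩, h'⟩ := f.2
    refine ⟨⟨r, C, h.comp (fun g => g * k) (rightMulCLM k.1.1) (norm_rightMulCLM_le _)
      (fun g => iwCoord_mul g k)⟩, fun b hb t g g' e => h' b hb t _ _ ?_⟩
    simp [e, mul_assoc]⟩
  map_add' _ _ := rfl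
  map_smul' _ _ := rfl

/-- The dual action of `k ∈ Iw` on `𝒟_χ`: `(k * μ)(f) = μ(k⁻¹ * f)`. -/
def iwActDist (χ : Fin (n + n) → (ℤ_[p]ˣ →* Aˣ)) (k : Iw p n) : DistIw χ →ₗ[A] DistIw χ :=
  Dist.dual (iwAct χ k⁻¹) 1 fun r B f h => by
    rw [one_mul]
    exact h.comp (fun g => g * k⁻¹) (rightMulCLM (k⁻¹).1.1) (norm_rightMulCLM_le _)
      (fun g => iwCoord_mul g k⁻¹)

/-- The action of `h ∈ Iw_H^1` on `𝒟_χ`, through `ι : Iw_H^1 → Iw`. -/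
def iwHActDist (χ : Fin (n + n) → (ℤ_[p]ˣ →* Aˣ)) (h : iwH p n 1) : DistIw χ →ₗ[A] DistIw χ :=
  iwActDist χ ⟨iota h.1, iota_mem_Iw h.2⟩

lemma AnalyticBound.zpComp {k : ℕ} {C : ℝ} {f : ℤ_[p]ˣ → A} (c : ℤ_[p]ˣ)
    (h : AnalyticBound p (zpCoord p) k C f) :
    AnalyticBound p (zpCoord p) k C (fun z => f (c * z)) := by
  refine h.comp (fun z => c * z) (ContinuousLinearMap.mul ℚ_[p] ℚ_[p] (zpCoord p c)) ?_ ?_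
  · exact (ContinuousLinearMap.opNorm_mul_apply_le ℚ_[p] ℚ_[p] _).trans (PadicInt.norm_le_one _)
  · intro z
    simp [zpCoord]

/-- The action of `h = (h₁, h₂) ∈ H(ℤ_p)` on `𝒜(ℤ_p^×, A)` attached to a character `sw`:
`(h * f)(z) = sw(det h₂) f((det h₂ / det h₁) z)`. -/
def zpAct (sw : ℤ_[p]ˣ →* Aˣ) (h : Gn p n × Gn p n) : AnZp p A →ₗ[A] AnZp p A where
  toFun f := ⟨(sw h.2.det : A) • fun z => f.1 (h.2.det / h.1.det * z), by
    obtain ⟨r, C, hf⟩ := f.2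
    exact ⟨r, _, (hf.zpComp _).smul _⟩⟩
  map_add' f f' := Subtype.ext (smul_add (sw h.2.det : A) _ _)
  map_smul' a f := Subtype.ext (smul_comm (sw h.2.det : A) a _)

/-- The dual action of `H(ℤ_p)` on `𝒟(ℤ_p^×, A)`: `(h * μ)(f) = μ(h⁻¹ * f)`. -/
def zpActDist (sw : ℤ_[p]ˣ →* Aˣ) (h : Gn p n × Gn p n) : DistZp p A →ₗ[A] DistZp p A :=
  Dist.dual (zpAct sw h⁻¹) ‖(sw h⁻¹.2.det : A)‖ fun _ _ _ hf => (hf.zpComp _).smul _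

/-- `μ` is supported on `Iw^β`: `μ(f) = μ(f|_{Iw^β})`, where `f|_{Iw^β}` is `f` on `Iw^β` and zero
elsewhere. -/
def IsSupportedOn (χ : Fin (n + n) → (ℤ_[p]ˣ →* Aˣ)) (β : ℕ) (μ : DistIw χ) : Prop :=
  ∀ f f' : anInd χ, (∀ g : Iw p n, g.1 ∈ iwSet p n β → f'.1 g = f.1 g) →
    (∀ g : Iw p n, g.1 ∉ iwSet p n β → f'.1 g = 0) → μ.1 f = μ.1 f'

end Induction

/-! ### Algebraic weights and algebraic induction -/

section Algebraic

variable {p : ℕ} [Fact p.Prime] {n : ℕ}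

/-- The index of the entry `λ_n` of a weight. -/
def idxN (n : ℕ) [NeZero n] : Fin (n + n) := Fin.castAdd n (Fin.rev 0)

/-- The index of the entry `λ_{n+1}` of a weight. -/
def idxN1 (n : ℕ) [NeZero n] : Fin (n + n) := Fin.natAdd n 0

/-- The index of the entry `λ_{i+1}` of a weight, for `0 ≤ i < n - 1`. -/
def idx (i : Fin (n - 1)) : Fin (n + n) := ⟨i.1, by omega⟩

/-- The index of the entry `λ_{i+2}` of a weight, for `0 ≤ i < n - 1`. -/
def idxS (i : Fin (n - 1)) : Fin (n + n) := ⟨i.1 + 1, by omega⟩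

/-- `lam = (λ₁, …, λ_{2n})` is dominant and pure with purity weight `w`. -/
def IsPureDominant (lam : Fin (n + n) → ℤ) (w : ℤ) : Prop :=
  Antitone lam ∧ ∀ i, lam i + lam (Fin.rev i) = w

/-- `Crit(λ) = {j : -λ_n ≤ j ≤ -λ_{n+1}}`. -/
def crit [NeZero n] (lam : Fin (n + n) → ℤ) : Set ℤ := Set.Icc (-lam (idxN n)) (-lam (idxN1 n))

variable (p) in
/-- The homomorphism `ℤ_p^× → L^×`. -/
def unitsHom (L : Type*) [NormedField L] [NormedAlgebra ℚ_[p] L] : ℤ_[p]ˣ →* Lˣ :=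
  Units.map ((algebraMap ℚ_[p] L).comp PadicInt.Coe.ringHom).toMonoidHom

variable (p) in
/-- The algebraic character `z ↦ z^m` of `ℤ_p^×`, with values in `L^×`. -/
def algChar (L : Type*) [NormedField L] [NormedAlgebra ℚ_[p] L] (m : ℤ) : ℤ_[p]ˣ →* Lˣ :=
  (zpowGroupHom m).comp (unitsHom p L)

/-- `f : GL_{2n}(ℤ_p) → L` is algebraic: a polynomial in the matrix entries and `det⁻¹`. -/
def IsAlgebraicFn {L : Type*} [NormedField L] [NormedAlgebra ℚ_[p] L] (f : G p n → L) : Prop :=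
  ∃ (P : MvPolynomial (Fin (n + n) × Fin (n + n)) L) (m : ℕ), ∀ g : G p n,
    f g * (unitsHom p L g.det : L) ^ m =
      MvPolynomial.eval (fun ij => algebraMap ℚ_[p] L ((g.1 ij.1 ij.2 : ℤ_[p]) : ℚ_[p])) P

lemma IsAlgebraicFn.mul_det {L : Type*} [NormedField L] [NormedAlgebra ℚ_[p] L] {f : G p n → L}
    (h : IsAlgebraicFn f) : ∃ m₀ : ℕ, ∀ m, m₀ ≤ m →
      ∃ P : MvPolynomial (Fin (n + n) × Fin (n + n)) L, ∀ g : G p n,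
        f g * (unitsHom p L g.det : L) ^ m =
          MvPolynomial.eval (fun ij => algebraMap ℚ_[p] L ((g.1 ij.1 ij.2 : ℤ_[p]) : ℚ_[p])) P := by
  obtain ⟨P, m₀, hP⟩ := h
  refine ⟨m₀, fun m hm => ?_⟩
  obtain ⟨r, rfl⟩ := Nat.exists_eq_add_of_le hm
  refine ⟨P * (Matrix.det (Matrix.of fun i j => MvPolynomial.X (i, j))) ^ r, fun g => ?_⟩
  rw [pow_add, ← mul_assoc, hP g, map_mul, map_pow]
  congr 2
  rw [RingHom.map_det]
  simp only [unitsHom, Units.coe_map, RingHom.toMonoidHom_eq_coe, MonoidHom.coe_coe,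
    Matrix.GeneralLinearGroup.val_det_apply]
  rw [RingHom.map_det]
  congr 1
  ext i j
  simp only [RingHom.mapMatrix_apply, Matrix.map_apply, Matrix.of_apply, MvPolynomial.eval_X]
  rfl

/-- The algebraic induction `V_λ(L)`: algebraic functions `f : GL_{2n}(ℤ_p) → L` with
`f(k t g) = λ(t) f(g)` for `k ∈ N̄(ℤ_p)` and `t ∈ T(ℤ_p)`. -/
def algInd (p : ℕ) [Fact p.Prime] (L : Type*) [NormedField L] [NormedAlgebra ℚ_[p] L]
    (lam : Fin (n + n) → ℤ) : Submodule L (G p n → L) where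
  carrier := {f | IsAlgebraicFn f ∧
    ∀ k ∈ lowerUnip p n 0, ∀ (t : Fin (n + n) → ℤ_[p]ˣ) (g : G p n),
      f (k * torus t * g) = ((∏ i, algChar p L (lam i) (t i) : Lˣ) : L) * f g}
  zero_mem' := ⟨⟨0, 0, by simp⟩, by simp⟩
  add_mem' := fun {f f'} h h' => by
    refine ⟨?_, fun k hk t g => by
      simp only [Pi.add_apply, h.2 k hk t g, h'.2 k hk t g, mul_add]⟩
    obtain ⟨m, hm⟩ := h.1.mul_det
    obtain ⟨m', hm'⟩ := h'.1.mul_det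
    obtain ⟨P, hP⟩ := hm _ (le_max_left m m')
    obtain ⟨P', hP'⟩ := hm' _ (le_max_right m m')
    exact ⟨P + P', max m m', fun g => by rw [Pi.add_apply, add_mul, hP, hP', map_add]⟩
  smul_mem' := fun a f h => by
    refine ⟨?_, fun k hk t g => by
      simp only [Pi.smul_apply, smul_eq_mul, h.2 k hk t g]; ring⟩
    obtain ⟨P, m, hP⟩ := h.1
    exact ⟨MvPolynomial.C a * P, m, fun g => by
      rw [Pi.smul_apply, smul_eq_mul, mul_assoc, hP, map_mul, MvPolynomial.eval_C]⟩

/-- The action of `k ∈ GL_{2n}(ℤ_p)` on `V_λ(L)`: `(k · f)(g) = f(g k)`. -/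
def algAct {L : Type*} [NormedField L] [NormedAlgebra ℚ_[p] L] (lam : Fin (n + n) → ℤ)
    (k : G p n) : algInd p L lam →ₗ[L] algInd p L lam where
  toFun f := ⟨fun g => f.1 (g * k), by
    obtain ⟨⟨P, m, hP⟩, h⟩ := f.2
    refine ⟨⟨MvPolynomial.C ((unitsHom p L k.det : L)⁻¹ ^ m) * MvPolynomial.bind₁ (fun ij =>
      ∑ l, MvPolynomial.X (ij.1, l) *
        MvPolynomial.C (algebraMap ℚ_[p] L ((k.1 l ij.2 : ℤ_[p]) : ℚ_[p]))) P, m, fun g => ?_⟩,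
      fun b hb t g => ?_⟩
    · have hk : (unitsHom p L k.det : L) ≠ 0 := Units.ne_zero _
      have := hP (g * k)
      rw [map_mul, map_mul, Units.val_mul, mul_pow] at this
      rw [map_mul, MvPolynomial.eval_C, ← MvPolynomial.aeval_eq_eval, MvPolynomial.aeval_bind₁]
      have e : (fun ij : Fin (n + n) × Fin (n + n) => MvPolynomial.aeval
          (fun ij : Fin (n + n) × Fin (n + n) =>
            algebraMap ℚ_[p] L ((g.1 ij.1 ij.2 : ℤ_[p]) : ℚ_[p]))
          (∑ l, MvPolynomial.X (ij.1, l) *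
            MvPolynomial.C (algebraMap ℚ_[p] L ((k.1 l ij.2 : ℤ_[p]) : ℚ_[p])))) =
          fun ij => algebraMap ℚ_[p] L ((((g * k).1 ij.1 ij.2 : ℤ_[p])) : ℚ_[p]) := by
        funext ij
        rw [Units.val_mul, Matrix.mul_apply, coe_sum_mul, map_sum, map_sum]
        simp [MvPolynomial.aeval_eq_eval]
      rw [e, MvPolynomial.aeval_eq_eval]
      change _ = _ * MvPolynomial.eval _ P
      rw [← this, inv_pow]
      field_simp
    · have := h b hb t (g * k)
      rwa [← mul_assoc] at this⟩
  map_add' _ _ := rfl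
  map_smul' _ _ := rfl

/-- The dual action of `h ∈ H(ℤ_p)` on `V_λ^∨(L)`: `(h · μ)(f) = μ(h⁻¹ · f)`. -/
def algActDual {L : Type*} [NormedField L] [NormedAlgebra ℚ_[p] L] (lam : Fin (n + n) → ℤ)
    (h : Gn p n × Gn p n) (μ : Module.Dual L (algInd p L lam)) : Module.Dual L (algInd p L lam) :=
  μ ∘ₗ algAct lam (iota h)⁻¹

/-- The restriction of functions from `GL_{2n}(ℤ_p)` to `Iw` embeds `V_λ(L)` into `𝒜_λ`, and `r`
is the dual `𝒟_λ → V_λ^∨(L)` of this inclusion. -/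
def IsRestrictionDual {L : Type*} [NormedField L] [NormedAlgebra ℚ_[p] L] (lam : Fin (n + n) → ℤ)
    (r : DistIw (fun i => algChar p L (lam i)) →ₗ[L] Module.Dual L (algInd p L lam)) : Prop :=
  ∃ inc : algInd p L lam →ₗ[L] anInd (fun i => algChar p L (lam i)),
    (∀ f (g : Iw p n), (inc f).1 g = f.1 g.1) ∧ ∀ μ f, r μ f = μ.1 (inc f)

/-! ### Branching vectors and the maps `v_Ω`, `κ_Ω` -/

/-- The weight `α_i = (1^i, 0^{2n-2i}, (-1)^i)`, used for `1 ≤ i ≤ n - 1`. -/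
def alphaWt (n i : ℕ) : Fin (n + n) → ℤ := fun k =>
  if k.1 < i then 1 else if n + n - i ≤ k.1 then -1 else 0

/-- The weight `α_n = (1^n, 0^n)`. -/
def alphaTop (n : ℕ) : Fin (n + n) → ℤ := fun k => if k.1 < n then 1 else 0

variable (p n) in
/-- A choice of normalised branching vectors: `v_(i) ∈ V_{α_i}(ℚ_p)` fixed by `H(ℤ_p)` for
`1 ≤ i ≤ n - 1` (the field `v i` is `v_(i+1)`), and `v_(n),1, v_(n),2 ∈ V_{α_n}(ℚ_p)` on which
`(h₁, h₂) ∈ H(ℤ_p)` acts by `det h₁`, `det h₂`; all take the value `1` at `u`. -/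
structure BranchingVectors where
  v : ∀ i : Fin (n - 1), algInd p ℚ_[p] (alphaWt n (i.1 + 1))
  v1 : algInd p ℚ_[p] (alphaTop n)
  v2 : algInd p ℚ_[p] (alphaTop n)
  v_inv : ∀ i h, algAct _ (iota h) (v i) = v i
  v1_act : ∀ h, algAct _ (iota h) v1 = (unitsHom p ℚ_[p] h.1.det : ℚ_[p]) • v1
  v2_act : ∀ h, algAct _ (iota h) v2 = (unitsHom p ℚ_[p] h.2.det : ℚ_[p]) • v2
  v_norm : ∀ i, (v i).1 (uElt p n) = 1
  v1_norm : v1.1 (uElt p n) = 1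
  v2_norm : v2.1 (uElt p n) = 1

/-- An element of `ℚ_p` of norm one, as a unit of `ℤ_p`. -/
def toUnit (x : ℚ_[p]) : ℤ_[p]ˣ := open Classical in if h : ‖x‖ = 1 then PadicInt.mkUnits h else 1

/-- The classical branching vector
`v_{λ,j} = ∏_{i<n} v_(i)^{λ_i - λ_{i+1}} · v_(n),1^{-λ_{n+1}-j} · v_(n),2^{λ_n+j} · det^{λ_{n+1}}`. -/
def classicalVec [NeZero n] (V : BranchingVectors p n) (lam : Fin (n + n) → ℤ) (j : ℤ)
    (g : G p n) : ℚ_[p] :=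
  (∏ i, (V.v i).1 g ^ (lam (idx i) - lam (idxS i))) * V.v1.1 g ^ (-lam (idxN1 n) - j) *
    V.v2.1 g ^ (lam (idxN n) + j) * ((g.det : ℤ_[p]) : ℚ_[p]) ^ lam (idxN1 n)

/-- The function `w_χ` on `N^1(ℤ_p)`:
`w_χ = χ_{n+1}(det) ∏_{i<n} (χ_i / χ_{i+1})(v_(i)) · χ_{n+1}(v_(n),1)⁻¹ · χ_n(v_(n),2)`. -/
def wChar {A : Type*} [NormedCommRing A] [NeZero n] (V : BranchingVectors p n)
    (χ : Fin (n + n) → (ℤ_[p]ˣ →* Aˣ)) (g : G p n) : Aˣ :=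
  χ (idxN1 n) g.det *
    (∏ i, χ (idx i) (toUnit ((V.v i).1 g)) / χ (idxS i) (toUnit ((V.v i).1 g))) *
    (χ (idxN1 n) (toUnit (V.v1.1 g)))⁻¹ * χ (idxN n) (toUnit (V.v2.1 g))

/-- `v : 𝒜(ℤ_p^×, A) → 𝒜_χ` is the map `v_Ω`: on `N(ℤ_p)`, the function `v(f)` is
`g ↦ w_χ(g) f(v_(n),2(g) / v_(n),1(g))` on `N^1(ℤ_p)` and zero outside `N^1(ℤ_p)`. -/
def IsBranchingMap {A : Type*} [NormedCommRing A] [NormedAlgebra ℚ_[p] A] [NeZero n]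
    (V : BranchingVectors p n) (χ : Fin (n + n) → (ℤ_[p]ˣ →* Aˣ))
    (v : AnZp p A →ₗ[A] anInd χ) : Prop :=
  ∀ (f : AnZp p A) (g : Iw p n), g.1 ∈ upperUnip p n 0 →
    (g.1 ∈ unipCoset p n 1 →
      (v f).1 g = (wChar V χ g.1 : A) * f.1 (toUnit (V.v2.1 g.1) / toUnit (V.v1.1 g.1))) ∧
    (g.1 ∉ unipCoset p n 1 → (v f).1 g = 0)

/-- `κ : 𝒟_χ → 𝒟(ℤ_p^×, A)` is the map `κ_Ω`, the dual of `v_Ω`. -/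
def IsKappa {A : Type*} [NormedCommRing A] [NormedAlgebra ℚ_[p] A] [NeZero n]
    (V : BranchingVectors p n) (χ : Fin (n + n) → (ℤ_[p]ˣ →* Aˣ))
    (κ : DistIw χ →ₗ[A] DistZp p A) : Prop :=
  ∃ v : AnZp p A →ₗ[A] anInd χ, IsBranchingMap V χ v ∧ ∀ μ f, (κ μ).1 f = μ.1 (v f)

end Algebraic

end BranchingLaw

end

open BranchingLaw

/-! The algebraic half of the argument rests on the open orbit of H through u. The coset N(pℤ_p)u
lies in B̄(ℤ_p) u H(ℤ_p) (`exists_lowerTri_mul_uElt_mul_iota`). Hence an algebraic function with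
given left weight and given H-character is determined on Iw^1 by its value at u. It is then
determined everywhere, because Iw^1 contains all matrices congruent to u mod p, and these are
Zariski dense (`algInd_eq_zero_of_apply_uElt`). This gives uniqueness of the branching vectors and
the bound one for the dimension of the classical eigenspace.

Existence is explicit. The group H centralises diag(0,1), so g diag(0,1) g⁻¹ is right H-invariant in
g, and its top right i × i minor is v_(i) up to the order of the columns. The vectors v_(n),1 and
v_(n),2 are the minors of the two upper n × n blocks of g. Elements of N^β are congruent to u mod
p^β, which gives the congruences to 1.

The weights of these minors telescope, and purity makes the total weight of w_χ equal to χ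
(`weight_identity`). So w_χ extends equivariantly from N^1 to Iw^1, the quotient v_(n),2/v_(n),1 is
left invariant, and v_Ω(f) is w_χ · (f ∘ quotient) on Iw^1, extended by zero (`isBranchingMap_iff`).
At a classical weight, multiplying by the j-th power of the quotient gives v_{λ,j} on Iw^1
(`classicalFn_eq_wChar`); this is the right-hand square. Equivariance is read off from the effect of
right translation by H on w_χ and on the quotient.

The analytic half shows that the maps exist. Continuous characters of ℤ_p^× are locally analytic
(`LocAnAt.of_continuous_char`), and weighted compositions with locally analytic data are bounded
(`exists_analyticBound_weighted_comp`), so κ_Ω is defined. For sp_λ one must know that x(μ(F))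
depends only on x ∘ F, that is, that μ sends functions with values in ker x into ker x. Such
functions are limits of finite sums of scalar functions with coefficients in ker x, and ker x is
closed (`Dist.apply_mem_of_ideal_valued`). With sp_λ characterised by sp(μ)(x ∘ F) = x(μ(F)), the
left-hand square only compares test functions. -/

noncomputable section
namespace BranchingLaw

/-! ### Locally analytic families -/

section LocallyAnalyticFamilies

open scoped NNReal ENNReal

/-- All re-expansions of a power series at centres close to `a` are dominated by one convergent
double series. The bound `S` therefore does not depend on the new centre `b`, which is what a
compactness argument over the centres needs. -/
lemma exists_uniform_changeOrigin {𝕜 E F : Type*} [NontriviallyNormedField 𝕜]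
    [NormedAddCommGroup E] [NormedSpace 𝕜 E] [NormedAddCommGroup F] [NormedSpace 𝕜 F]
    [CompleteSpace F] {Ψ : E → F} {a : E} (h : AnalyticAt 𝕜 Ψ a) :
    ∃ ρ : ℝ, 0 < ρ ∧ ∃ S : ℝ, 0 ≤ S ∧ ∀ b, ‖b - a‖ ≤ ρ → ∃ q : FormalMultilinearSeries 𝕜 E F,
      (∀ m, ‖q m‖ * ρ ^ m ≤ S) ∧
      ∀ h, ‖h‖ < ρ → HasSum (fun m => q m fun _ => h) (Ψ (b + h)) := by
  obtain ⟨P, r, hP⟩ := h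
  obtain ⟨s, hs0, hs⟩ := ENNReal.lt_iff_exists_nnreal_btwn.1 hP.r_pos
  -- Half of a radius `s < r`: the shift of the centre and the new variable may each have size `ρ`
  -- while their sum stays in the disc of convergence.
  set ρ : ℝ≥0 := s / 2 with hρ
  have hρ0 : 0 < ρ := by
    have : 0 < s := by exact_mod_cast hs0
    positivity
  have hρr : ((ρ : ℝ≥0∞) + ρ) < r := by
    rw [← ENNReal.coe_add, hρ, add_halves]
    exact hs
  have hsum := P.changeOriginSeries_summable_aux₁ (r := ρ) (r' := ρ) (hρr.trans_le hP.r_le)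
  refine ⟨ρ, by exact_mod_cast hρ0, _, NNReal.coe_nonneg
    (∑' s : Σ k l : ℕ, { s : Finset (Fin (k + l)) // s.card = l },
      ‖P (s.1 + s.2.1)‖₊ * ρ ^ s.2.1 * ρ ^ s.1), fun b hb => ⟨P.changeOrigin (b - a), ?_, ?_⟩⟩
  · intro m
    have hb' : ‖b - a‖₊ ≤ ρ := by exact_mod_cast hb
    have hlt : (ρ : ℝ≥0∞) < P.radius := (le_self_add.trans_lt hρr).trans_le hP.r_le
    have h1 := P.nnnorm_changeOrigin_le (x := b - a) m
      (lt_of_le_of_lt (by exact_mod_cast hb') hlt)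
    have hs2 := P.changeOriginSeries_summable_aux₂ hlt m
    have h2 : ‖P.changeOrigin (b - a) m‖₊ ≤
        ∑' s : Σ l : ℕ, { s : Finset (Fin (m + l)) // s.card = l }, ‖P (m + s.1)‖₊ * ρ ^ s.1 := by
      have hle : ∀ s : Σ l : ℕ, { s : Finset (Fin (m + l)) // s.card = l },
          ‖P (m + s.1)‖₊ * ‖b - a‖₊ ^ s.1 ≤ ‖P (m + s.1)‖₊ * ρ ^ s.1 := fun s => by gcongr
      exact h1.trans ((NNReal.summable_of_le hle hs2).tsum_le_tsum hle hs2)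
    have h3 : ‖P.changeOrigin (b - a) m‖₊ * ρ ^ m ≤
        ∑' s : Σ l : ℕ, { s : Finset (Fin (m + l)) // s.card = l },
          ‖P (m + s.1)‖₊ * ρ ^ s.1 * ρ ^ m := by
      rw [NNReal.tsum_mul_right]
      gcongr
    have h4 := (NNReal.summable_sigma.1 hsum).2
    have h5 := h4.le_tsum m (fun _ _ => zero_le)
    have h6 := h3.trans (h5.trans_eq (hsum.tsum_sigma' (NNReal.summable_sigma.1 hsum).1).symm)
    exact_mod_cast h6
  · intro h hh
    have hb' : ‖b - a‖₊ ≤ ρ := by exact_mod_cast hb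
    have := hP.changeOrigin (y := b - a)
      (lt_of_le_of_lt (by exact_mod_cast hb') (le_self_add.trans_lt hρr))
    rw [add_sub_cancel] at this
    refine this.hasSum ?_
    rw [Metric.mem_eball, edist_zero_right, ← ofReal_norm]
    refine lt_of_lt_of_le (b := (ρ : ℝ≥0∞)) ?_ ?_
    · rw [ENNReal.ofReal_lt_coe_iff (norm_nonneg _)]
      exact hh
    · refine ENNReal.le_sub_of_add_le_right ENNReal.coe_ne_top ?_
      refine le_trans ?_ hρr.le
      gcongr

variable {p : ℕ} [Fact p.Prime] {X E A Y : Type*}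
  [NormedAddCommGroup E] [NormedSpace ℚ_[p] E] [NormedCommRing A] [NormedAlgebra ℚ_[p] A]
  [NormedAddCommGroup Y] [NormedSpace ℚ_[p] Y]

lemma inv_prime_lt_one : ((p : ℝ)⁻¹) < 1 :=
  inv_lt_one_of_one_lt₀ (by exact_mod_cast (Fact.out : p.Prime).one_lt)

lemma inv_prime_pos : 0 < ((p : ℝ)⁻¹) :=
  inv_pos.2 (by exact_mod_cast (Fact.out : p.Prime).pos)

/-- A family of functions which locally factors, through linear maps of bounded norm, over an
analytic map to a Banach space is uniformly bounded. -/
theorem exists_analyticBound_family [CompleteSpace Y] {ι : Type*} {e : X → E}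
    (hc : IsCompact (Set.range e)) (f : ι → X → A) (B : ι → ℝ) (hB : ∀ i, 0 ≤ B i)
    (h : ∀ x, ∃ Ψ : E → Y, AnalyticAt ℚ_[p] Ψ (e x) ∧ ∃ Λ : ι → Y →L[ℚ_[p]] A,
      (∀ i, ‖Λ i‖ ≤ B i) ∧ ∀ᶠ z in 𝓝 (e x), ∀ y, e y = z → ∀ i, f i y = Λ i (Ψ z)) :
    ∃ k : ℕ, ∃ C : ℝ, 0 ≤ C ∧ ∀ i, AnalyticBound p e k (C * B i) (f i) := by
  choose Ψ hΨ Λ hΛ hf using h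
  have H : ∀ x, ∃ ρ : ℝ, 0 < ρ ∧ ∃ S : ℝ, 0 ≤ S ∧ ∀ b, ‖b - e x‖ ≤ ρ →
      ∃ q : FormalMultilinearSeries ℚ_[p] E Y, (∀ m, ‖q m‖ * ρ ^ m ≤ S) ∧
      ∀ y, ‖e y - b‖ < ρ → HasSum (fun m => q m fun _ => e y - b) (Ψ x (e y)) ∧
        ∀ i, f i y = Λ x i (Ψ x (e y)) := by
    intro x
    obtain ⟨ρ, hρ, S, hS, hq⟩ := exists_uniform_changeOrigin (hΨ x)
    obtain ⟨ε, hε, hfε⟩ := Metric.eventually_nhds_iff.1 (hf x)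
    -- With `ε / 3`, a point near `b` is at distance less than `2 ε / 3` from `e x` by the triangle
    -- inequality, hence inside the region where the factorisation holds.
    refine ⟨min ρ (ε / 3), by positivity, S, hS, fun b hb => ?_⟩
    obtain ⟨q, hq1, hq2⟩ := hq b (hb.trans (min_le_left _ _))
    refine ⟨q, fun m => le_trans ?_ (hq1 m), fun y hy => ⟨?_, fun i => hfε ?_ y rfl i⟩⟩
    · gcongr
      exact min_le_left _ _
    · have := hq2 (e y - b) (hy.trans_le (min_le_left _ _))
      rwa [add_sub_cancel] at this
    · rw [dist_eq_norm, ← sub_add_sub_cancel _ b]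
      refine (norm_add_le _ _).trans_lt ?_
      have h1 := hy.trans_le (min_le_right _ _)
      have h2 := hb.trans (min_le_right _ _)
      linarith
  choose ρ hρ S hS hq using H
  obtain ⟨t, ht⟩ := hc.elim_finite_subcover_image (b := Set.univ) (c := fun x => Metric.ball (e x) (ρ x))
    (fun x _ => Metric.isOpen_ball) (by
      rintro _ ⟨x, rfl⟩
      exact Set.mem_iUnion₂.2 ⟨x, trivial, Metric.mem_ball_self (hρ x)⟩)
  obtain ⟨-, htf, ht⟩ := ht
  -- The terms are only bounded on the radius `ρ`. Passing to at most half of it gains a factor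
  -- `(1/2)^m`, which makes them tend to zero.
  have hk : ∃ k : ℕ, ∀ x ∈ t, ((p : ℝ)⁻¹) ^ k < ρ x / 2 := by
    have : ∀ᶠ k : ℕ in atTop, ∀ x ∈ t, ((p : ℝ)⁻¹) ^ k < ρ x / 2 := by
      rw [Filter.eventually_all_finite htf]
      intro x _
      exact (tendsto_pow_atTop_nhds_zero_of_lt_one inv_prime_pos.le
        (inv_prime_lt_one (p := p))).eventually_lt_const (half_pos (hρ x))
    exact this.exists
  obtain ⟨k, hk⟩ := hk
  obtain ⟨C, hC⟩ : ∃ C : ℝ, ∀ x ∈ t, S x ≤ C := by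
    obtain ⟨C, hC⟩ := (htf.image S).bddAbove
    exact ⟨C, fun x hx => hC ⟨x, hx, rfl⟩⟩
  refine ⟨k, max C 0, le_max_right _ _, fun i x => ?_⟩
  obtain ⟨x₀, hx₀, hx⟩ := Set.mem_iUnion₂.1 (ht ⟨x, rfl⟩)
  rw [Metric.mem_ball, dist_eq_norm] at hx
  obtain ⟨q, hq1, hq2⟩ := hq x₀ (e x) hx.le
  have key : ∀ m, ‖(Λ x₀ i).compFormalMultilinearSeries q m‖ * (((p : ℝ)⁻¹) ^ k) ^ m ≤
      max C 0 * B i * (1 / 2) ^ m := fun m => by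
    have h1 : ‖(Λ x₀ i).compFormalMultilinearSeries q m‖ ≤ B i * ‖q m‖ :=
      ((Λ x₀ i).norm_compContinuousMultilinearMap_le (q m)).trans (by gcongr; exact hΛ x₀ i)
    have h2 : ‖q m‖ * ρ x₀ ^ m ≤ max C 0 := (hq1 m).trans ((hC x₀ hx₀).trans (le_max_left _ _))
    have h0 : 0 ≤ B i := hB i
    have h3 : (((p : ℝ)⁻¹) ^ k) ^ m ≤ (ρ x₀ * (1 / 2)) ^ m := by
      have := (inv_prime_pos (p := p)).le
      gcongr
      rw [mul_one_div]
      exact (hk x₀ hx₀).le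
    calc _ ≤ (B i * ‖q m‖) * (ρ x₀ * (1 / 2)) ^ m := by gcongr
      _ = B i * (‖q m‖ * ρ x₀ ^ m) * (1 / 2) ^ m := by rw [mul_pow]; ring
      _ ≤ B i * max C 0 * (1 / 2) ^ m := by gcongr
      _ = _ := by ring
  refine ⟨(Λ x₀ i).compFormalMultilinearSeries q, fun m => (key m).trans ?_,
    squeeze_zero (fun m => ?_) key ?_, fun y hy => ?_⟩
  · exact mul_le_of_le_one_right (mul_nonneg (le_max_right _ _) (hB i))
      (pow_le_one₀ (by norm_num) (by norm_num))
  · have := (inv_prime_pos (p := p)).le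
    positivity
  · simpa using (tendsto_pow_atTop_nhds_zero_of_lt_one (r := (1 / 2 : ℝ)) (by norm_num)
      (by norm_num)).const_mul (max C 0 * B i)
  · have hlt : ‖e y - e x‖ < ρ x₀ := by
      have := hk x₀ hx₀
      have := hρ x₀
      linarith
    obtain ⟨h1, h2⟩ := hq2 y hlt
    rw [h2 i]
    exact h1.map (Λ x₀ i) (Λ x₀ i).continuous

/-- `f` is near `x` the restriction of an analytic function on the ambient space. -/
def LocAnAt (p : ℕ) [Fact p.Prime] {X E Y : Type*} [NormedAddCommGroup E] [NormedSpace ℚ_[p] E]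
    [NormedAddCommGroup Y] [NormedSpace ℚ_[p] Y] (e : X → E) (f : X → Y) (x : X) : Prop :=
  ∃ F : E → Y, AnalyticAt ℚ_[p] F (e x) ∧ ∀ᶠ z in 𝓝 (e x), ∀ y, e y = z → f y = F z

/-- The pointwise notion is the one that is easy to verify. Compactness converts it into a uniform
radius and a uniform bound, by the result on families applied to a single function. -/
lemma LocAnAt.mem_locAn [CompleteSpace A] {e : X → E} (hc : IsCompact (Set.range e)) {f : X → A}
    (h : ∀ x, LocAnAt p e f x) : f ∈ locAn p e A := by
  obtain ⟨k, C, -, H⟩ := exists_analyticBound_family (ι := Unit) (Y := A) hc (fun _ => f)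
    (fun _ => ‖ContinuousLinearMap.id ℚ_[p] A‖) (fun _ => norm_nonneg _) (fun x => by
      obtain ⟨F, hF, hf⟩ := h x
      exact ⟨F, hF, fun _ => ContinuousLinearMap.id _ _, fun _ => le_rfl, by
        filter_upwards [hf] with z hz y hy _ using hz y hy⟩)
  exact ⟨k, _, H ()⟩

end LocallyAnalyticFamilies
end BranchingLaw
end

noncomputable section
namespace BranchingLaw

/-! ### Universal power series and boundedness of weighted composition operators. -/

section WeightedComposition

open scoped NNReal ENNReal

variable {p : ℕ} [Fact p.Prime] {X X' E E' A Y : Type*}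
  [NormedAddCommGroup E] [NormedSpace ℚ_[p] E] [NormedAddCommGroup E'] [NormedSpace ℚ_[p] E']
  [NormedCommRing A] [NormedAlgebra ℚ_[p] A] [NormedAddCommGroup Y] [NormedSpace ℚ_[p] Y]

/-- The bounded families of homogeneous multilinear forms. -/
def BoundedSeries (p : ℕ) [Fact p.Prime] (E' A : Type*) [NormedAddCommGroup E']
    [NormedSpace ℚ_[p] E'] [NormedCommRing A] [NormedAlgebra ℚ_[p] A] : Type _ :=
  lp (fun m : ℕ => ContinuousMultilinearMap ℚ_[p] (fun _ : Fin m => E') A) ∞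

instance : NormedAddCommGroup (BoundedSeries p E' A) :=
  inferInstanceAs (NormedAddCommGroup
    (lp (fun m : ℕ => ContinuousMultilinearMap ℚ_[p] (fun _ : Fin m => E') A) ∞))

instance : NormedSpace ℚ_[p] (BoundedSeries p E' A) :=
  inferInstanceAs (NormedSpace ℚ_[p]
    (lp (fun m : ℕ => ContinuousMultilinearMap ℚ_[p] (fun _ : Fin m => E') A) ∞))

/-- The homogeneous term of degree `m`. -/
def BoundedSeries.term (m : ℕ) : BoundedSeries p E' A →L[ℚ_[p]]
    ContinuousMultilinearMap ℚ_[p] (fun _ : Fin m => E') A :=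
  lp.evalCLM ℚ_[p] (fun m : ℕ => ContinuousMultilinearMap ℚ_[p] (fun _ : Fin m => E') A) ∞ m

variable (p E' A) in
/-- The universal power series: `m`-homogeneous terms are evaluated at a point. -/
def evalSeries : FormalMultilinearSeries ℚ_[p] E' (BoundedSeries p E' A →L[ℚ_[p]] A) := fun m =>
  (BoundedSeries.term m).flipMultilinear

lemma evalSeries_apply (m : ℕ) (v : Fin m → E') (Q : BoundedSeries p E' A) :
    evalSeries p E' A m v Q = BoundedSeries.term m Q v := rfl

lemma norm_evalSeries_le (m : ℕ) : ‖evalSeries p E' A m‖ ≤ 1 := by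
  refine ContinuousMultilinearMap.opNorm_le_bound zero_le_one fun v => ?_
  rw [one_mul]
  refine ContinuousLinearMap.opNorm_le_bound _ (Finset.prod_nonneg fun _ _ => norm_nonneg _)
    fun Q => ?_
  rw [mul_comm]; change ‖BoundedSeries.term m Q v‖ ≤ _ 
  refine ((BoundedSeries.term m Q).le_opNorm v).trans ?_
  gcongr
  exact lp.norm_apply_le_norm ENNReal.top_ne_zero (E := fun m : ℕ => ContinuousMultilinearMap ℚ_[p]
    (fun _ : Fin m => E') A) Q m

/-- Every term of the universal series has norm at most one, so it is analytic on the open unit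
ball. All `p^k`-analytic functions factor through this one operator-valued analytic map, and the
individual function enters only as the vector at which the operator is evaluated. -/
lemma one_le_radius_evalSeries : 1 ≤ (evalSeries p E' A).radius := by
  have := (evalSeries p E' A).le_radius_of_bound 1 (r := 1) fun m => by
    simpa using norm_evalSeries_le m
  simpa using this

/-- A power series on the ball of radius `p^{-k}`, rescaled to the unit ball. -/
def rescale (k : ℕ) (q : FormalMultilinearSeries ℚ_[p] E' A) (B : ℝ)
    (h : ∀ m, ‖q m‖ * (((p : ℝ)⁻¹) ^ k) ^ m ≤ B) : BoundedSeries p E' A :=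
  ⟨fun m => (((p : ℚ_[p]) ^ k) ^ m) • q m, memℓp_infty ⟨B, by
    rintro _ ⟨m, rfl⟩
    dsimp only
    rw [norm_smul, norm_pow, norm_pow, Padic.norm_p, mul_comm]
    exact h m⟩⟩

lemma rescale_apply (k : ℕ) (q : FormalMultilinearSeries ℚ_[p] E' A) (B : ℝ)
    (h : ∀ m, ‖q m‖ * (((p : ℝ)⁻¹) ^ k) ^ m ≤ B) (m : ℕ) :
    BoundedSeries.term m (rescale k q B h) = (((p : ℚ_[p]) ^ k) ^ m) • q m := rfl

lemma norm_rescale_le (k : ℕ) (q : FormalMultilinearSeries ℚ_[p] E' A) (B : ℝ)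
    (h : ∀ m, ‖q m‖ * (((p : ℝ)⁻¹) ^ k) ^ m ≤ B) : ‖rescale k q B h‖ ≤ B := by
  refine lp.norm_le_of_forall_le' B fun m => ?_
  change ‖BoundedSeries.term m (rescale k q B h)‖ ≤ B
  rw [rescale_apply, norm_smul, norm_pow, norm_pow, Padic.norm_p, mul_comm]
  exact h m

/-- The sum of the universal power series on the ball of radius `p^{-k}` around `a`. -/
def evalMap (p : ℕ) [Fact p.Prime] {E' : Type*} [NormedAddCommGroup E'] [NormedSpace ℚ_[p] E']
    (A : Type*) [NormedCommRing A] [NormedAlgebra ℚ_[p] A] (k : ℕ) (a z : E') :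
    BoundedSeries p E' A →L[ℚ_[p]] A :=
  (evalSeries p E' A).sum ((((p : ℚ_[p]) ^ k)⁻¹) • (z - a))

lemma norm_inv_pow_smul_lt_one {k : ℕ} {v : E'} (hv : ‖v‖ < ((p : ℝ)⁻¹) ^ k) :
    ‖(((p : ℚ_[p]) ^ k)⁻¹) • v‖ < 1 := by
  have h0 := pow_pos (inv_prime_pos (p := p)) k
  rw [norm_smul, norm_inv, norm_pow, Padic.norm_p, inv_mul_lt_iff₀ h0, mul_one]
  exact hv

lemma analyticAt_evalMap [CompleteSpace A] (k : ℕ) (a z : E') (hz : ‖z - a‖ < ((p : ℝ)⁻¹) ^ k) :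
    AnalyticAt ℚ_[p] (evalMap p A k a) z := by
  have h1 := (evalSeries p E' A).analyticOnNhd ((((p : ℚ_[p]) ^ k)⁻¹) • (z - a)) (by
    rw [Metric.mem_eball, edist_zero_right, ← ofReal_norm]
    refine lt_of_lt_of_le ?_ one_le_radius_evalSeries
    rw [ENNReal.ofReal_lt_one]
    exact norm_inv_pow_smul_lt_one hz)
  have h2 : AnalyticAt ℚ_[p] (fun z : E' => (((p : ℚ_[p]) ^ k)⁻¹) • (z - a)) z := by fun_prop
  exact AnalyticAt.comp (f := fun z : E' => (((p : ℚ_[p]) ^ k)⁻¹) • (z - a)) h1 h2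

/-- The factor `(p^k)^m` in the rescaled coefficient of degree `m` cancels the factor `p^{-k}` in
each of the `m` arguments. The ball is open because bounded coefficients do not suffice for
convergence on its boundary. -/
lemma hasSum_evalMap [CompleteSpace A] (k : ℕ) (a z : E') (hz : ‖z - a‖ < ((p : ℝ)⁻¹) ^ k)
    (q : FormalMultilinearSeries ℚ_[p] E' A) (B : ℝ)
    (h : ∀ m, ‖q m‖ * (((p : ℝ)⁻¹) ^ k) ^ m ≤ B) :
    HasSum (fun m => q m fun _ => z - a) (evalMap p A k a z (rescale k q B h)) := by
  have hpos : 0 < (evalSeries p E' A).radius := zero_lt_one.trans_le one_le_radius_evalSeries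
  have h1 := ((evalSeries p E' A).hasFPowerSeriesOnBall hpos).hasSum
    (y := (((p : ℚ_[p]) ^ k)⁻¹) • (z - a)) (by
    rw [Metric.mem_eball, edist_zero_right, ← ofReal_norm]
    refine lt_of_lt_of_le ?_ one_le_radius_evalSeries
    rw [ENNReal.ofReal_lt_one]
    exact norm_inv_pow_smul_lt_one hz)
  rw [zero_add] at h1
  have h2 := h1.map (ContinuousLinearMap.apply ℚ_[p] A (rescale k q B h))
    (ContinuousLinearMap.apply ℚ_[p] A (rescale k q B h)).continuous
  refine (congrArg (HasSum · _) (funext fun m => ?_)).mpr h2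
  change _ = evalSeries p E' A m (fun _ => (((p : ℚ_[p]) ^ k)⁻¹) • (z - a)) (rescale k q B h)
  have hp0 : (p : ℚ_[p]) ^ k ≠ 0 := pow_ne_zero _ (by exact_mod_cast (Fact.out : p.Prime).ne_zero)
  rw [evalSeries_apply, rescale_apply, smul_apply,
    ContinuousMultilinearMap.map_smul_univ (q m) (fun _ => ((p : ℚ_[p]) ^ k)⁻¹), smul_smul]
  simp [hp0]

lemma norm_apply_le_norm (Q : BoundedSeries p E' A) :
    ‖ContinuousLinearMap.apply ℚ_[p] A Q‖ ≤ ‖Q‖ := by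
  refine ContinuousLinearMap.opNorm_le_bound _ (norm_nonneg _) fun T => ?_
  rw [mul_comm]
  exact T.le_opNorm Q

lemma AnalyticBound.nonneg [Nonempty X] {e : X → E} {k : ℕ} {B : ℝ} {f : X → A}
    (h : AnalyticBound p e k B f) : 0 ≤ B := by
  obtain ⟨q, h1, -⟩ := h (Classical.arbitrary X)
  have := inv_prime_pos (p := p)
  exact le_trans (by positivity) (h1 0)

/-- A weighted composition operator `f ↦ w · (f ∘ φ)` with locally analytic `w` and `φ` is
bounded. -/
theorem exists_analyticBound_weighted_comp [CompleteSpace A] [Nonempty X'] {e : X → E} {e' : X' → E'}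
    (hc : IsCompact (Set.range e)) {w : X → A} {φ : X → X'} (hw : ∀ x, LocAnAt p e w x)
    (hφ : ∀ x, LocAnAt p e (fun y => e' (φ y)) x) (k : ℕ) :
    ∃ k' : ℕ, ∃ C : ℝ, 0 ≤ C ∧ ∀ f B, AnalyticBound p e' k B f →
      AnalyticBound p e k' (C * B) (fun y => w y * f (φ y)) := by
  -- The family consists of all pairs of a function and a bound for it; a constant uniform over this
  -- family is exactly boundedness of the operator.
  let ι := {fB : (X' → A) × ℝ // AnalyticBound p e' k fB.2 fB.1}
  obtain ⟨k', C, hC, H⟩ := exists_analyticBound_family (ι := ι) (p := p) (A := A)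
    (Y := BoundedSeries p E' A →L[ℚ_[p]] A) hc (fun i y => w y * i.1.1 (φ y)) (fun i => i.1.2)
    (fun i => i.2.nonneg) (fun x => by
      obtain ⟨w', hw', hwe⟩ := hw x
      obtain ⟨φ', hφ', hφe⟩ := hφ x
      have ha : φ' (e x) = e' (φ x) := (hφe.self_of_nhds x rfl).symm
      choose q hq1 hq2 hq3 using fun i : ι => i.2 (φ x)
      -- Near `x` the value `w(y) f(φ(y))` is this operator-valued analytic function, which does not
      -- involve `f`, applied to the rescaled expansion of `f` at `φ x`, a vector of norm at most
      -- `B`.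
      refine ⟨fun z => (ContinuousLinearMap.mul ℚ_[p] A (w' z)).comp
        (evalMap p A k (e' (φ x)) (φ' z)), ?_,
        fun i => ContinuousLinearMap.apply ℚ_[p] A (rescale k (q i) _ (hq1 i)),
        fun i => (norm_apply_le_norm _).trans (norm_rescale_le _ _ _ _), ?_⟩
      · have h1 : AnalyticAt ℚ_[p] (fun z => evalMap p A k (e' (φ x)) (φ' z)) (e x) := by
          refine AnalyticAt.comp (g := evalMap p A k (e' (φ x))) (analyticAt_evalMap _ _ _ ?_) hφ'
          rw [ha, sub_self, norm_zero]
          exact pow_pos inv_prime_pos _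
        have h2 : AnalyticAt ℚ_[p] (fun z => ContinuousLinearMap.mul ℚ_[p] A (w' z)) (e x) :=
          ((ContinuousLinearMap.mul ℚ_[p] A).analyticAt _).comp hw'
        exact ((ContinuousLinearMap.compL ℚ_[p] (BoundedSeries p E' A) A A).analyticAt_bilinear
          _).comp₂ h2 h1
      · have hn : ∀ᶠ z in 𝓝 (e x), ‖φ' z - e' (φ x)‖ < ((p : ℝ)⁻¹) ^ k := by
          have := (hφ'.continuousAt.sub (continuousAt_const (y := e' (φ x)))).norm
          refine this.eventually_lt_const ?_
          change ‖φ' (e x) - e' (φ x)‖ < _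
          rw [ha, sub_self, norm_zero]
          exact pow_pos inv_prime_pos _
        filter_upwards [hwe, hφe, hn] with z h1 h2 h3 y hy i
        have h4 := hasSum_evalMap k (e' (φ x)) (φ' z) h3 (q i) _ (hq1 i)
        rw [← h2 y hy] at h4 h3
        change w y * i.1.1 (φ y) = w' z * evalMap p A k (e' (φ x)) (φ' z) _
        rw [h1 y hy, (hq3 i (φ y) h3.le).unique h4, h2 y hy])
  exact ⟨k', C, hC, fun f B h => H ⟨(f, B), h⟩⟩

end WeightedComposition
end BranchingLaw
end

noncomputable section
namespace BranchingLaw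

/-! ### Stability properties of local analyticity. -/

section LocAnAt

variable {p : ℕ} [Fact p.Prime] {X X' E E' A Y Z : Type*}
  [NormedAddCommGroup E] [NormedSpace ℚ_[p] E] [NormedAddCommGroup E'] [NormedSpace ℚ_[p] E']
  [NormedCommRing A] [NormedAlgebra ℚ_[p] A] [NormedAddCommGroup Y] [NormedSpace ℚ_[p] Y]
  [NormedAddCommGroup Z] [NormedSpace ℚ_[p] Z] {e : X → E} {x : X}

lemma LocAnAt.of_eventually {f : X → Y} {F : E → Y} (hF : AnalyticAt ℚ_[p] F (e x))
    (h : ∀ y, f y = F (e y)) : LocAnAt p e f x :=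
  ⟨F, hF, Eventually.of_forall fun _ y hy => hy ▸ h y⟩

lemma LocAnAt.const (c : Y) : LocAnAt p e (fun _ => c) x :=
  .of_eventually analyticAt_const fun _ => rfl

lemma LocAnAt.congr {f g : X → Y} (hf : LocAnAt p e f x)
    (h : ∀ᶠ z in 𝓝 (e x), ∀ y, e y = z → g y = f y) : LocAnAt p e g x := by
  obtain ⟨F, hF, hf⟩ := hf
  refine ⟨F, hF, ?_⟩
  filter_upwards [hf, h] with z h1 h2 y hy
  rw [h2 y hy, h1 y hy]

lemma LocAnAt.comp_analytic {f : X → Y} {F : Y → Z} (hF : AnalyticAt ℚ_[p] F (f x))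
    (hf : LocAnAt p e f x) : LocAnAt p e (fun y => F (f y)) x := by
  obtain ⟨f', hf', hfe⟩ := hf
  rw [hfe.self_of_nhds x rfl] at hF
  refine ⟨fun z => F (f' z), hF.comp hf', ?_⟩
  filter_upwards [hfe] with z h y hy
  rw [h y hy]

lemma LocAnAt.comp {e' : X' → E'} {f : X' → Y} {φ : X → X'} (hf : LocAnAt p e' f (φ x))
    (hφ : LocAnAt p e (fun y => e' (φ y)) x) : LocAnAt p e (fun y => f (φ y)) x := by
  obtain ⟨F, hF, hf⟩ := hf
  obtain ⟨φ', hφ', hφe⟩ := hφ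
  have ha : e' (φ x) = φ' (e x) := hφe.self_of_nhds x rfl
  rw [ha] at hF hf
  refine ⟨fun z => F (φ' z), hF.comp hφ', ?_⟩
  filter_upwards [hφe, hφ'.continuousAt.eventually hf] with z h1 h2 y hy
  exact h2 (φ y) (h1 y hy)

lemma LocAnAt.prodMk {f : X → Y} {g : X → Z} (hf : LocAnAt p e f x) (hg : LocAnAt p e g x) :
    LocAnAt p e (fun y => (f y, g y)) x := by
  obtain ⟨F, hF, hf⟩ := hf
  obtain ⟨G, hG, hg⟩ := hg
  refine ⟨fun z => (F z, G z), hF.prod hG, ?_⟩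
  filter_upwards [hf, hg] with z h1 h2 y hy
  rw [h1 y hy, h2 y hy]

lemma LocAnAt.mul {f g : X → A} (hf : LocAnAt p e f x) (hg : LocAnAt p e g x) :
    LocAnAt p e (fun y => f y * g y) x :=
  (hf.prodMk hg).comp_analytic (F := fun z : A × A => z.1 * z.2) (analyticAt_mul _)

lemma LocAnAt.prod {ι : Type*} {f : ι → X → A} {s : Finset ι} (hf : ∀ i, LocAnAt p e (f i) x) :
    LocAnAt p e (fun y => ∏ i ∈ s, f i y) x := by
  classical
  induction s using Finset.induction_on with
  | empty => simpa using LocAnAt.const 1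
  | insert i s hi ih =>
    simp only [Finset.prod_insert hi]
    exact (hf i).mul ih

lemma LocAnAt.pi {ι : Type*} [Fintype ι] {Y : ι → Type*} [∀ i, NormedAddCommGroup (Y i)]
    [∀ i, NormedSpace ℚ_[p] (Y i)] {f : X → ∀ i, Y i} (hf : ∀ i, LocAnAt p e (fun y => f y i) x) :
    LocAnAt p e f x := by
  choose F hF hf using hf
  refine ⟨fun z i => F i z, AnalyticAt.pi hF, ?_⟩
  filter_upwards [eventually_all.2 hf] with z h y hy
  exact funext fun i => h i y hy

end LocAnAt

/-! ### Local analyticity of continuous characters -/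

section Characters

variable {p : ℕ} [Fact p.Prime] {A : Type*} [NormedCommRing A] [NormedAlgebra ℚ_[p] A]

open NormedSpace

/-- Legendre's formula gives `(p - 1) v_p(m!) ≤ m`, hence `v_p(m!) ≤ m`. This crude form gives
convergence of the exponential on `‖x‖ < p⁻¹` for every `p`, including `p = 2`. -/
lemma norm_inv_factorial_le (m : ℕ) : ‖((m.factorial : ℚ_[p]))⁻¹‖ ≤ (p : ℝ) ^ m := by
  have h1 : 1 ≤ (p : ℝ) := by exact_mod_cast (Fact.out : p.Prime).one_lt.le
  have h0 : (m.factorial : ℚ_[p]) ≠ 0 := by exact_mod_cast m.factorial_ne_zero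
  rw [norm_inv, Padic.norm_eq_zpow_neg_valuation h0, ← zpow_neg, neg_neg, Padic.valuation_natCast,
    zpow_natCast]
  refine pow_le_pow_right₀ h1 ?_
  have h2 := sub_one_mul_padicValNat_factorial (p := p) m
  have h3 : 1 ≤ p - 1 := Nat.le_sub_one_of_lt (Fact.out : p.Prime).one_lt
  calc padicValNat p m.factorial ≤ (p - 1) * padicValNat p m.factorial :=
        Nat.le_mul_of_pos_left _ h3
    _ ≤ m := by rw [h2]; exact Nat.sub_le _ _

variable (p A) in
lemma inv_prime_le_radius_expSeries :
    ENNReal.ofReal ((p : ℝ)⁻¹) ≤ (expSeries ℚ_[p] A).radius := by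
  refine (expSeries ℚ_[p] A).le_radius_of_bound (r := Real.toNNReal ((p : ℝ)⁻¹))
    (max 1 ‖(1 : A)‖) fun m => ?_
  have hp0 : (0 : ℝ) < p := by exact_mod_cast (Fact.out : p.Prime).pos
  rw [Real.coe_toNNReal _ inv_prime_pos.le, expSeries, norm_smul]
  have h1 := norm_inv_factorial_le (p := p) m
  have h2 := ContinuousMultilinearMap.norm_mkPiAlgebraFin_le (𝕜 := ℚ_[p]) (A := A) (n := m)
  calc _ ≤ (p : ℝ) ^ m * max 1 ‖(1 : A)‖ * ((p : ℝ)⁻¹) ^ m := by gcongr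
    _ = max 1 ‖(1 : A)‖ := by
      rw [inv_pow]
      field_simp

lemma mem_eball_radius_expSeries {x : A} (hx : ‖x‖ < (p : ℝ)⁻¹) :
    x ∈ Metric.eball (0 : A) (expSeries ℚ_[p] A).radius := by
  rw [Metric.mem_eball, edist_zero_right, ← ofReal_norm]
  exact lt_of_lt_of_le ((ENNReal.ofReal_lt_ofReal_iff inv_prime_pos).2 hx)
    (inv_prime_le_radius_expSeries p A)

lemma radius_expSeries_pos : 0 < (expSeries ℚ_[p] A).radius :=
  lt_of_lt_of_le (ENNReal.ofReal_pos.2 inv_prime_pos) (inv_prime_le_radius_expSeries p A)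

lemma exp_add_of_norm_lt [CompleteSpace A] {x y : A} (hx : ‖x‖ < (p : ℝ)⁻¹)
    (hy : ‖y‖ < (p : ℝ)⁻¹) : exp (x + y) = exp x * exp y :=
  exp_add_of_mem_ball (𝕂 := ℚ_[p]) (mem_eball_radius_expSeries hx) (mem_eball_radius_expSeries hy)

/-- The derivative is written as a linear equivalence so that the inverse function theorem applies.
It supplies a local logarithm on `ℚ_p`, and shows in `A` that elements near `1` are exponentials. -/
lemma hasStrictFDerivAt_exp_equiv [CompleteSpace A] :
    HasStrictFDerivAt (𝕜 := ℚ_[p]) (exp : A → A)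
      ((ContinuousLinearEquiv.refl ℚ_[p] A : A ≃L[ℚ_[p]] A) : A →L[ℚ_[p]] A) 0 :=
  hasStrictFDerivAt_exp_zero_of_radius_pos radius_expSeries_pos

/-- A local analytic inverse of the `p`-adic exponential. -/
lemma exists_analytic_log : ∃ ℓ : ℚ_[p] → ℚ_[p], AnalyticAt ℚ_[p] ℓ 1 ∧ ℓ 1 = 0 ∧
    ∀ᶠ z in 𝓝 1, exp (ℓ z) = z := by
  have h := hasStrictFDerivAt_exp_equiv (p := p) (A := ℚ_[p])
  have h1 : h.localInverse _ _ _ 1 = 0 := by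
    have := h.localInverse_apply_image
    rwa [exp_zero] at this
  refine ⟨h.localInverse _ _ _, ?_, h1, ?_⟩
  · have := (h.toOpenPartialHomeomorph _).analyticAt_symm' (a := 0)
      (i := ContinuousLinearEquiv.refl ℚ_[p] ℚ_[p])
      h.mem_toOpenPartialHomeomorph_source
      ((hasFPowerSeriesAt_exp_zero_of_radius_pos radius_expSeries_pos).analyticAt)
      h.hasFDerivAt.fderiv
    rw [HasStrictFDerivAt.toOpenPartialHomeomorph_coe, exp_zero] at this
    exact this
  · have := h.eventually_right_inverse
    rwa [exp_zero] at this

lemma exists_exp_radius : ∃ k : ℕ, ∀ y : ℚ_[p], ‖y‖ ≤ ((p : ℝ)⁻¹) ^ k →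
    ‖y‖ < (p : ℝ)⁻¹ ∧ ‖(exp y : ℚ_[p])‖ ≤ 1 := by
  have hc : ContinuousAt (exp : ℚ_[p] → ℚ_[p]) 0 :=
    (hasStrictFDerivAt_exp_equiv (p := p)).continuousAt
  have h1 : ∀ᶠ y in 𝓝 (0 : ℚ_[p]), ‖y‖ < (p : ℝ)⁻¹ ∧ ‖(exp y : ℚ_[p])‖ ≤ 1 := by
    refine ((continuous_norm.tendsto' 0 0 norm_zero).eventually_lt_const
      (inv_prime_pos (p := p))).and ?_
    have h2 : ∀ᶠ y in 𝓝 (0 : ℚ_[p]), dist (exp y) (1 : ℚ_[p]) < 1 := by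
      have := hc.eventually (Metric.ball_mem_nhds _ one_pos)
      simpa using this
    filter_upwards [h2] with y hy
    rw [dist_eq_norm] at hy
    rw [← sub_add_cancel (exp y) 1]
    exact (IsUltrametricDist.norm_add_le_max _ _).trans (max_le hy.le (by simp))
  obtain ⟨ε, hε, h⟩ := Metric.eventually_nhds_iff.1 h1
  obtain ⟨k, hk⟩ := exists_pow_lt_of_lt_one hε (inv_prime_lt_one (p := p))
  exact ⟨k, fun y hy => h (by rw [dist_zero_right]; exact hy.trans_lt hk)⟩

lemma norm_pow_mul_le (k : ℕ) (s : ℤ_[p]) : ‖(p : ℚ_[p]) ^ k * s‖ ≤ ((p : ℝ)⁻¹) ^ k := by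
  rw [norm_mul, norm_pow, Padic.norm_p]
  exact mul_le_of_le_one_right (pow_nonneg inv_prime_pos.le _) (PadicInt.norm_le_one s)

/-- `s ↦ exp(p^k s)` as a continuous homomorphism `ℤ_p → ℤ_p^×`, for large `k`. -/
lemma exists_expUnit : ∃ (k : ℕ) (U : ℤ_[p] → ℤ_[p]ˣ), Continuous U ∧
    (∀ s t, U (s + t) = U s * U t) ∧ U 0 = 1 ∧
    ∀ s, zpCoord p (U s) = exp ((p : ℚ_[p]) ^ k * s) := by
  obtain ⟨k, hk⟩ := exists_exp_radius (p := p)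
  have hadd : ∀ s t : ℤ_[p], (exp ((p : ℚ_[p]) ^ k * ((s + t : ℤ_[p]) : ℚ_[p])) : ℚ_[p]) =
      exp ((p : ℚ_[p]) ^ k * s) * exp ((p : ℚ_[p]) ^ k * t) := fun s t => by
    rw [← exp_add_of_norm_lt (p := p) (hk _ (norm_pow_mul_le k s)).1
      (hk _ (norm_pow_mul_le k t)).1]
    push_cast
    rw [mul_add]
  let I : ℤ_[p] → ℤ_[p] := fun s => ⟨exp ((p : ℚ_[p]) ^ k * s), (hk _ (norm_pow_mul_le k s)).2⟩
  have hI : ∀ s t, I (s + t) = I s * I t := fun s t => Subtype.ext (hadd s t)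
  have hI0 : I 0 = 1 := Subtype.ext (by simp [I])
  have hIc : Continuous I := by
    refine Continuous.subtype_mk ?_ _
    have h1 : ContinuousOn (exp : ℚ_[p] → ℚ_[p]) (Metric.eball 0 (expSeries ℚ_[p] ℚ_[p]).radius) :=
      continuousOn_exp
    have h3 : Continuous fun s : ℤ_[p] => (s : ℚ_[p]) := continuous_subtype_val
    have h2 : Continuous fun s : ℤ_[p] => (p : ℚ_[p]) ^ k * (s : ℚ_[p]) := continuous_const.mul h3
    refine h1.comp_continuous h2 fun s => ?_
    exact mem_eball_radius_expSeries (hk _ (norm_pow_mul_le k s)).1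
  refine ⟨k, fun s => ⟨I s, I (-s), ?_, ?_⟩, ?_, fun s t => Units.ext (hI s t),
    Units.ext hI0, fun s => rfl⟩
  · rw [← hI, add_neg_cancel, hI0]
  · rw [← hI, neg_add_cancel, hI0]
  · exact Units.continuous_iff.2 ⟨hIc, hIc.comp continuous_neg⟩

lemma continuous_exp_smul [CompleteSpace A] {b : A} (hb : ‖b‖ < (p : ℝ)⁻¹) :
    Continuous fun s : ℤ_[p] => exp ((s : ℚ_[p]) • b) := by
  have h1 : ContinuousOn (exp : A → A) (Metric.eball 0 (expSeries ℚ_[p] A).radius) :=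
    continuousOn_exp
  refine h1.comp_continuous (continuous_subtype_val.smul continuous_const) fun s => ?_
  refine mem_eball_radius_expSeries (lt_of_le_of_lt ((norm_smul_le _ _).trans ?_) hb)
  exact mul_le_of_le_one_left (norm_nonneg _) (PadicInt.norm_le_one s)

/-- Every continuous character `ℤ_p → A^×` is exponential near `0`. -/
lemma exists_exp_of_continuous [CompleteSpace A] {ψ : ℤ_[p] → A} (hψ : Continuous ψ) (h0 : ψ 0 = 1)
    (hadd : ∀ s t, ψ (s + t) = ψ s * ψ t) :
    ∃ (j : ℕ) (b : A), ∀ s : ℤ_[p], ψ ((p : ℤ_[p]) ^ j * s) = exp ((s : ℚ_[p]) • b) := by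
  -- By continuity `ψ(p^j)` approaches `1`, so for some `j` it equals `exp b` with `b` small. This
  -- single value determines `ψ` on `p^j ℤ_p`.
  have h1 : Tendsto (fun j : ℕ => ψ ((p : ℤ_[p]) ^ j)) atTop (𝓝 1) := by
    have : Tendsto (fun j : ℕ => (p : ℤ_[p]) ^ j) atTop (𝓝 0) := by
      refine tendsto_pow_atTop_nhds_zero_of_norm_lt_one ?_
      rw [PadicInt.norm_p]
      exact inv_prime_lt_one
    rw [← h0]
    exact (hψ.tendsto 0).comp this
  have h2 : exp '' Metric.ball (0 : A) ((p : ℝ)⁻¹) ∈ 𝓝 (1 : A) := by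
    rw [← exp_zero, ← (hasStrictFDerivAt_exp_equiv (p := p) (A := A)).map_nhds_eq_of_equiv]
    exact image_mem_map (Metric.ball_mem_nhds _ inv_prime_pos)
  obtain ⟨j, b, hb, hj⟩ := (h1.eventually h2).exists
  rw [mem_ball_zero_iff] at hb
  refine ⟨j, b, fun s => ?_⟩
  have hle : ∀ s : ℤ_[p], ‖(s : ℚ_[p]) • b‖ < (p : ℝ)⁻¹ := fun s =>
    lt_of_le_of_lt ((norm_smul_le _ _).trans
      (mul_le_of_le_one_left (norm_nonneg _) (PadicInt.norm_le_one s))) hb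
  have hc : Continuous fun s : ℤ_[p] => (p : ℤ_[p]) ^ j * s := continuous_const.mul continuous_id
  -- Both sides are continuous in `s`, and on the dense set of natural numbers they agree by
  -- induction because both are multiplicative.
  refine congrFun (PadicInt.denseRange_natCast.equalizer (hψ.comp hc)
    (continuous_exp_smul hb) ?_) s
  funext m
  simp only [Function.comp_apply]
  induction m with
  | zero => simp [h0]
  | succ m ih =>
    have e1 : (((m + 1 : ℕ) : ℤ_[p]) : ℚ_[p]) • b = (((m : ℕ) : ℤ_[p]) : ℚ_[p]) • b +
        ((1 : ℤ_[p]) : ℚ_[p]) • b := by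
      rw [← add_smul]
      push_cast
      rfl
    rw [e1, exp_add_of_norm_lt (p := p) (hle _) (hle _), ← ih, Nat.cast_succ, mul_add, hadd, mul_one,
      ← hj]
    simp

/-- A continuous character of `ℤ_p^×` with values in a Banach algebra is locally analytic. -/
theorem LocAnAt.of_continuous_char [CompleteSpace A] (χ : ℤ_[p]ˣ →* Aˣ)
    (hχ : Continuous fun z => (χ z : A)) (z₀ : ℤ_[p]ˣ) :
    LocAnAt p (zpCoord p) (fun z => (χ z : A)) z₀ := by
  obtain ⟨k, U, hUc, hUadd, hU0, hU⟩ := exists_expUnit (p := p)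
  obtain ⟨j, b, hb⟩ := exists_exp_of_continuous (p := p) (ψ := fun s => (χ (U s) : A))
    (hχ.comp hUc) (by simp [hU0]) (fun s t => by simp [hUadd])
  obtain ⟨ℓ, hℓ, hℓ1, hexp⟩ := exists_analytic_log (p := p)
  have hp0 : (p : ℚ_[p]) ≠ 0 := by exact_mod_cast (Fact.out : p.Prime).ne_zero
  have hz₀ : zpCoord p z₀ ≠ 0 := by simp [zpCoord]
  have h1 : zpCoord p z₀ / zpCoord p z₀ = 1 := div_self hz₀
  have hdiv : AnalyticAt ℚ_[p] (fun z => z / zpCoord p z₀) (zpCoord p z₀) := by fun_prop (disch := exact hz₀)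
  -- Near `z₀` one has `z = z₀ exp(ℓ(z/z₀))`. The exponent `k` comes from the parametrisation `U` of
  -- units near `1`, and `j` from the range on which `χ ∘ U` is exponential; so the logarithm is
  -- divided by `p^(k+j)`.
  refine ⟨fun z => (χ z₀ : A) * exp ((ℓ (z / zpCoord p z₀) / (p : ℚ_[p]) ^ (k + j)) • b), ?_, ?_⟩
  · have a1 : AnalyticAt ℚ_[p] (fun z => ℓ (z / zpCoord p z₀)) (zpCoord p z₀) :=
      AnalyticAt.comp (f := fun z => z / zpCoord p z₀) (by rwa [h1]) hdiv
    have a2 : AnalyticAt ℚ_[p] (fun z => (ℓ (z / zpCoord p z₀) / (p : ℚ_[p]) ^ (k + j)) • b)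
        (zpCoord p z₀) := by
      have : AnalyticAt ℚ_[p] (fun z : ℚ_[p] => (z / (p : ℚ_[p]) ^ (k + j)) • b)
          (ℓ (zpCoord p z₀ / zpCoord p z₀)) := by
        have := ((ContinuousLinearMap.toSpanSingleton ℚ_[p] b).analyticAt
          (ℓ (zpCoord p z₀ / zpCoord p z₀) / (p : ℚ_[p]) ^ (k + j))).comp
          (f := fun z : ℚ_[p] => z / (p : ℚ_[p]) ^ (k + j)) (by
            simp only [div_eq_mul_inv]; exact analyticAt_id.mul analyticAt_const)
        exact this
      exact AnalyticAt.comp (f := fun z => ℓ (z / zpCoord p z₀)) this a1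
    have a3 : AnalyticAt ℚ_[p] (exp : A → A)
        ((ℓ (zpCoord p z₀ / zpCoord p z₀) / (p : ℚ_[p]) ^ (k + j)) • b) := by
      rw [h1, hℓ1, zero_div, zero_smul]
      exact (hasFPowerSeriesAt_exp_zero_of_radius_pos radius_expSeries_pos).analyticAt
    exact analyticAt_const.mul (AnalyticAt.comp
      (f := fun z => (ℓ (z / zpCoord p z₀) / (p : ℚ_[p]) ^ (k + j)) • b) a3 a2)
  · have hsmall : ∀ᶠ z in 𝓝 (1 : ℚ_[p]), ‖ℓ z‖ < ((p : ℝ)⁻¹) ^ (k + j) := by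
      refine hℓ.continuousAt.norm.eventually_lt_const ?_
      change ‖ℓ 1‖ < _
      rw [hℓ1, norm_zero]
      exact pow_pos inv_prime_pos _
    have hev := hsmall.and hexp
    rw [← h1] at hev
    replace hev := hdiv.continuousAt.eventually hev
    filter_upwards [hev] with z hz y hy
    obtain ⟨hz1, hz2⟩ := hz
    -- Close to `z₀` the logarithm is so small that the quotient is a `p`-adic integer, as required
    -- for an argument of `U`.
    have hs : ‖ℓ (z / zpCoord p z₀) / (p : ℚ_[p]) ^ (k + j)‖ ≤ 1 := by
      rw [norm_div, norm_pow, Padic.norm_p]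
      exact div_le_one_of_le₀ hz1.le (pow_nonneg inv_prime_pos.le _)
    obtain ⟨s, hs'⟩ : ∃ s : ℤ_[p], (s : ℚ_[p]) = ℓ (z / zpCoord p z₀) / (p : ℚ_[p]) ^ (k + j) :=
      ⟨⟨_, hs⟩, rfl⟩
    have hbs := hb s
    have hy' : U ((p : ℤ_[p]) ^ j * s) = y / z₀ := by
      refine Units.ext (Subtype.ext ?_)
      have e1 := hU ((p : ℤ_[p]) ^ j * s)
      have e2 : (p : ℚ_[p]) ^ k * (((p : ℤ_[p]) ^ j * s : ℤ_[p]) : ℚ_[p]) =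
          ℓ (z / zpCoord p z₀) := by
        rw [PadicInt.coe_mul, PadicInt.coe_pow, PadicInt.coe_natCast, ← mul_assoc, ← pow_add, hs']
        exact mul_div_cancel₀ _ (pow_ne_zero _ hp0)
      rw [e2, hz2] at e1
      refine e1.trans ?_
      rw [← hy, div_eq_iff hz₀, zpCoord, zpCoord, ← PadicInt.coe_mul, ← Units.val_mul, div_mul_cancel]
    rw [hy', hs'] at hbs
    change _ = (χ z₀ : A) * exp ((ℓ (z / zpCoord p z₀) / (p : ℚ_[p]) ^ (k + j)) • b)
    rw [← hbs, ← Units.val_mul, ← map_mul, mul_div_cancel]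

end Characters
end BranchingLaw
end

noncomputable section
namespace BranchingLaw

/-! ### Locally analytic functions with values in an ideal -/

section IdealValued

variable {p : ℕ} [Fact p.Prime] {X E A : Type*}
  [NormedAddCommGroup E] [NormedSpace ℚ_[p] E] [NormedCommRing A] [NormedAlgebra ℚ_[p] A]

lemma AnalyticBound.zero {e : X → E} {k : ℕ} {B : ℝ} (hB : 0 ≤ B) :
    AnalyticBound p e k B (0 : X → A) :=
  fun _ => ⟨0, by simpa using hB, by simp, fun y _ => by simp⟩

lemma AnalyticBound.sum {ι : Type*} {e : X → E} {k : ℕ} {B : ι → ℝ} {f : ι → X → A} (s : Finset ι)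
    (h : ∀ i ∈ s, AnalyticBound p e k (B i) (f i)) :
    AnalyticBound p e k (∑ i ∈ s, B i) (∑ i ∈ s, f i) := by
  classical
  induction s using Finset.induction_on with
  | empty => simpa using AnalyticBound.zero le_rfl
  | insert i s hi ih =>
    rw [Finset.sum_insert hi, Finset.sum_insert hi]
    exact (h i (by simp)).add (ih fun j hj => h j (by simp [hj]))

/-- Two points are in the same ball of radius `p^{-k}` (open ball). -/
def ballSetoid (p : ℕ) [Fact p.Prime] [IsUltrametricDist E] (e : X → E) (k : ℕ) : Setoid X where
  r x y := ‖e x - e y‖ < ((p : ℝ)⁻¹) ^ k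
  iseqv :=
    { refl := fun x => by
        rw [sub_self, norm_zero]
        exact pow_pos inv_prime_pos _
      symm := fun {x y} h => by rwa [norm_sub_rev]
      trans := fun {x y z} h h' => by
        rw [← sub_add_sub_cancel _ (e y)]
        exact (IsUltrametricDist.norm_add_le_max _ _).trans_lt (max_lt h h') }

lemma finite_ballSetoid [IsUltrametricDist E] {e : X → E} (hc : IsCompact (Set.range e)) (k : ℕ) :
    Finite (Quotient (ballSetoid p e k)) := by
  obtain ⟨t, -, htf, ht⟩ := hc.elim_finite_subcover_image (b := Set.univ)
    (c := fun x => Metric.ball (e x) (((p : ℝ)⁻¹) ^ k)) (fun x _ => Metric.isOpen_ball) (by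
      rintro _ ⟨x, rfl⟩
      exact Set.mem_iUnion₂.2 ⟨x, trivial, Metric.mem_ball_self (pow_pos inv_prime_pos _)⟩)
  have := htf.to_subtype
  refine Finite.of_surjective (fun x : t => (Quotient.mk (ballSetoid p e k) x.1)) fun c => ?_
  obtain ⟨y, rfl⟩ := Quotient.exists_rep c
  obtain ⟨x, hx, hy⟩ := Set.mem_iUnion₂.1 (ht ⟨y, rfl⟩)
  refine ⟨⟨x, hx⟩, (Quotient.sound ?_).symm⟩
  rw [Metric.mem_ball, dist_eq_norm] at hy
  exact hy

/-- The class of the ball is locally constant, so a locally analytic function stays locally analytic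
when it is cut off to one ball. -/
lemma mk_ballSetoid_eq_of_near [IsUltrametricDist E] {e : X → E} {k : ℕ} (x : X) :
    ∀ᶠ z in 𝓝 (e x), ∀ y, e y = z →
      Quotient.mk (ballSetoid p e k) y = Quotient.mk (ballSetoid p e k) x := by
  filter_upwards [Metric.ball_mem_nhds (e x) (pow_pos (inv_prime_pos (p := p)) k)] with z hz y hy
  rw [Metric.mem_ball, dist_eq_norm, ← hy] at hz
  exact Quotient.sound hz

lemma norm_sub_out_lt [IsUltrametricDist E] (e : X → E) (k : ℕ) (y : X) :
    ‖e y - e (Quotient.mk (ballSetoid p e k) y).out‖ < ((p : ℝ)⁻¹) ^ k := by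
  have : (ballSetoid p e k).r (Quotient.mk (ballSetoid p e k) y).out y := Quotient.mk_out y
  rw [norm_sub_rev]
  exact this

/-- A monomial on a ball, extended by zero, is locally analytic. -/
lemma ball_monomial_mem_locAn [CompleteSpace A] [IsUltrametricDist E] {e : X → E}
    (hc : IsCompact (Set.range e)) {k : ℕ} (c : Quotient (ballSetoid p e k)) (a : E) {m : ℕ}
    (b : Fin m → E →L[ℚ_[p]] ℚ_[p]) :
    (open Classical in fun y => if Quotient.mk (ballSetoid p e k) y = c then
      algebraMap ℚ_[p] A (∏ i, b i (e y - a)) else 0) ∈ locAn p e A := by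
  classical
  refine LocAnAt.mem_locAn hc fun x => ?_
  by_cases hx : Quotient.mk (ballSetoid p e k) x = c
  · have h1 : LocAnAt p e (fun y => algebraMap ℚ_[p] A (∏ i, b i (e y - a))) x := by
      refine .of_eventually (F := fun z => algebraMap ℚ_[p] A (∏ i, b i (z - a))) ?_ fun y => rfl
      have h2 : AnalyticAt ℚ_[p] (fun z => ∏ i, b i (z - a)) (e x) := by
        refine Finset.analyticAt_fun_prod _ fun i _ => ?_
        have h3 : AnalyticAt ℚ_[p] (fun z : E => z - a) (e x) := by fun_prop
        exact AnalyticAt.comp (f := fun z : E => z - a) ((b i).analyticAt _) h3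
      exact ((algebraMapCLM ℚ_[p] A).analyticAt _).comp h2
    refine h1.congr ?_
    filter_upwards [mk_ballSetoid_eq_of_near (p := p) (k := k) x] with z hz y hy
    rw [if_pos ((hz y hy).trans hx)]
  · refine (LocAnAt.const (0 : A)).congr ?_
    filter_upwards [mk_ballSetoid_eq_of_near (p := p) (k := k) x] with z hz y hy
    rw [if_neg (by rwa [hz y hy])]

/-- Finite sums of homogeneous terms with values in an ideal lie in the ideal generated by it. -/
lemma ball_multilinear_mem_smul_top [CompleteSpace A] [IsUltrametricDist E]
    [FiniteDimensional ℚ_[p] E] {e : X → E} (hc : IsCompact (Set.range e)) (J : Ideal A) {k : ℕ}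
    (c : Quotient (ballSetoid p e k)) (a : E) {m : ℕ}
    (q : ContinuousMultilinearMap ℚ_[p] (fun _ : Fin m => E) A) (hq : ∀ v, q v ∈ J) :
    ∃ f ∈ J • (⊤ : Submodule A (locAn p e A)), ∀ y, f.1 y =
      open Classical in if Quotient.mk (ballSetoid p e k) y = c then q fun _ => e y - a else 0 := by
  classical
  let bas := Module.finBasis ℚ_[p] E
  let co : Fin (Module.finrank ℚ_[p] E) → E →L[ℚ_[p]] ℚ_[p] := fun i =>
    LinearMap.toContinuousLinearMap (bas.coord i)
  -- Expanding the form in a basis of `E` writes it as a finite sum of scalar monomials with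
  -- coefficients `q(bas ∘ r)`, which lie in `J`.
  refine ⟨∑ r : Fin m → Fin (Module.finrank ℚ_[p] E), (q fun i => bas (r i)) •
    ⟨_, ball_monomial_mem_locAn hc c a fun i => co (r i)⟩, ?_, fun y => ?_⟩
  · exact Submodule.sum_mem _ fun r _ => Submodule.smul_mem_smul (hq _) trivial
  · rw [Submodule.coe_sum, Finset.sum_apply]
    simp only [Submodule.coe_smul, Pi.smul_apply, smul_eq_mul]
    split_ifs with h
    · have hv : (fun _ : Fin m => e y - a) = fun _ : Fin m => ∑ j, co j (e y - a) • bas j := by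
        funext _
        exact (bas.sum_repr (e y - a)).symm
      conv_rhs => rw [hv]
      have := q.toMultilinearMap.map_sum (fun (_ : Fin m) j => co j (e y - a) • bas j)
      refine Eq.trans ?_ this.symm
      refine Finset.sum_congr rfl fun r _ => ?_
      rw [MultilinearMap.map_smul_univ q.toMultilinearMap (fun i => co (r i) (e y - a))
        (fun i => bas (r i)), Algebra.smul_def, mul_comm]
      rfl
    · simp

lemma hasSum_ite_mem_finset {ι : Type*} [DecidableEq ι] (s : Finset ι) (g : ι → A) :
    HasSum (fun i => if i ∈ s then g i else 0) (∑ i ∈ s, g i) := by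
  have h : ∑ i ∈ s, (if i ∈ s then g i else 0) = ∑ i ∈ s, g i :=
    Finset.sum_congr rfl fun i hi => if_pos hi
  rw [← h]
  exact hasSum_sum_of_ne_finset_zero fun i hi => if_neg hi

/-- A locally analytic function with values in the image of a projection to an ideal is a limit of
finite sums of scalar functions with coefficients in this ideal. -/
theorem exists_approx_of_ideal_valued [CompleteSpace A] [IsUltrametricDist E]
    [FiniteDimensional ℚ_[p] E] {e : X → E} (hc : IsCompact (Set.range e))
    (J : Ideal A) (π : A →L[ℚ_[p]] A) (hπ : ∀ a, π a ∈ J)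
    (F : locAn p e A) (hF : ∀ y, π (F.1 y) = F.1 y) :
    ∃ (k' : ℕ) (C : ℝ), ∀ δ : ℝ, 0 < δ → ∃ G ∈ J • (⊤ : Submodule A (locAn p e A)),
      AnalyticBound p e k' (C * δ) (F - G).1 := by
  classical
  obtain ⟨k, B, hk⟩ := F.2
  choose q₀ hq₀1 hq₀2 hq₀3 using hk
  -- Composing the local expansions with `π` leaves their sums unchanged, because `π ∘ F = F`, and
  -- forces every coefficient into `J`.
  let q : X → FormalMultilinearSeries ℚ_[p] E A := fun x => π.compFormalMultilinearSeries (q₀ x)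
  have hqle : ∀ x m, ‖q x m‖ * (((p : ℝ)⁻¹) ^ k) ^ m ≤
      ‖π‖ * (‖q₀ x m‖ * (((p : ℝ)⁻¹) ^ k) ^ m) := fun x m => by
    rw [← mul_assoc]
    have := (inv_prime_pos (p := p)).le
    gcongr
    exact π.norm_compContinuousMultilinearMap_le (q₀ x m)
  have hq2 : ∀ x, Tendsto (fun m => ‖q x m‖ * (((p : ℝ)⁻¹) ^ k) ^ m) atTop (𝓝 0) := fun x => by
    refine squeeze_zero (fun m => ?_) (hqle x) (by simpa using (hq₀2 x).const_mul ‖π‖)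
    have := (inv_prime_pos (p := p)).le
    positivity
  have hq3 : ∀ x y, ‖e y - e x‖ ≤ ((p : ℝ)⁻¹) ^ k →
      HasSum (fun m => q x m fun _ => e y - e x) (F.1 y) := fun x y h => by
    rw [← hF y]
    exact (hq₀3 x y h).map π π.continuous
  have hfin : Finite (Quotient (ballSetoid p e k)) := finite_ballSetoid hc k
  have : Fintype (Quotient (ballSetoid p e k)) := Fintype.ofFinite _
  let T : Quotient (ballSetoid p e k) → BoundedSeries p E A → X → A := fun c Q y =>
    if Quotient.mk (ballSetoid p e k) y = c then evalMap p A k (e c.out) (e y) Q else 0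
  -- Here `k'` and `C` are fixed before `δ` is chosen: summing a bounded series over one ball, with
  -- zero outside, is a bounded operator into the `p^{k'}`-analytic functions.
  obtain ⟨k', C, hC, hT⟩ := exists_analyticBound_family
    (ι := Quotient (ballSetoid p e k) × BoundedSeries p E A) (p := p) (A := A)
    (Y := BoundedSeries p E A →L[ℚ_[p]] A) hc (fun i => T i.1 i.2) (fun i => ‖i.2‖)
    (fun i => norm_nonneg _) (fun x => by
      refine ⟨evalMap p A k (e (Quotient.mk (ballSetoid p e k) x).out),
        analyticAt_evalMap _ _ _ (norm_sub_out_lt e k x),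
        fun i => if Quotient.mk (ballSetoid p e k) x = i.1 then
          ContinuousLinearMap.apply ℚ_[p] A i.2 else 0, fun i => ?_, ?_⟩
      · dsimp only
        split_ifs
        · exact norm_apply_le_norm _
        · simp
      · filter_upwards [mk_ballSetoid_eq_of_near (p := p) (k := k) x] with z hz y hy i
        have hyx := hz y hy
        dsimp only [T]
        by_cases h : Quotient.mk (ballSetoid p e k) x = i.1
        · rw [if_pos (hyx.trans h), if_pos h, ← h, hy]
          rfl
        · rw [if_neg (by rwa [hyx]), if_neg h]
          rfl)
  refine ⟨k', ∑ _c : Quotient (ballSetoid p e k), C, fun δ hδ => ?_⟩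
  -- There are finitely many balls and on each of them the terms tend to zero, so a common
  -- truncation degree makes every remaining term at most `δ`. The truncated part is `G`, and the
  -- tails bound `F - G`.
  obtain ⟨M, hM⟩ : ∃ M : ℕ, ∀ c : Quotient (ballSetoid p e k), ∀ m, M ≤ m →
      ‖q c.out m‖ * (((p : ℝ)⁻¹) ^ k) ^ m ≤ δ := by
    have : ∀ᶠ M in atTop, ∀ c : Quotient (ballSetoid p e k),
        ‖q c.out M‖ * (((p : ℝ)⁻¹) ^ k) ^ M ≤ δ :=
      eventually_all.2 fun c => (hq2 c.out).eventually_le_const hδ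
    obtain ⟨M, hM⟩ := eventually_atTop.1 this
    exact ⟨M, fun c m hm => hM m hm c⟩
  let tail : Quotient (ballSetoid p e k) → FormalMultilinearSeries ℚ_[p] E A := fun c m =>
    if m < M then 0 else q c.out m
  have htail : ∀ c m, ‖tail c m‖ * (((p : ℝ)⁻¹) ^ k) ^ m ≤ δ := fun c m => by
    simp only [tail]
    split_ifs with h
    · simpa using hδ.le
    · exact hM c m (not_lt.1 h)
  choose g hgJ hg using fun (c : Quotient (ballSetoid p e k)) (m : ℕ) =>
    ball_multilinear_mem_smul_top hc J c (e c.out) (q c.out m) (fun v => hπ _)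
  let G : locAn p e A := ∑ c, ∑ m ∈ Finset.range M, g c m
  have hG : G ∈ J • (⊤ : Submodule A (locAn p e A)) :=
    Submodule.sum_mem _ fun c _ => Submodule.sum_mem _ fun m _ => hgJ c m
  refine ⟨G, hG, ?_⟩
  have hFG : (F - G).1 = ∑ c, T c (rescale k (tail c) δ (htail c)) := by
    funext y
    have hG' : G.1 y = ∑ m ∈ Finset.range M,
        q (Quotient.mk (ballSetoid p e k) y).out m
          (fun _ => e y - e (Quotient.mk (ballSetoid p e k) y).out) := by
      simp only [G, Submodule.coe_sum, Finset.sum_apply, hg]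
      rw [Finset.sum_eq_single (Quotient.mk (ballSetoid p e k) y)]
      · simp
      · intro c _ hcy
        refine Finset.sum_eq_zero fun m _ => if_neg (Ne.symm hcy)
      · simp
    rw [Finset.sum_apply, Finset.sum_eq_single (Quotient.mk (ballSetoid p e k) y)]
    · change F.1 y - G.1 y = T _ _ y
      simp only [T, if_true]
      have h1 := hasSum_evalMap k _ (e y) (norm_sub_out_lt e k y)
        (tail (Quotient.mk (ballSetoid p e k) y)) δ (htail _)
      have h2 := hq3 (Quotient.mk (ballSetoid p e k) y).out y (norm_sub_out_lt e k y).le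
      have h3 : HasSum (fun m => if m ∈ Finset.range M then
          q (Quotient.mk (ballSetoid p e k) y).out m
          (fun _ => e y - e (Quotient.mk (ballSetoid p e k) y).out) else 0) (G.1 y) := by
        rw [hG']
        exact hasSum_ite_mem_finset _ _
      refine HasSum.unique ?_ h1
      refine (congrArg (HasSum · _) (funext fun m => ?_)).mpr (h2.sub h3)
      simp only [tail, Finset.mem_range]
      split_ifs <;> simp
    · intro c _ hcy
      exact if_neg (Ne.symm hcy)
    · simp
  rw [hFG, Finset.sum_mul]
  refine AnalyticBound.sum _ fun c _ x => ?_
  obtain ⟨r, h1, h2, h3⟩ := hT (c, rescale k (tail c) δ (htail c)) x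
  exact ⟨r, fun m => (h1 m).trans
      (mul_le_mul_of_nonneg_left (norm_rescale_le _ _ _ (htail c)) hC), h2, h3⟩

/-- The continuous functionals map locally analytic functions with values in a closed ideal into
this ideal. -/
theorem Dist.apply_mem_of_ideal_valued [CompleteSpace A] [IsUltrametricDist E]
    [FiniteDimensional ℚ_[p] E] {e : X → E} (hc : IsCompact (Set.range e))
    {S : Submodule A (X → A)} (P : locAn p e A →ₗ[A] S)
    (hP : ∀ k, ∃ k' : ℕ, ∃ C : ℝ, 0 ≤ C ∧ ∀ (f : locAn p e A) B, AnalyticBound p e k B f.1 →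
      AnalyticBound p e k' (C * B) (P f).1)
    (J : Ideal A) (hJ : IsClosed (J : Set A)) (π : A →L[ℚ_[p]] A) (hπ : ∀ a, π a ∈ J)
    (F : locAn p e A) (hF : ∀ y, π (F.1 y) = F.1 y) (μ : Dist p e S) : μ.1 (P F) ∈ J := by
  obtain ⟨k', C, hC⟩ := exists_approx_of_ideal_valued hc J π hπ F hF
  obtain ⟨k'', CP, hCP, hP⟩ := hP k'
  obtain ⟨Cμ, hμ⟩ := μ.2 k''
  rw [← SetLike.mem_coe, ← hJ.closure_eq, Metric.mem_closure_iff]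
  intro ε hε
  obtain ⟨δ, hδ, hδε⟩ : ∃ δ : ℝ, 0 < δ ∧ Cμ * (CP * (C * δ)) < ε := by
    have h1 : Tendsto (fun δ : ℝ => Cμ * (CP * (C * δ))) (𝓝[>] 0) (𝓝 0) := by
      have : Continuous fun δ : ℝ => Cμ * (CP * (C * δ)) := by fun_prop
      exact tendsto_nhdsWithin_of_tendsto_nhds (this.tendsto' 0 0 (by simp))
    obtain ⟨δ, h2, h3⟩ := ((h1.eventually_lt_const hε).and self_mem_nhdsWithin).exists
    exact ⟨δ, h3, h2⟩
  obtain ⟨G, hG, hb⟩ := hC δ hδ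
  -- `A`-linearity alone handles the approximants; continuity of `μ` and closedness of `J` then
  -- handle the limit.
  have hGJ : μ.1 (P G) ∈ J := by
    refine Submodule.smul_induction_on hG (fun a ha f _ => ?_) fun f f' hf hf' => ?_
    · rw [map_smul, map_smul, smul_eq_mul]
      exact J.mul_mem_right _ ha
    · rw [map_add, map_add]
      exact J.add_mem hf hf'
  refine ⟨_, hGJ, ?_⟩
  have := hμ (P (F - G)) _ (hP _ _ hb)
  rw [map_sub, map_sub] at this
  rw [dist_eq_norm]
  exact this.trans_lt hδε

end IdealValued
end BranchingLaw
end

noncomputable section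
namespace BranchingLaw

/-! ### Triangular decompositions over `ℤ_p` -/

section Triangular

variable {p : ℕ} [Fact p.Prime]

lemma isUnit_iff_not_dvd (z : ℤ_[p]) : IsUnit z ↔ ¬ (p : ℤ_[p]) ∣ z := by
  rw [← Ideal.mem_span_singleton, ← PadicInt.maximalIdeal_eq_span_p, IsLocalRing.mem_maximalIdeal,
    mem_nonunits_iff, not_not]

lemma toZMod_eq_zero_iff (z : ℤ_[p]) : PadicInt.toZMod z = 0 ↔ (p : ℤ_[p]) ∣ z := by
  rw [← RingHom.mem_ker, PadicInt.ker_toZMod, PadicInt.maximalIdeal_eq_span_p,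
    Ideal.mem_span_singleton]

/-- A matrix over `ℤ_p` which is upper triangular mod `p` with unit diagonal is the product of a
lower unipotent matrix congruent to `1` and an upper triangular matrix. -/
lemma exists_lower_mul_upper : ∀ (m : ℕ) (M : Matrix (Fin m) (Fin m) ℤ_[p]),
    (∀ i j, j < i → (p : ℤ_[p]) ∣ M i j) → (∀ i, ¬ (p : ℤ_[p]) ∣ M i i) →
    ∃ K U : Matrix (Fin m) (Fin m) ℤ_[p], (∀ i, K i i = 1) ∧ (∀ i j, i < j → K i j = 0) ∧
      (∀ i j, j < i → (p : ℤ_[p]) ∣ K i j) ∧ (∀ i j, j < i → U i j = 0) ∧ M = K * U := by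
  intro m
  induction m with
  | zero =>
    exact fun M _ _ => ⟨1, 1, fun i => i.elim0, fun i => i.elim0, fun i => i.elim0,
      fun i => i.elim0, Matrix.ext fun i => i.elim0⟩
  | succ m ih =>
    intro M hl hd
    obtain ⟨a, ha⟩ := (isUnit_iff_not_dvd _).2 (hd 0)
    let c : Fin m → ℤ_[p] := fun i => M i.succ 0 * (a⁻¹ : ℤ_[p]ˣ)
    have hc : ∀ i, (p : ℤ_[p]) ∣ c i := fun i => (hl i.succ 0 (Fin.succ_pos i)).mul_right _
    -- Gaussian elimination: the induction applies to the Schur complement of the top left entry. As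
    -- `p` divides every `c i`, this complement is congruent mod `p` to the lower right block and
    -- inherits both hypotheses.
    obtain ⟨K, U, hK1, hK0, hKp, hU, hM⟩ := ih
      (Matrix.of fun i j => M i.succ j.succ - c i * M 0 j.succ)
      (fun i j hij => dvd_sub (hl _ _ (Fin.succ_lt_succ_iff.2 hij)) ((hc i).mul_right _))
      (fun i h => hd i.succ ((dvd_sub_left ((hc i).mul_right _)).1 h))
    refine ⟨Matrix.of fun i j => Fin.cases (Fin.cases 1 (fun _ => 0) j)
      (fun i => Fin.cases (c i) (fun j => K i j) j) i,
      Matrix.of fun i j => Fin.cases (M 0 j) (fun i => Fin.cases 0 (fun j => U i j) j) i,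
      ?_, ?_, ?_, ?_, ?_⟩
    · intro i
      induction i using Fin.cases with
      | zero => rfl
      | succ i => exact hK1 i
    · intro i j hij
      induction i using Fin.cases with
      | zero =>
        induction j using Fin.cases with
        | zero => exact absurd hij (lt_irrefl _)
        | succ j => rfl
      | succ i =>
        induction j using Fin.cases with
        | zero => exact absurd hij (Fin.not_lt_zero _)
        | succ j => exact hK0 i j (Fin.succ_lt_succ_iff.1 hij)
    · intro i j hij
      induction i using Fin.cases with
      | zero => exact absurd hij (Fin.not_lt_zero _)
      | succ i =>
        induction j using Fin.cases with
        | zero => exact hc i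
        | succ j => exact hKp i j (Fin.succ_lt_succ_iff.1 hij)
    · intro i j hij
      induction i using Fin.cases with
      | zero => exact absurd hij (Fin.not_lt_zero _)
      | succ i =>
        induction j using Fin.cases with
        | zero => rfl
        | succ j => exact hU i j (Fin.succ_lt_succ_iff.1 hij)
    · ext i j
      rw [Matrix.mul_apply, Fin.sum_univ_succ]
      induction i using Fin.cases with
      | zero => simp
      | succ i =>
        induction j using Fin.cases with
        | zero =>
          have : c i * M 0 0 = M i.succ 0 := by
            rw [← ha]
            simp [c]
          simp [this]
        | succ j =>
          have := congrFun (congrFun hM i) j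
          rw [Matrix.mul_apply] at this
          simp only [Matrix.of_apply, Fin.cases_zero, Fin.cases_succ]
          rw [← this]
          simp

lemma isUnit_det_of_congr_one {m : ℕ} {M : Matrix (Fin m) (Fin m) ℤ_[p]}
    (h : ∀ i j, (p : ℤ_[p]) ∣ M i j - (1 : Matrix (Fin m) (Fin m) ℤ_[p]) i j) : IsUnit M.det := by
  rw [isUnit_iff_not_dvd, ← toZMod_eq_zero_iff, RingHom.map_det]
  have : PadicInt.toZMod.mapMatrix M = (1 : Matrix (Fin m) (Fin m) (ZMod p)) := by
    rw [← map_one PadicInt.toZMod.mapMatrix]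
    ext i j
    have := (toZMod_eq_zero_iff _).2 (h i j)
    rw [map_sub, sub_eq_zero] at this
    exact this
  rw [this, Matrix.det_one]
  exact one_ne_zero

/-- The subgroup of lower triangular matrices. -/
def lowerTri (p : ℕ) [Fact p.Prime] (m : ℕ) : Subgroup (Matrix.GeneralLinearGroup (Fin m) ℤ_[p])
    where
  carrier := {g | ∀ i j, i < j → g.1 i j = 0}
  one_mem' := fun i j h => by simp [h.ne]
  mul_mem' := fun {a b} ha hb => by
    have h1 : Matrix.BlockTriangular a.1 OrderDual.toDual := fun i j h => ha i j h
    have h2 : Matrix.BlockTriangular b.1 OrderDual.toDual := fun i j h => hb i j h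
    exact fun i j h => (h1.mul h2) h
  inv_mem' := fun {a} ha => by
    have h1 : Matrix.BlockTriangular a.1 OrderDual.toDual := fun i j h => ha i j h
    let : Invertible a.1 := a.invertible
    have h2 := Matrix.blockTriangular_inv_of_blockTriangular h1
    intro i j h
    rw [Matrix.coe_units_inv]
    exact h2 h

/-- The subgroup of matrices which are diagonal mod `p`. -/
def diagMod (p : ℕ) [Fact p.Prime] (m : ℕ) : Subgroup (Matrix.GeneralLinearGroup (Fin m) ℤ_[p])
    where
  carrier := {g | ∀ i j, i ≠ j → (p : ℤ_[p]) ∣ g.1 i j}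
  one_mem' := fun i j h => by simp [h]
  mul_mem' := fun {a b} ha hb i j h => by
    rw [Units.val_mul, Matrix.mul_apply]
    refine Finset.dvd_sum fun l _ => ?_
    by_cases hl : i = l
    · exact (hb l j (hl ▸ h)).mul_left _
    · exact (ha i l hl).mul_right _
  inv_mem' := fun {a} ha i j h => by
    -- If `p` divided the diagonal entry it would divide the whole row and hence the determinant.
    -- Row `i` of `a a⁻¹ = 1` can then be solved mod `p` for the entry `(i, j)` of `a⁻¹`.
    have hdet : IsUnit (a.1 i i) := by
      rw [isUnit_iff_not_dvd]
      intro hi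
      have h1 : (p : ℤ_[p]) ∣ a.1.det := by
        rw [Matrix.det_eq_sum_mul_adjugate_row a.1 i]
        refine Finset.dvd_sum fun l _ => ?_
        by_cases hl : i = l
        · rw [← hl]
          exact hi.mul_right _
        · exact (ha i l hl).mul_right _
      exact (isUnit_iff_not_dvd _).1 ((Matrix.isUnit_iff_isUnit_det _).1 a.isUnit) h1
    have h1 : (a.1 * a⁻¹.1) i j = 0 := by
      rw [← Units.val_mul, mul_inv_cancel]
      simp [h]
    rw [Matrix.mul_apply, ← Finset.add_sum_erase _ _ (Finset.mem_univ i)] at h1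
    have h2 : (p : ℤ_[p]) ∣ ∑ l ∈ Finset.univ.erase i, a.1 i l * a⁻¹.1 l j :=
      Finset.dvd_sum fun l hl => (ha i l (Finset.ne_of_mem_erase hl).symm).mul_right _
    have h3 : (p : ℤ_[p]) ∣ a.1 i i * a⁻¹.1 i j := by
      rw [eq_neg_of_add_eq_zero_left h1]
      exact h2.neg_right
    exact hdet.dvd_mul_left.1 h3

/-- A lower unipotent matrix as an element of `GL_m(ℤ_p)`. -/
def lowerUnit {m : ℕ} (K : Matrix (Fin m) (Fin m) ℤ_[p]) (h1 : ∀ i, K i i = 1)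
    (h0 : ∀ i j, i < j → K i j = 0) : Matrix.GeneralLinearGroup (Fin m) ℤ_[p] :=
  Matrix.GeneralLinearGroup.mk'' K (by
    rw [Matrix.det_of_isLowerTriangular K (fun i j h => h0 i j h)]
    simp [h1])

lemma isUnit_diag_of_lower {m : ℕ} {g : Matrix.GeneralLinearGroup (Fin m) ℤ_[p]}
    (h : ∀ i j, i < j → g.1 i j = 0) (i : Fin m) : IsUnit (g.1 i i) := by
  have h1 : IsUnit g.1.det := (Matrix.isUnit_iff_isUnit_det _).1 g.isUnit
  rw [Matrix.det_of_isLowerTriangular g.1 (fun i j hij => h i j hij)] at h1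
  exact isUnit_of_dvd_unit (Finset.dvd_prod_of_mem (fun i => g.1 i i) (Finset.mem_univ i)) h1

lemma isUnit_diag_of_upper {m : ℕ} {g : Matrix.GeneralLinearGroup (Fin m) ℤ_[p]}
    (h : ∀ i j, j < i → g.1 i j = 0) (i : Fin m) : IsUnit (g.1 i i) := by
  have h1 : IsUnit g.1.det := (Matrix.isUnit_iff_isUnit_det _).1 g.isUnit
  rw [Matrix.det_of_isUpperTriangular (M := g.1) (fun i j hij => h i j hij)] at h1
  exact isUnit_of_dvd_unit (Finset.dvd_prod_of_mem (fun i => g.1 i i) (Finset.mem_univ i)) h1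

lemma exists_lowerUnit_mul_upper {m : ℕ} (g : Matrix.GeneralLinearGroup (Fin m) ℤ_[p])
    (hl : ∀ i j, j < i → (p : ℤ_[p]) ∣ g.1 i j) (hd : ∀ i, ¬ (p : ℤ_[p]) ∣ g.1 i i) :
    ∃ k U : Matrix.GeneralLinearGroup (Fin m) ℤ_[p], (∀ i, k.1 i i = 1) ∧
      (∀ i j, i < j → k.1 i j = 0) ∧ (∀ i j, j < i → (p : ℤ_[p]) ∣ k.1 i j) ∧
      (∀ i j, j < i → U.1 i j = 0) ∧ g = k * U := by
  obtain ⟨K, U, hK1, hK0, hKp, hU, hM⟩ := exists_lower_mul_upper m g.1 hl hd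
  have h : (lowerUnit K hK1 hK0)⁻¹.1 * g.1 = U := by
    rw [hM]
    change (lowerUnit K hK1 hK0)⁻¹.1 * ((lowerUnit K hK1 hK0).1 * U) = U
    rw [← mul_assoc, ← Units.val_mul, inv_mul_cancel, Units.val_one, one_mul]
  refine ⟨lowerUnit K hK1 hK0, (lowerUnit K hK1 hK0)⁻¹ * g, hK1, hK0, hKp, ?_, by group⟩
  rw [Units.val_mul, h]
  exact hU

lemma not_dvd_diag_of_mem_borel {m : ℕ} {g : Matrix.GeneralLinearGroup (Fin m) ℤ_[p]}
    (hl : ∀ i j, j < i → (p : ℤ_[p]) ∣ g.1 i j) (i : Fin m) : ¬ (p : ℤ_[p]) ∣ g.1 i i := by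
  intro hi
  have h1 : IsUnit g.1.det := (Matrix.isUnit_iff_isUnit_det _).1 g.isUnit
  rw [isUnit_iff_not_dvd, ← toZMod_eq_zero_iff, RingHom.map_det,
    Matrix.det_of_isUpperTriangular (M := PadicInt.toZMod.mapMatrix g.1)
      (fun i j hij => (toZMod_eq_zero_iff _).2 (hl i j hij))] at h1
  exact h1 (Finset.prod_eq_zero (Finset.mem_univ i) ((toZMod_eq_zero_iff _).2 hi))

end Triangular

/-! ### Iwahori decomposition and membership in Iw^1. -/

section Iwahori

variable {p : ℕ} [Fact p.Prime] {n : ℕ}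

lemma blk_castAdd_castAdd (a b c d : Matrix (Fin n) (Fin n) ℤ_[p]) (i j : Fin n) :
    blk a b c d (Fin.castAdd n i) (Fin.castAdd n j) = a i j := by
  change Matrix.fromBlocks _ _ _ _ (finSumFinEquiv.symm _) (finSumFinEquiv.symm _) = _
  rw [finSumFinEquiv_symm_apply_castAdd, finSumFinEquiv_symm_apply_castAdd]
  rfl

lemma blk_castAdd_natAdd (a b c d : Matrix (Fin n) (Fin n) ℤ_[p]) (i j : Fin n) :
    blk a b c d (Fin.castAdd n i) (Fin.natAdd n j) = b i j := by
  change Matrix.fromBlocks _ _ _ _ (finSumFinEquiv.symm _) (finSumFinEquiv.symm _) = _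
  rw [finSumFinEquiv_symm_apply_castAdd, finSumFinEquiv_symm_apply_natAdd]
  rfl

lemma blk_natAdd_castAdd (a b c d : Matrix (Fin n) (Fin n) ℤ_[p]) (i j : Fin n) :
    blk a b c d (Fin.natAdd n i) (Fin.castAdd n j) = c i j := by
  change Matrix.fromBlocks _ _ _ _ (finSumFinEquiv.symm _) (finSumFinEquiv.symm _) = _
  rw [finSumFinEquiv_symm_apply_castAdd, finSumFinEquiv_symm_apply_natAdd]
  rfl

lemma blk_natAdd_natAdd (a b c d : Matrix (Fin n) (Fin n) ℤ_[p]) (i j : Fin n) :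
    blk a b c d (Fin.natAdd n i) (Fin.natAdd n j) = d i j := by
  change Matrix.fromBlocks _ _ _ _ (finSumFinEquiv.symm _) (finSumFinEquiv.symm _) = _
  rw [finSumFinEquiv_symm_apply_natAdd, finSumFinEquiv_symm_apply_natAdd]
  rfl

lemma exists_eq_blk (M : Matrix (Fin (n + n)) (Fin (n + n)) ℤ_[p]) :
    ∃ a b c d, M = blk a b c d :=
  ⟨_, _, _, _, ((Matrix.reindex finSumFinEquiv finSumFinEquiv).apply_symm_apply M).symm.trans
    (congrArg _ (Matrix.fromBlocks_toBlocks _).symm)⟩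

lemma torus_val (t : Fin (n + n) → ℤ_[p]ˣ) :
    (torus t).1 = Matrix.diagonal fun i => (t i : ℤ_[p]) := rfl

lemma torus_mul_apply (t : Fin (n + n) → ℤ_[p]ˣ) (g : G p n) (i j) :
    (torus t * g).1 i j = t i * g.1 i j := by
  rw [Units.val_mul, torus_val, Matrix.diagonal_mul]

lemma mul_torus_apply (t : Fin (n + n) → ℤ_[p]ˣ) (g : G p n) (i j) :
    (g * torus t).1 i j = g.1 i j * t j := by
  rw [Units.val_mul, torus_val, Matrix.mul_diagonal]

lemma torus_inv (t : Fin (n + n) → ℤ_[p]ˣ) : (torus t)⁻¹ = torus t⁻¹ := by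
  rw [inv_eq_iff_mul_eq_one]
  ext i j
  rw [torus_mul_apply, torus_val, Matrix.diagonal_apply, Units.val_one, Matrix.one_apply]
  split_ifs with h <;> simp [h]

lemma exists_torus_of_lowerTri {g : G p n} (hg : g ∈ lowerTri p (n + n)) :
    ∃ k ∈ lowerUnip p n 0, ∃ t, g = k * torus t := by
  choose t ht using isUnit_diag_of_lower hg
  refine ⟨g * (torus t)⁻¹, ⟨fun i => ?_, fun i j hij => ?_, fun i j _ => by simp⟩, t, by group⟩
  · rw [torus_inv, mul_torus_apply, ← ht]
    simp
  · rw [torus_inv, mul_torus_apply, hg i j hij, zero_mul]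

/-- The Iwahori decomposition. -/
lemma exists_iwahori {g : G p n} (hg : g ∈ Iw p n) :
    ∃ k ∈ lowerUnip p n 1, ∃ t, ∃ m ∈ upperUnip p n 0, g = k * torus t * m ∧
      (g ∈ diagMod p (n + n) → m ∈ upperUnip p n 1) := by
  have hl := (mem_Iw_iff g).1 hg
  obtain ⟨k, U, hk1, hk0, hkp, hU, rfl⟩ := exists_lowerUnit_mul_upper g hl
    (not_dvd_diag_of_mem_borel hl)
  choose t ht using isUnit_diag_of_upper hU
  have hm1 : ∀ i, ((torus t)⁻¹ * U).1 i i = 1 := fun i => by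
    rw [torus_inv, torus_mul_apply, ← ht]
    simp
  have hm0 : ∀ i j, j < i → ((torus t)⁻¹ * U).1 i j = 0 := fun i j hij => by
    rw [torus_inv, torus_mul_apply, hU i j hij, mul_zero]
  refine ⟨k, ⟨hk1, hk0, fun i j h => by simpa using hkp i j h⟩, t, (torus t)⁻¹ * U,
    ⟨hm1, hm0, fun i j _ => by simp⟩, by group, fun hD => ⟨hm1, hm0, fun i j hij => ?_⟩⟩
  -- The factor `k` is always diagonal mod `p`. When `g` is too, so is the upper factor `k⁻¹ g`,
  -- which puts `m` in `N(pℤ_p)`.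
  have hk : k ∈ diagMod p (n + n) := fun i j hij => by
    rcases lt_or_gt_of_ne hij with h | h
    · rw [hk0 i j h]
      exact dvd_zero _
    · exact hkp i j h
  have hU' : U ∈ diagMod p (n + n) := by
    have := mul_mem (inv_mem hk) hD
    rwa [inv_mul_cancel_left] at this
  rw [torus_inv, torus_mul_apply, pow_one]
  exact (hU' i j hij.ne).mul_left _

lemma lowerUnip_mem_diagMod {k : G p n} (hk : k ∈ lowerUnip p n 1) : k ∈ diagMod p (n + n) :=
  fun i j hij => by
    rcases lt_or_gt_of_ne hij with h | h
    · rw [hk.2.1 i j h]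
      exact dvd_zero _
    · simpa using hk.2.2 i j h

lemma upperUnip_mem_diagMod {m : G p n} (hm : m ∈ upperUnip p n 1) : m ∈ diagMod p (n + n) :=
  fun i j hij => by
    rcases lt_or_gt_of_ne hij with h | h
    · simpa using hm.2.2 i j h
    · rw [hm.2.1 i j h]
      exact dvd_zero _

lemma torus_mem_diagMod (t : Fin (n + n) → ℤ_[p]ˣ) : torus t ∈ diagMod p (n + n) :=
  fun i j hij => by
    rw [torus_val, Matrix.diagonal_apply_ne _ hij]
    exact dvd_zero _

lemma diagMod_le_Iw : diagMod p (n + n) ≤ Iw p n :=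
  fun g hg => (mem_Iw_iff g).2 fun i j hij => hg i j hij.ne'

/-- By the Iwahori decomposition `N̄(pℤ_p) T(ℤ_p) N(pℤ_p)` is the group of matrices diagonal mod
`p`, and Iw^1 is its right translate by `u`. Questions about Iw^1 thus become questions about a
subgroup that is visible mod `p`. -/
lemma mem_iwSet_iff (g : G p n) : g ∈ iwSet p n 1 ↔ g * (uElt p n)⁻¹ ∈ diagMod p (n + n) := by
  constructor
  · rintro ⟨k, hk, t, _, ⟨m, hm, rfl⟩, rfl⟩
    have : k * torus t * (m * uElt p n) * (uElt p n)⁻¹ = k * torus t * m := by group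
    rw [this]
    exact mul_mem (mul_mem (lowerUnip_mem_diagMod hk) (torus_mem_diagMod t))
      (upperUnip_mem_diagMod hm)
  · intro h
    obtain ⟨k, hk, t, m, -, e, hm⟩ := exists_iwahori (diagMod_le_Iw h)
    exact ⟨k, hk, t, m * uElt p n, ⟨m, hm h, rfl⟩, by rw [← mul_assoc, ← e]; group⟩

lemma upper_mul {a b : G p n} (ha : a ∈ upperUnip p n 0) (hb : b ∈ upperUnip p n 0) :
    a * b ∈ upperUnip p n 0 := by
  have h1 : Matrix.BlockTriangular a.1 id := fun i j h => ha.2.1 i j h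
  have h2 : Matrix.BlockTriangular b.1 id := fun i j h => hb.2.1 i j h
  refine ⟨fun i => ?_, fun i j h => (h1.mul h2) h, fun i j _ => by simp⟩
  rw [Units.val_mul, Matrix.mul_apply, Finset.sum_eq_single i, ha.1, hb.1, mul_one]
  · intro l _ hl
    rcases lt_or_gt_of_ne hl with h | h
    · rw [ha.2.1 i l h, zero_mul]
    · rw [hb.2.1 l i h, mul_zero]
  · simp

lemma iota_mul (h h' : Gn p n × Gn p n) : iota (h * h') = iota h * iota h' := by
  refine Units.ext ?_
  change blk (h.1.1 * h'.1.1) 0 0 (h.2.1 * h'.2.1) = blk h.1.1 0 0 h.2.1 * blk h'.1.1 0 0 h'.2.1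
  rw [blk_mul]
  simp

lemma iota_one : iota (1 : Gn p n × Gn p n) = 1 := Units.ext blk_one

lemma iota_inv (h : Gn p n × Gn p n) : iota h⁻¹ = (iota h)⁻¹ := by
  rw [eq_inv_iff_mul_eq_one, ← iota_mul, inv_mul_cancel, iota_one]

/-- Since `g ι(h) u⁻¹ = (g u⁻¹)(u ι(h) u⁻¹)`, translation by `ι(h)` becomes multiplication by an
element of `diagMod`; this is what membership in Iw_H^1 means. -/
lemma iwSet_mul_iota {h : Gn p n × Gn p n} (hh : h ∈ iwH p n 1) (g : G p n) :
    g * iota h ∈ iwSet p n 1 ↔ g ∈ iwSet p n 1 := by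
  have h1 := (mem_iwSet_iff _).1 hh
  rw [mem_iwSet_iff, mem_iwSet_iff, ← Subgroup.mul_mem_cancel_right _ h1]
  have : g * iota h * (uElt p n)⁻¹ = g * (uElt p n)⁻¹ * (uElt p n * iota h * (uElt p n)⁻¹) := by
    group
  rw [this, Subgroup.mul_mem_cancel_right _ h1, Subgroup.mul_mem_cancel_right _ h1]

lemma iwH_inv {h : Gn p n × Gn p n} (hh : h ∈ iwH p n 1) : h⁻¹ ∈ iwH p n 1 := by
  have h1 := (mem_iwSet_iff _).1 hh
  refine (mem_iwSet_iff _).2 ?_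
  have : uElt p n * iota h⁻¹ * (uElt p n)⁻¹ = (uElt p n * iota h * (uElt p n)⁻¹)⁻¹ := by
    rw [iota_inv]; group
  rw [this]
  exact inv_mem h1

/-- On `N(ℤ_p)`, the set `Iw^1` is `N^1`. -/
lemma mem_unipCoset_iff {g : G p n} (hg : g ∈ upperUnip p n 0) :
    g ∈ unipCoset p n 1 ↔ g ∈ iwSet p n 1 := by
  have hu : (uElt p n)⁻¹ ∈ upperUnip p n 0 := by
    have e : (uElt p n)⁻¹.1 = blk 1 (-antidiag p n) 0 1 := rfl
    refine ⟨fun i => ?_, fun i j hij => ?_, fun i j _ => by simp⟩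
    · rw [e]
      induction i using Fin.addCases with
      | left i => rw [blk_castAdd_castAdd, Matrix.one_apply_eq]
      | right i => rw [blk_natAdd_natAdd, Matrix.one_apply_eq]
    · rw [e]
      induction i using Fin.addCases with
      | left i =>
        induction j using Fin.addCases with
        | left j =>
          rw [blk_castAdd_castAdd, Matrix.one_apply_ne]
          exact fun h => by simp [h] at hij
        | right j =>
          exfalso
          simp only [Fin.lt_def, Fin.val_castAdd, Fin.val_natAdd] at hij
          omega
      | right i =>
        induction j using Fin.addCases with
        | left j => rw [blk_natAdd_castAdd, Matrix.zero_apply]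
        | right j =>
          rw [blk_natAdd_natAdd, Matrix.one_apply_ne]
          exact fun h => by simp [h] at hij
  rw [mem_iwSet_iff]
  constructor
  · rintro ⟨m, hm, rfl⟩
    rw [mul_inv_cancel_right]
    exact upperUnip_mem_diagMod hm
  · intro h
    have h1 := upper_mul hg hu
    exact ⟨g * (uElt p n)⁻¹, ⟨h1.1, h1.2.1, fun i j hij => by simpa using h i j hij.ne⟩, by group⟩

end Iwahori
end BranchingLaw
end

noncomputable section
namespace BranchingLaw

/-! ### The open orbit of `H` -/

section Orbit

variable {p : ℕ} [Fact p.Prime] {n : ℕ}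

lemma antidiag_mul_apply {κ : Type*} (M : Matrix (Fin n) κ ℤ_[p]) (i j) :
    (antidiag p n * M) i j = M (Fin.rev i) j := by
  simp [Matrix.mul_apply, antidiag]

lemma mul_antidiag_apply {κ : Type*} (M : Matrix κ (Fin n) ℤ_[p]) (i j) :
    (M * antidiag p n) i j = M i (Fin.rev j) := by
  have : ∀ x : Fin n, j = Fin.rev x ↔ x = Fin.rev j := fun x => by
    rw [← Fin.rev_eq_iff, eq_comm]
  simp [Matrix.mul_apply, antidiag, this]

lemma antidiag_mul_self : antidiag p n * antidiag p n = 1 := by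
  ext i j
  rw [antidiag_mul_apply, antidiag, Matrix.of_apply, Fin.rev_rev, Matrix.one_apply]
  simp [eq_comm]

variable (p n) in
/-- The matrix `w_n` as an element of `GL_n(ℤ_p)`. -/
def antidiagUnit : Gn p n := ⟨antidiag p n, antidiag p n, antidiag_mul_self, antidiag_mul_self⟩

lemma conj_antidiag_apply (g : Gn p n) (i j) :
    (antidiagUnit p n * g * antidiagUnit p n).1 i j = g.1 (Fin.rev i) (Fin.rev j) := by
  change (antidiag p n * g.1 * antidiag p n) i j = _
  rw [mul_antidiag_apply, antidiag_mul_apply]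

/-- `N^1` lies in the orbit `B̄ u H` of the lower triangular group and `H`. -/
lemma exists_lowerTri_mul_uElt_mul_iota {m : G p n} (hm : m ∈ upperUnip p n 1) :
    ∃ l ∈ lowerTri p (n + n), ∃ h, m * uElt p n = l * uElt p n * iota h := by
  obtain ⟨a, b, c, d, hM⟩ := exists_eq_blk m.1
  obtain ⟨h1, h2, h3⟩ := hm
  simp only [hM, pow_one] at h1 h2 h3
  have hc : c = 0 := by
    ext i j
    rw [← blk_natAdd_castAdd a b c d, h2 _ _ (by
      simp only [Fin.lt_def, Fin.val_castAdd, Fin.val_natAdd]; omega)]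
    rfl
  have ha : ∀ i j, (p : ℤ_[p]) ∣ a i j - (1 : Matrix (Fin n) (Fin n) ℤ_[p]) i j := fun i j => by
    rw [← blk_castAdd_castAdd a b c d]
    rcases lt_trichotomy i j with h | rfl | h
    · rw [Matrix.one_apply_ne h.ne, sub_zero]
      exact h3 _ _ (by simpa only [Fin.lt_def, Fin.val_castAdd] using h)
    · rw [h1, Matrix.one_apply_eq, sub_self]
      exact dvd_zero _
    · rw [Matrix.one_apply_ne h.ne', sub_zero, h2 _ _ (by simpa only [Fin.lt_def, Fin.val_castAdd] using h)]
      exact dvd_zero _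
  have hd : ∀ i j, (p : ℤ_[p]) ∣ d i j - (1 : Matrix (Fin n) (Fin n) ℤ_[p]) i j := fun i j => by
    rw [← blk_natAdd_natAdd a b c d]
    rcases lt_trichotomy i j with h | rfl | h
    · rw [Matrix.one_apply_ne h.ne, sub_zero]
      exact h3 _ _ (by simpa only [Fin.lt_def, Fin.val_natAdd, add_lt_add_iff_left] using h)
    · rw [h1, Matrix.one_apply_eq, sub_self]
      exact dvd_zero _
    · rw [Matrix.one_apply_ne h.ne', sub_zero,
        h2 _ _ (by simpa only [Fin.lt_def, Fin.val_natAdd, add_lt_add_iff_left] using h)]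
      exact dvd_zero _
  have hb : ∀ i j, (p : ℤ_[p]) ∣ b i j := fun i j => by
    rw [← blk_castAdd_natAdd a b c d]
    exact h3 _ _ (by simp only [Fin.lt_def, Fin.val_castAdd, Fin.val_natAdd]; omega)
  have hx : ∀ i j, (p : ℤ_[p]) ∣
      (a + b * antidiag p n) i j - (1 : Matrix (Fin n) (Fin n) ℤ_[p]) i j := fun i j => by
    rw [Matrix.add_apply, mul_antidiag_apply, add_sub_right_comm]
    exact dvd_add (ha i j) (hb _ _)
  have key : ∀ M : Gn p n, (∀ i j, (p : ℤ_[p]) ∣ M.1 i j -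
      (1 : Matrix (Fin n) (Fin n) ℤ_[p]) i j) → M ∈ diagMod p n := fun M h i j hij => by
    simpa [Matrix.one_apply_ne hij] using h i j
  let W := antidiagUnit p n
  have hWW : W * W = 1 := mul_inv_cancel W
  let x : Gn p n := Matrix.GeneralLinearGroup.mk'' _ (isUnit_det_of_congr_one hx)
  let a' : Gn p n := Matrix.GeneralLinearGroup.mk'' _ (isUnit_det_of_congr_one ha)
  let d' : Gn p n := Matrix.GeneralLinearGroup.mk'' _ (isUnit_det_of_congr_one hd)
  -- Write `m = [a, b; 0, d]`, so that `m u` has top right block `a w + b = x w` with `x = a + b w`.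
  -- Taking `l = ι(l₁, l₂)`, the equation `m u = l u ι(h)` reads `l₁h₁ = a`, `l₂h₂ = d`, `l₁ w h₂ =
  -- x w`. A factorisation of `x (w d w)⁻¹` as lower times upper, `K U`, solves it with `l₁ = K` and
  -- `l₂ = (w U w)⁻¹`, since conjugation by `w` exchanges upper and lower triangular.
  have hy : x * (W * d' * W)⁻¹ ∈ diagMod p n := by
    refine mul_mem (key x hx) (inv_mem fun i j hij => ?_)
    rw [conj_antidiag_apply]
    exact key d' hd _ _ (by simpa using hij)
  obtain ⟨K, U, hK1, hK0, -, hU, e⟩ := exists_lowerUnit_mul_upper _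
    (fun i j hij => hy i j hij.ne') (not_dvd_diag_of_mem_borel fun i j hij => hy i j hij.ne')
  have hl : W * U * W ∈ lowerTri p n := fun i j hij => by
    rw [conj_antidiag_apply]
    exact hU _ _ (by simpa using hij)
  have hl' := inv_mem hl
  refine ⟨iota (K, (W * U * W)⁻¹), fun i j hij => ?_, (K⁻¹ * a', W * U * W * d'), Units.ext ?_⟩
  · change blk _ _ _ _ _ _ = _
    induction i using Fin.addCases with
    | left i =>
      induction j using Fin.addCases with
      | left j =>
        rw [blk_castAdd_castAdd]
        exact hK0 i j (by simpa only [Fin.lt_def, Fin.val_castAdd] using hij)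
      | right j => rw [blk_castAdd_natAdd, Matrix.zero_apply]
    | right i =>
      induction j using Fin.addCases with
      | left j =>
        exfalso
        simp only [Fin.lt_def, Fin.val_castAdd, Fin.val_natAdd] at hij
        omega
      | right j =>
        rw [blk_natAdd_natAdd]
        exact hl' i j (by
          simpa only [Fin.lt_def, Fin.val_natAdd, add_lt_add_iff_left] using hij)
  · have e1 : K * (K⁻¹ * a') = a' := by group
    have e2 : K * W * (W * U * W * d') = x * W := by
      calc K * W * (W * U * W * d') = K * (W * W) * U * W * d' := by group
        _ = K * U * W * d' := by rw [hWW]; group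
        _ = x * (W * d' * W)⁻¹ * W * d' := by rw [e]
        _ = x * W⁻¹ := by group
        _ = x * W := rfl
    have e3 : (W * U * W)⁻¹ * (W * U * W * d') = d' := by group
    have e4 : (a + b * antidiag p n) * antidiag p n = a * antidiag p n + b := by
      rw [add_mul, mul_assoc, antidiag_mul_self, mul_one]
    have e1' := congrArg Units.val e1
    have e2' := congrArg Units.val e2
    have e3' := congrArg Units.val e3
    change m.1 * blk 1 (antidiag p n) 0 1 =
      blk K.1 0 0 (W * U * W)⁻¹.1 * blk 1 (antidiag p n) 0 1 *
        blk (K⁻¹ * a').1 0 0 (W * U * W * d').1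
    rw [hM, hc, blk_mul, blk_mul, blk_mul]
    simp only [mul_one, mul_zero, zero_mul, add_zero, zero_add]
    rw [← e4]
    congr 1
    · exact e1'.symm
    · exact e2'.symm
    · exact e3'.symm

end Orbit

/-! ### Algebraic functions -/

section AlgebraicFn

variable {p : ℕ} [Fact p.Prime] {n : ℕ} {L : Type*} [NormedField L] [NormedAlgebra ℚ_[p] L]

variable (p n L) in
/-- The algebra of algebraic functions `GL_{2n}(ℤ_p) → L`. -/
def algFn : Subalgebra L (G p n → L) where
  carrier := {f | IsAlgebraicFn f}
  add_mem' := fun {f f'} h h' => by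
    obtain ⟨m, hm⟩ := h.mul_det
    obtain ⟨m', hm'⟩ := h'.mul_det
    obtain ⟨P, hP⟩ := hm _ (le_max_left m m')
    obtain ⟨P', hP'⟩ := hm' _ (le_max_right m m')
    exact ⟨P + P', max m m', fun g => by rw [Pi.add_apply, add_mul, hP, hP', map_add]⟩
  mul_mem' := fun {f f'} h h' => by
    obtain ⟨P, m, hP⟩ := h
    obtain ⟨P', m', hP'⟩ := h'
    exact ⟨P * P', m + m', fun g => by
      rw [map_mul, ← hP, ← hP', Pi.mul_apply, pow_add, mul_mul_mul_comm]⟩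
  algebraMap_mem' := fun a => ⟨MvPolynomial.C a, 0, fun g => by simp⟩

/-- Extension of scalars `ℤ_p → L`. -/
def intHom (p : ℕ) [Fact p.Prime] (L : Type*) [NormedField L] [NormedAlgebra ℚ_[p] L] :
    ℤ_[p] →+* L := (algebraMap ℚ_[p] L).comp PadicInt.Coe.ringHom

lemma intHom_injective : Function.Injective (intHom p L) :=
  (algebraMap ℚ_[p] L).injective.comp Subtype.val_injective

lemma algFn_entry (i j) : (fun g : G p n => intHom p L (g.1 i j)) ∈ algFn p n L :=
  ⟨MvPolynomial.X (i, j), 0, fun g => by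
    rw [pow_zero, mul_one, MvPolynomial.eval_X]
    rfl⟩

lemma algFn_det {κ : Type*} [Fintype κ] [DecidableEq κ] {M : G p n → Matrix κ κ ℤ_[p]}
    (h : ∀ i j, (fun g => intHom p L (M g i j)) ∈ algFn p n L) :
    (fun g => intHom p L (M g).det) ∈ algFn p n L := by
  have : (fun g => intHom p L (M g).det) = ∑ σ : Equiv.Perm κ,
      (Equiv.Perm.sign σ : ℤ) • ∏ i, fun g => intHom p L (M g (σ i) i) := by
    funext g
    rw [Matrix.det_apply, map_sum, Finset.sum_apply]
    refine Finset.sum_congr rfl fun σ _ => ?_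
    rw [Units.smul_def, map_zsmul, map_prod, Pi.smul_apply, Finset.prod_apply]
  rw [this]
  exact sum_mem fun σ _ => zsmul_mem (prod_mem fun i _ => h _ _) _

lemma algFn_sum_mul {κ : Type*} [Fintype κ] {a b : κ → G p n → ℤ_[p]}
    (ha : ∀ i, (fun g => intHom p L (a i g)) ∈ algFn p n L)
    (hb : ∀ i, (fun g => intHom p L (b i g)) ∈ algFn p n L) :
    (fun g => intHom p L (∑ i, a i g * b i g)) ∈ algFn p n L := by
  have : (fun g => intHom p L (∑ i, a i g * b i g)) =
      ∑ i, (fun g => intHom p L (a i g)) * fun g => intHom p L (b i g) := by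
    funext g
    rw [map_sum, Finset.sum_apply]
    exact Finset.sum_congr rfl fun i _ => map_mul _ _ _
  rw [this]
  exact sum_mem fun i _ => mul_mem (ha i) (hb i)

lemma algFn_const (z : ℤ_[p]) : (fun _ : G p n => intHom p L z) ∈ algFn p n L :=
  (algFn p n L).algebraMap_mem (intHom p L z)

lemma algFn_det_zpow (m : ℤ) :
    (fun g : G p n => intHom p L (g.det : ℤ_[p]) ^ m) ∈ algFn p n L := by
  have h1 : (fun g : G p n => intHom p L (g.det : ℤ_[p])) ∈ algFn p n L :=
    algFn_det (M := fun g => g.1) algFn_entry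
  have h2 : (fun g : G p n => (intHom p L (g.det : ℤ_[p]))⁻¹) ∈ algFn p n L :=
    ⟨1, 1, fun g => by
      rw [pow_one, map_one]
      exact inv_mul_cancel₀ (Units.ne_zero (unitsHom p L g.det))⟩
  obtain ⟨k, rfl | rfl⟩ := m.eq_nat_or_neg
  · convert pow_mem h1 k using 1
    funext g
    simp
  · have := pow_mem h2 k
    convert this using 1
    funext g
    simp

lemma algFn_inv_entry (i j) : (fun g : G p n => intHom p L (g⁻¹.1 i j)) ∈ algFn p n L := by
  have h : ∀ g : G p n, intHom p L (g⁻¹.1 i j) =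
      intHom p L (g.det : ℤ_[p]) ^ (-1 : ℤ) * intHom p L (g.1.adjugate i j) := fun g => by
    have h0 : intHom p L (g.det : ℤ_[p]) ≠ 0 := Units.ne_zero (unitsHom p L g.det)
    have h1 : g.1.adjugate = (g.det : ℤ_[p]) • g⁻¹.1 := by
      calc g.1.adjugate = g⁻¹.1 * (g.1 * g.1.adjugate) := by
            rw [← mul_assoc, ← Units.val_mul, inv_mul_cancel, Units.val_one, one_mul]
        _ = _ := by rw [Matrix.mul_adjugate, Matrix.mul_smul, mul_one]; rfl
    rw [h1, Matrix.smul_apply, smul_eq_mul, map_mul, zpow_neg_one, inv_mul_cancel_left₀ h0]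
  rw [funext h]
  refine mul_mem (algFn_det_zpow (-1)) ?_
  simp only [Matrix.adjugate_apply]
  refine algFn_det fun a b => ?_
  by_cases hab : a = j
  · subst hab
    simp only [Matrix.updateRow_self]
    exact algFn_const _
  · simp only [Matrix.updateRow_ne hab]
    exact algFn_entry a b

/-- A `B̄`-equivariant algebraic function which is an eigenvector of `H(ℤ_p)` is determined by its
value at `u`. -/
lemma algInd_eq_zero_of_apply_uElt {lam : Fin (n + n) → ℤ} {f : G p n → L} (hf : f ∈ algInd p L lam)
    {c : Gn p n × Gn p n → L} (hc : ∀ g h, f (g * iota h) = c h * f g) (hu : f (uElt p n) = 0) :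
    f = 0 := by
  -- Every element of Iw^1 is in the orbit of `u` under lower triangular matrices and `H`, and both
  -- factors only multiply `f(u) = 0` by scalars.
  have h1 : ∀ g ∈ iwSet p n 1, f g = 0 := by
    rintro _ ⟨k, hk, t, _, ⟨m, hm, rfl⟩, rfl⟩
    obtain ⟨l, hl, h, e⟩ := exists_lowerTri_mul_uElt_mul_iota hm
    obtain ⟨k', hk', t', rfl⟩ := exists_torus_of_lowerTri hl
    rw [hf.2 k ⟨hk.1, hk.2.1, fun i j _ => by simp⟩, e, hc, hf.2 k' hk', hu]
    simp
  obtain ⟨P, m, hP⟩ := hf.1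
  -- Iw^1 contains every matrix `u + p z`. So `P` vanishes on a product of infinite subsets of the
  -- field `L`, one for each coordinate, and must be zero.
  have h2 : P = 0 := by
    refine MvPolynomial.funext_set (fun ij => Set.range fun z : ℤ_[p] =>
      intHom p L ((uElt p n).1 ij.1 ij.2 + p * z)) (fun ij => ?_) fun y hy => ?_
    · refine Set.infinite_range_of_injective fun z z' hz => ?_
      have := intHom_injective hz
      simpa [(Fact.out : p.Prime).ne_zero] using this
    · choose z hz using fun ij => hy ij (Set.mem_univ _)
      let M : Matrix (Fin (n + n)) (Fin (n + n)) ℤ_[p] :=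
        Matrix.of fun i j => (uElt p n).1 i j + p * z (i, j)
      have hM : ∀ i j, (p : ℤ_[p]) ∣ (M * (uElt p n)⁻¹.1) i j -
          (1 : Matrix (Fin (n + n)) (Fin (n + n)) ℤ_[p]) i j := fun i j => by
        have : M * (uElt p n)⁻¹.1 =
            1 + (p : ℤ_[p]) • ((Matrix.of fun i j => z (i, j)) * (uElt p n)⁻¹.1) := by
          have e : M = (uElt p n).1 + (p : ℤ_[p]) • (Matrix.of fun i j => z (i, j)) := by
            ext i j
            simp [M]
          rw [e, add_mul, ← Units.val_mul, mul_inv_cancel, Units.val_one, Matrix.smul_mul]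
        rw [this, Matrix.add_apply, add_sub_cancel_left]
        exact Dvd.intro _ rfl
      let g₀ : G p n := Matrix.GeneralLinearGroup.mk'' _ (isUnit_det_of_congr_one hM)
      let g : G p n := g₀ * uElt p n
      have hg : g ∈ iwSet p n 1 := by
        rw [mem_iwSet_iff, mul_inv_cancel_right]
        intro i j hij
        have := hM i j
        rwa [Matrix.one_apply_ne hij, sub_zero] at this
      have hgM : g.1 = M := by
        change M * (uElt p n)⁻¹.1 * (uElt p n).1 = M
        rw [mul_assoc, ← Units.val_mul, inv_mul_cancel, Units.val_one, mul_one]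
      have hy' : y = fun ij => algebraMap ℚ_[p] L ((g.1 ij.1 ij.2 : ℤ_[p]) : ℚ_[p]) := by
        funext ij
        rw [hgM]
        exact (hz ij).symm
      rw [hy', ← hP g, h1 g hg, zero_mul, map_zero]
  funext g
  have h3 := hP g
  rw [h2, map_zero] at h3
  exact (mul_eq_zero.1 h3).resolve_right (pow_ne_zero _ (Units.ne_zero _))

end AlgebraicFn
end BranchingLaw
end

noncomputable section
namespace BranchingLaw

/-! ### Minors and triangular matrices -/

section Minors

open Matrix

variable {R : Type*} [CommRing R] {m i : ℕ}

/-- Multiplication by a lower triangular matrix scales the minors in the first `i` rows. -/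
lemma det_submatrix_lower_mul {κ : Type*} (hi : i ≤ m) {l : Matrix (Fin m) (Fin m) R}
    (hl : ∀ a b, a < b → l a b = 0) (M : Matrix (Fin m) κ R) (c : Fin i → κ) :
    ((l * M).submatrix (Fin.castLE hi) c).det =
      (∏ a : Fin i, l (Fin.castLE hi a) (Fin.castLE hi a)) *
        (M.submatrix (Fin.castLE hi) c).det := by
  have h : (l * M).submatrix (Fin.castLE hi) c =
      l.submatrix (Fin.castLE hi) (Fin.castLE hi) * M.submatrix (Fin.castLE hi) c := by
    ext a b
    simp only [Matrix.submatrix_apply, Matrix.mul_apply]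
    -- A row of index below `i` of a lower triangular matrix is zero in the columns from `i` on, so
    -- only the first `i` indices contribute.
    refine (Fintype.sum_of_injective (Fin.castLE hi) (Fin.castLE_injective hi) _ _ (fun x hx => ?_)
      fun x => rfl).symm
    rw [hl _ _, zero_mul]
    by_contra hlt
    exact hx ⟨⟨x.1, by simp only [Fin.lt_def, Fin.val_castLE] at hlt; omega⟩, rfl⟩
  rw [h, Matrix.det_mul, Matrix.det_of_isLowerTriangular]
  · rfl
  · exact fun a b hab => hl _ _ hab

/-- Multiplication by a lower triangular matrix scales the minors in the last `i` columns. -/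
lemma det_submatrix_mul_lower {κ : Type*} (hi : i ≤ m) {l : Matrix (Fin m) (Fin m) R}
    (hl : ∀ a b, a < b → l a b = 0) (M : Matrix κ (Fin m) R) (r : Fin i → κ) :
    ((M * l).submatrix r (fun b => Fin.rev (Fin.castLE hi b))).det =
      (∏ a : Fin i, l (Fin.rev (Fin.castLE hi a)) (Fin.rev (Fin.castLE hi a))) *
        (M.submatrix r fun b => Fin.rev (Fin.castLE hi b)).det := by
  -- Transposing and reversing both indices keeps a matrix lower triangular and exchanges the last
  -- columns with the first rows.
  have h := det_submatrix_lower_mul hi (l := lᵀ.submatrix Fin.rev Fin.rev)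
    (fun a b hab => hl _ _ (Fin.rev_lt_rev.2 hab)) (Mᵀ.submatrix Fin.rev id) r
  have e : lᵀ.submatrix Fin.rev Fin.rev * Mᵀ.submatrix Fin.rev id =
      (M * l)ᵀ.submatrix Fin.rev id := by
    rw [Matrix.transpose_mul]
    exact Matrix.submatrix_mul_equiv lᵀ Mᵀ Fin.rev Fin.revPerm id
  rw [e] at h
  rw [← Matrix.det_transpose, ← Matrix.det_transpose (M.submatrix _ _)]
  exact h

lemma prod_castLE {B : Type*} [CommMonoid B] (hi : i ≤ m) (f : Fin m → B) :
    ∏ k : Fin m, (if k.1 < i then f k else 1) = ∏ a : Fin i, f (Fin.castLE hi a) := by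
  refine (Fintype.prod_of_injective (Fin.castLE hi) (Fin.castLE_injective hi) _ _ (fun x hx => ?_)
    fun x => ?_).symm
  · refine if_neg fun h => hx ⟨⟨x.1, h⟩, rfl⟩
  · simp

lemma prod_rev_castLE {B : Type*} [CommMonoid B] (hi : i ≤ m) (f : Fin m → B) :
    ∏ k : Fin m, (if m - i ≤ k.1 then f k else 1) =
      ∏ a : Fin i, f (Fin.rev (Fin.castLE hi a)) := by
  refine (Fintype.prod_of_injective (fun a => Fin.rev (Fin.castLE hi a))
    (Fin.rev_injective.comp (Fin.castLE_injective hi)) _ _ (fun x hx => ?_) fun x => ?_).symm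
  · refine if_neg fun h => hx ⟨⟨(Fin.rev x).1, ?_⟩, ?_⟩
    · rw [Fin.val_rev]
      omega
    · exact Fin.rev_rev x
  · rw [if_pos]
    rw [Fin.val_rev, Fin.val_castLE]
    omega

end Minors

/-! ### The branching vectors -/

section Branching

variable {p : ℕ} [Fact p.Prime] {n : ℕ}

lemma lower_mul_torus_apply {k : G p n} (hk : k ∈ lowerUnip p n 0) (t : Fin (n + n) → ℤ_[p]ˣ) :
    (∀ a b, a < b → (k * torus t).1 a b = 0) ∧ ∀ a, (k * torus t).1 a a = t a :=
  ⟨fun a b h => by rw [mul_torus_apply, hk.2.1 a b h, zero_mul],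
    fun a => by rw [mul_torus_apply, hk.1 a, one_mul]⟩

lemma lower_mul_torus_inv_apply {k : G p n} (hk : k ∈ lowerUnip p n 0)
    (t : Fin (n + n) → ℤ_[p]ˣ) : (∀ a b, a < b → (k * torus t)⁻¹.1 a b = 0) ∧
      ∀ a, (k * torus t)⁻¹.1 a a = ((t a)⁻¹ : ℤ_[p]ˣ) := by
  have h1 := lower_mul_torus_apply hk t
  have h2 : (k * torus t)⁻¹ ∈ lowerTri p (n + n) := inv_mem h1.1
  refine ⟨h2, fun a => ?_⟩
  have h3 : ((k * torus t).1 * (k * torus t)⁻¹.1) a a = 1 := by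
    rw [← Units.val_mul, mul_inv_cancel, Units.val_one, Matrix.one_apply_eq]
  rw [Matrix.mul_apply, Finset.sum_eq_single a] at h3
  · rw [h1.2] at h3
    rw [← (t a).inv_mul_cancel_left ((k * torus t)⁻¹.1 a a), h3, mul_one]
  · intro b _ hb
    rcases lt_or_gt_of_ne hb with h | h
    · rw [h2 b a h, mul_zero]
    · rw [h1.1 a b h, zero_mul]
  · simp

/-- The integral matrix `g · diag(0, 1) · g⁻¹`, which is right `H`-invariant in `g`. -/
def projConj (g : G p n) : Matrix (Fin (n + n)) (Fin (n + n)) ℤ_[p] := g.1 * blk 0 0 0 1 * g⁻¹.1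

lemma projConj_mul (g g' : G p n) : projConj (g * g') = g.1 * projConj g' * g⁻¹.1 := by
  rw [projConj, projConj, mul_inv_rev, Units.val_mul, Units.val_mul]
  simp only [mul_assoc]

/-- Block diagonal matrices commute with `diag(0, 1)`. -/
lemma projConj_mul_iota (g : G p n) (h : Gn p n × Gn p n) : projConj (g * iota h) = projConj g := by
  have : projConj (iota h) = blk 0 0 0 1 := by
    change blk h.1.1 0 0 h.2.1 * blk 0 0 0 1 * blk h.1⁻¹.1 0 0 h.2⁻¹.1 = _
    rw [blk_mul, blk_mul]
    simp
  rw [projConj_mul, this]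
  rfl

lemma projConj_uElt : projConj (uElt p n) = blk 0 (antidiag p n) 0 1 := by
  change blk 1 (antidiag p n) 0 1 * blk 0 0 0 1 * blk 1 (-antidiag p n) 0 1 = _
  rw [blk_mul, blk_mul]
  simp

/-- The `i × i` minor in the top right corner, with reversed columns, of `projConj g`. -/
def cornerMinor (i : ℕ) (hi : i ≤ n + n) (g : G p n) : ℤ_[p] :=
  ((projConj g).submatrix (Fin.castLE hi) fun b => Fin.rev (Fin.castLE hi b)).det

/-- The determinant of the top left block. -/
def leftMinor (g : G p n) : ℤ_[p] :=
  (g.1.submatrix (Fin.castLE (Nat.le_add_left n n)) (Fin.castAdd n)).det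

/-- The determinant of the top right block with reversed columns. -/
def rightMinor (g : G p n) : ℤ_[p] :=
  (g.1.submatrix (Fin.castLE (Nat.le_add_left n n)) fun b => Fin.natAdd n (Fin.rev b)).det

lemma cornerMinor_mul_iota (i hi) (g : G p n) (h : Gn p n × Gn p n) :
    cornerMinor i hi (g * iota h) = cornerMinor i hi g := by
  rw [cornerMinor, projConj_mul_iota, cornerMinor]

/-- Left translation by `b` conjugates `projConj g` by `b`. On the corner minor, `b` scales the
first `i` rows by its diagonal and `b⁻¹` scales the last `i` columns by the inverse diagonal;
together this is the weight `α_i`. -/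
lemma cornerMinor_lower_mul (i hi) {k : G p n} (hk : k ∈ lowerUnip p n 0)
    (t : Fin (n + n) → ℤ_[p]ˣ) (g : G p n) :
    cornerMinor i hi (k * torus t * g) = (((∏ a : Fin i, t (Fin.castLE hi a)) *
      ∏ a : Fin i, (t (Fin.rev (Fin.castLE hi a)))⁻¹ : ℤ_[p]ˣ) : ℤ_[p]) * cornerMinor i hi g := by
  have h1 := lower_mul_torus_apply hk t
  have h2 := lower_mul_torus_inv_apply hk t
  rw [cornerMinor, projConj_mul, det_submatrix_mul_lower hi h2.1, det_submatrix_lower_mul hi h1.1,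
    cornerMinor, Units.val_mul (∏ a : Fin i, t (Fin.castLE hi a)), Units.coe_prod, Units.coe_prod]
  simp only [h1.2, h2.2]
  ring

/-- For `i ≤ n` the corner stays inside the top right block `w_n` of `projConj u`, and the reversed
columns turn it into an identity matrix. -/
lemma cornerMinor_uElt (i hi) (hin : i ≤ n) : cornerMinor i hi (uElt p n) = 1 := by
  rw [cornerMinor, projConj_uElt]
  refine (congrArg Matrix.det (Matrix.ext fun a b => ?_)).trans Matrix.det_one
  have ha : Fin.castLE hi a = Fin.castAdd n (Fin.castLE hin a) := rfl
  have hb : Fin.rev (Fin.castLE hi b) = Fin.natAdd n (Fin.rev (Fin.castLE hin b)) := by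
    ext
    simp only [Fin.val_rev, Fin.val_castLE, Fin.val_natAdd]
    omega
  rw [Matrix.submatrix_apply, ha, hb, blk_castAdd_natAdd, antidiag, Matrix.of_apply,
    Matrix.one_apply]
  simp [Fin.rev_inj, eq_comm]

lemma leftMinor_lower_mul {k : G p n} (hk : k ∈ lowerUnip p n 0) (t : Fin (n + n) → ℤ_[p]ˣ)
    (g : G p n) : leftMinor (k * torus t * g) =
      ((∏ a : Fin n, t (Fin.castLE (Nat.le_add_left n n) a) : ℤ_[p]ˣ) : ℤ_[p]) * leftMinor g := by
  have h1 := lower_mul_torus_apply hk t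
  rw [leftMinor, Units.val_mul (k * torus t), det_submatrix_lower_mul _ h1.1, Units.coe_prod]
  simp only [h1.2]
  rfl

lemma rightMinor_lower_mul {k : G p n} (hk : k ∈ lowerUnip p n 0) (t : Fin (n + n) → ℤ_[p]ˣ)
    (g : G p n) : rightMinor (k * torus t * g) =
      ((∏ a : Fin n, t (Fin.castLE (Nat.le_add_left n n) a) : ℤ_[p]ˣ) : ℤ_[p]) * rightMinor g := by
  have h1 := lower_mul_torus_apply hk t
  rw [rightMinor, Units.val_mul (k * torus t), det_submatrix_lower_mul _ h1.1, Units.coe_prod]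
  simp only [h1.2]
  rfl

lemma mul_iota_castAdd (g : G p n) (h : Gn p n × Gn p n) (i : Fin (n + n)) (j : Fin n) :
    (g * iota h).1 i (Fin.castAdd n j) = ∑ l, g.1 i (Fin.castAdd n l) * h.1.1 l j := by
  rw [Units.val_mul, Matrix.mul_apply, Fin.sum_univ_add]
  change _ + ∑ l, _ * blk _ _ _ _ _ _ = _
  simp only [blk_natAdd_castAdd, Matrix.zero_apply, mul_zero, Finset.sum_const_zero, add_zero]
  refine Finset.sum_congr rfl fun l _ => ?_
  change _ * blk _ _ _ _ _ _ = _
  rw [blk_castAdd_castAdd]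

lemma mul_iota_natAdd (g : G p n) (h : Gn p n × Gn p n) (i : Fin (n + n)) (j : Fin n) :
    (g * iota h).1 i (Fin.natAdd n j) = ∑ l, g.1 i (Fin.natAdd n l) * h.2.1 l j := by
  rw [Units.val_mul, Matrix.mul_apply, Fin.sum_univ_add]
  change ∑ l, _ * blk _ _ _ _ _ _ + _ = _
  simp only [blk_castAdd_natAdd, Matrix.zero_apply, mul_zero, Finset.sum_const_zero, zero_add]
  refine Finset.sum_congr rfl fun l _ => ?_
  change _ * blk _ _ _ _ _ _ = _
  rw [blk_natAdd_natAdd]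

lemma leftMinor_mul_iota (g : G p n) (h : Gn p n × Gn p n) :
    leftMinor (g * iota h) = h.1.det * leftMinor g := by
  have : (g * iota h).1.submatrix (Fin.castLE (Nat.le_add_left n n)) (Fin.castAdd n) =
      g.1.submatrix (Fin.castLE (Nat.le_add_left n n)) (Fin.castAdd n) * h.1.1 := by
    ext i j
    rw [Matrix.submatrix_apply, mul_iota_castAdd, Matrix.mul_apply]
    rfl
  rw [leftMinor, this, Matrix.det_mul, mul_comm]
  rfl

lemma rightMinor_mul_iota (g : G p n) (h : Gn p n × Gn p n) :
    rightMinor (g * iota h) = h.2.det * rightMinor g := by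
  have : (g * iota h).1.submatrix (Fin.castLE (Nat.le_add_left n n))
      (fun b => Fin.natAdd n (Fin.rev b)) =
      g.1.submatrix (Fin.castLE (Nat.le_add_left n n)) (fun b => Fin.natAdd n (Fin.rev b)) *
        h.2.1.submatrix Fin.revPerm Fin.revPerm := by
    ext i j
    rw [Matrix.submatrix_apply, mul_iota_natAdd, Matrix.mul_apply, ← Equiv.sum_comp Fin.revPerm]
    rfl
  rw [rightMinor, this, Matrix.det_mul, mul_comm, Matrix.det_submatrix_equiv_self]
  rfl

lemma leftMinor_uElt : leftMinor (uElt p n) = 1 := by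
  rw [leftMinor]
  refine (congrArg Matrix.det (Matrix.ext fun a b => ?_)).trans Matrix.det_one
  exact blk_castAdd_castAdd _ _ _ _ a b

/-- The reversal of columns in `rightMinor` removes the sign `det w_n` and gives the normalisation
`1` at `u`. -/
lemma rightMinor_uElt : rightMinor (uElt p n) = 1 := by
  rw [rightMinor]
  refine (congrArg Matrix.det (Matrix.ext fun a b => ?_)).trans Matrix.det_one
  refine (blk_castAdd_natAdd _ _ _ _ a (Fin.rev b)).trans ?_
  rw [antidiag, Matrix.of_apply, Matrix.one_apply]
  simp [Fin.rev_inj, eq_comm]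

/-- Congruent matrices have congruent minors. -/
lemma minors_congr {R : Type*} [CommRing R] (φ : ℤ_[p] →+* R) {g g' : G p n}
    (h : φ.mapMatrix g.1 = φ.mapMatrix g'.1) :
    (∀ i hi, φ (cornerMinor i hi g) = φ (cornerMinor i hi g')) ∧
      φ (leftMinor g) = φ (leftMinor g') ∧ φ (rightMinor g) = φ (rightMinor g') := by
  have e : Matrix.GeneralLinearGroup.map φ g = Matrix.GeneralLinearGroup.map φ g' := Units.ext h
  have h' : φ.mapMatrix g⁻¹.1 = φ.mapMatrix g'⁻¹.1 := by
    have := congrArg (fun x => x⁻¹) e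
    simp only [← map_inv] at this
    exact congrArg Units.val this
  refine ⟨fun i hi => ?_, ?_, ?_⟩
  · have h1 : φ.mapMatrix (projConj g) = φ.mapMatrix (projConj g') := by
      rw [projConj, projConj, map_mul, map_mul, map_mul, map_mul, h, h']
    rw [cornerMinor, cornerMinor, RingHom.map_det, RingHom.map_det]
    exact congrArg (fun M : Matrix (Fin (n + n)) (Fin (n + n)) R =>
      (M.submatrix (Fin.castLE hi) fun b => Fin.rev (Fin.castLE hi b)).det) h1
  · rw [leftMinor, leftMinor, RingHom.map_det, RingHom.map_det]
    exact congrArg (fun M : Matrix (Fin (n + n)) (Fin (n + n)) R =>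
      (M.submatrix (Fin.castLE (Nat.le_add_left n n)) (Fin.castAdd n)).det) h
  · rw [rightMinor, rightMinor, RingHom.map_det, RingHom.map_det]
    exact congrArg (fun M : Matrix (Fin (n + n)) (Fin (n + n)) R =>
      (M.submatrix (Fin.castLE (Nat.le_add_left n n)) fun b => Fin.natAdd n (Fin.rev b)).det) h

/-- On `N^β` the minors are congruent to `1` mod `p^β`. -/
lemma minors_unipCoset {β : ℕ} {g : G p n} (hg : g ∈ unipCoset p n β) :
    (∀ i hi, i ≤ n → (p : ℤ_[p]) ^ β ∣ cornerMinor i hi g - 1) ∧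
      (p : ℤ_[p]) ^ β ∣ leftMinor g - 1 ∧ (p : ℤ_[p]) ^ β ∣ rightMinor g - 1 := by
  obtain ⟨m, hm, rfl⟩ := hg
  let φ := Ideal.Quotient.mk (Ideal.span {(p : ℤ_[p]) ^ β})
  have h1 : φ.mapMatrix m.1 = 1 := by
    rw [← map_one φ.mapMatrix]
    ext i j
    change φ _ = φ _
    rcases lt_trichotomy i j with h | rfl | h
    · rw [Matrix.one_apply_ne h.ne, map_zero]
      exact Ideal.Quotient.eq_zero_iff_mem.2 (Ideal.mem_span_singleton.2 (hm.2.2 i j h))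
    · rw [hm.1, Matrix.one_apply_eq]
    · rw [Matrix.one_apply_ne h.ne', hm.2.1 i j h]
  have h2 : φ.mapMatrix (m * uElt p n).1 = φ.mapMatrix (uElt p n).1 := by
    rw [Units.val_mul, map_mul, h1, one_mul]
  obtain ⟨h3, h4, h5⟩ := minors_congr φ h2
  have key : ∀ z : ℤ_[p], φ z = φ 1 → (p : ℤ_[p]) ^ β ∣ z - 1 := fun z hz =>
    Ideal.mem_span_singleton.1 ((Ideal.Quotient.mk_eq_mk_iff_sub_mem _ _).1 hz)
  exact ⟨fun i hi hin => key _ ((h3 i hi).trans (by rw [cornerMinor_uElt i hi hin])),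
    key _ (h4.trans (by rw [leftMinor_uElt])), key _ (h5.trans (by rw [rightMinor_uElt]))⟩

lemma prod_alphaWt {B : Type*} [CommGroup B] {i : ℕ} (hi : i ≤ n) (t : Fin (n + n) → B) :
    ∏ k, t k ^ alphaWt n i k = (∏ a : Fin i, t (Fin.castLE (hi.trans (Nat.le_add_left n n)) a)) *
      ∏ a : Fin i, (t (Fin.rev (Fin.castLE (hi.trans (Nat.le_add_left n n)) a)))⁻¹ := by
  rw [← prod_castLE, ← prod_rev_castLE _ fun k => (t k)⁻¹, ← Finset.prod_mul_distrib]
  refine Finset.prod_congr rfl fun k _ => ?_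
  rw [alphaWt]
  -- The only case without a matching exponent, `k < i` together with `2n - i ≤ k`, is impossible
  -- because `i ≤ n`.
  split_ifs <;> first | omega | simp

lemma prod_alphaTop {B : Type*} [CommGroup B] (t : Fin (n + n) → B) :
    ∏ k, t k ^ alphaTop n k = ∏ a : Fin n, t (Fin.castLE (Nat.le_add_left n n) a) := by
  rw [← prod_castLE]
  refine Finset.prod_congr rfl fun k _ => ?_
  rw [alphaTop]
  split_ifs <;> simp

variable {L : Type*} [NormedField L] [NormedAlgebra ℚ_[p] L]

lemma prod_algChar (lam : Fin (n + n) → ℤ) (t : Fin (n + n) → ℤ_[p]ˣ) :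
    ∏ i, algChar p L (lam i) (t i) = unitsHom p L (∏ i, t i ^ lam i) := by
  rw [map_prod]
  refine Finset.prod_congr rfl fun i _ => ?_
  rw [map_zpow]
  rfl

lemma algFn_projConj (i j) : (fun g : G p n => intHom p L (projConj g i j)) ∈ algFn p n L := by
  have h : ∀ g : G p n, projConj g i j =
      ∑ l, (∑ k, g.1 i k * blk 0 0 0 1 k l) * g⁻¹.1 l j := fun g => by
    rw [projConj, Matrix.mul_apply]
    exact Finset.sum_congr rfl fun l _ => by rw [Matrix.mul_apply]
  simp only [h]
  exact algFn_sum_mul (fun l => algFn_sum_mul (fun k => algFn_entry _ _) fun k => algFn_const _)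
    fun l => algFn_inv_entry _ _

lemma algFn_cornerMinor (i hi) :
    (fun g : G p n => intHom p L (cornerMinor i hi g)) ∈ algFn p n L :=
  algFn_det (M := fun g => (projConj g).submatrix (Fin.castLE hi) fun b =>
    Fin.rev (Fin.castLE hi b)) fun _ _ => algFn_projConj _ _

lemma algFn_leftMinor : (fun g : G p n => intHom p L (leftMinor g)) ∈ algFn p n L :=
  algFn_det (M := fun g => g.1.submatrix (Fin.castLE (Nat.le_add_left n n)) (Fin.castAdd n))
    fun _ _ => algFn_entry _ _

lemma algFn_rightMinor : (fun g : G p n => intHom p L (rightMinor g)) ∈ algFn p n L :=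
  algFn_det (M := fun g => g.1.submatrix (Fin.castLE (Nat.le_add_left n n)) fun b =>
    Fin.natAdd n (Fin.rev b)) fun _ _ => algFn_entry _ _

lemma succ_le_of_fin_pred (i : Fin (n - 1)) : i.1 + 1 ≤ n := by omega

/-- The minor giving the `i`-th branching vector. -/
def vMinor (i : Fin (n - 1)) (g : G p n) : ℤ_[p] :=
  cornerMinor (i.1 + 1) ((succ_le_of_fin_pred i).trans (Nat.le_add_left n n)) g

lemma vMinor_mem_algInd (i : Fin (n - 1)) :
    (fun g : G p n => intHom p L (vMinor i g)) ∈ algInd p L (alphaWt n (i.1 + 1)) :=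
  ⟨algFn_cornerMinor _ _, fun k hk t g => by
    beta_reduce
    rw [vMinor, cornerMinor_lower_mul _ _ hk, prod_algChar, prod_alphaWt (succ_le_of_fin_pred i),
      map_mul]
    rfl⟩

lemma leftMinor_mem_algInd :
    (fun g : G p n => intHom p L (leftMinor g)) ∈ algInd p L (alphaTop n) :=
  ⟨algFn_leftMinor, fun k hk t g => by
    beta_reduce
    rw [leftMinor_lower_mul hk, prod_algChar, prod_alphaTop, map_mul]
    rfl⟩

lemma rightMinor_mem_algInd :
    (fun g : G p n => intHom p L (rightMinor g)) ∈ algInd p L (alphaTop n) :=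
  ⟨algFn_rightMinor, fun k hk t g => by
    beta_reduce
    rw [rightMinor_lower_mul hk, prod_algChar, prod_alphaTop, map_mul]
    rfl⟩

variable (p n) in
/-- The explicit branching vectors. -/
def branchingVectors : BranchingVectors p n where
  v i := ⟨_, vMinor_mem_algInd i⟩
  v1 := ⟨_, leftMinor_mem_algInd⟩
  v2 := ⟨_, rightMinor_mem_algInd⟩
  v_inv _ h := Subtype.ext <| funext fun g =>
    congrArg (intHom p ℚ_[p]) (cornerMinor_mul_iota _ _ g h)
  v1_act h := Subtype.ext <| funext fun g =>
    (congrArg (intHom p ℚ_[p]) (leftMinor_mul_iota g h)).trans (map_mul _ _ _)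
  v2_act h := Subtype.ext <| funext fun g =>
    (congrArg (intHom p ℚ_[p]) (rightMinor_mul_iota g h)).trans (map_mul _ _ _)
  v_norm i := (congrArg (intHom p ℚ_[p])
    (cornerMinor_uElt _ _ (succ_le_of_fin_pred i))).trans (map_one _)
  v1_norm := (congrArg (intHom p ℚ_[p]) leftMinor_uElt).trans (map_one _)
  v2_norm := (congrArg (intHom p ℚ_[p]) rightMinor_uElt).trans (map_one _)

lemma algInd_eq_of_eigen {lam : Fin (n + n) → ℤ} {f f' : algInd p L lam}
    {c : Gn p n × Gn p n → L} (hf : ∀ h, algAct lam (iota h) f = c h • f)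
    (hf' : ∀ h, algAct lam (iota h) f' = c h • f') (hu : f.1 (uElt p n) = f'.1 (uElt p n)) :
    f = f' := by
  have key : ∀ F : algInd p L lam, (∀ h, algAct lam (iota h) F = c h • F) →
      ∀ g h, F.1 (g * iota h) = c h * F.1 g := fun F hF g h => congrFun (congrArg Subtype.val (hF h)) g
  have h1 : (f - f').1 = 0 := algInd_eq_zero_of_apply_uElt (f - f').2 (c := c) (fun g h => by
    change f.1 _ - f'.1 _ = c h * (f.1 g - f'.1 g)
    rw [key f hf, key f' hf', mul_sub]) (sub_eq_zero.2 hu)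
  exact sub_eq_zero.1 (Subtype.ext h1)

lemma BranchingVectors.eq (V V' : BranchingVectors p n) : V = V' := by
  obtain ⟨v, v1, v2, a1, a2, a3, b1, b2, b3⟩ := V
  obtain ⟨v', v1', v2', a1', a2', a3', b1', b2', b3'⟩ := V'
  have e : v = v' := funext fun i => algInd_eq_of_eigen (c := fun _ => 1)
    (fun h => by rw [a1, one_smul]) (fun h => by rw [a1', one_smul]) ((b1 i).trans (b1' i).symm)
  obtain rfl := algInd_eq_of_eigen a2 a2' (b2.trans b2'.symm)
  obtain rfl := algInd_eq_of_eigen a3 a3' (b3.trans b3'.symm)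
  subst e
  rfl

end Branching
end BranchingLaw
end

noncomputable section
namespace BranchingLaw

/-! ### The weight of `w_χ` and of the classical vectors -/

section Weights

variable {M B : Type*} [CommGroup M] [CommGroup B]

/-- Summation by parts in multiplicative form: `X i` meets the partial product up to `i` and the
inverse of the one up to `i - 1`, leaving `s i`. -/
lemma prod_div_telescope (X : ℕ → M →* B) (s : ℕ → M) (N : ℕ) :
    (∏ i ∈ Finset.range N, X i (∏ k ∈ Finset.range (i + 1), s k) /
      X (i + 1) (∏ k ∈ Finset.range (i + 1), s k)) * X N (∏ k ∈ Finset.range (N + 1), s k) =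
      ∏ k ∈ Finset.range (N + 1), X k (s k) := by
  induction N with
  | zero => simp
  | succ N ih =>
    rw [Finset.prod_range_succ, Finset.prod_range_succ _ (N + 1), map_mul,
      Finset.prod_range_succ _ (N + 1), ← ih, mul_assoc _ (_ / _), ← mul_assoc (_ / _),
      div_mul_cancel, mul_assoc]

lemma prod_univ_add_rev {n : ℕ} (f : Fin (n + n) → B) :
    ∏ i, f i = (∏ a : Fin n, f (Fin.castAdd n a)) * ∏ a : Fin n, f (Fin.rev (Fin.castAdd n a)) := by
  rw [Fin.prod_univ_add, ← Equiv.prod_comp Fin.revPerm fun a => f (Fin.natAdd n a)]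
  congr 1
  refine Finset.prod_congr rfl fun a _ => congrArg f ?_
  ext
  simp only [Fin.revPerm_apply, Fin.val_natAdd, Fin.val_rev, Fin.val_castAdd]
  omega

lemma idxN_val (n : ℕ) [NeZero n] : (idxN n).1 = n - 1 := by
  rw [idxN, Fin.val_castAdd, Fin.val_rev]
  simp

lemma idxN1_eq (n : ℕ) [NeZero n] : idxN1 n = Fin.rev (idxN n) := by
  have := NeZero.ne n
  ext
  rw [Fin.val_rev, idxN_val, idxN1, Fin.val_natAdd]
  simp
  omega

lemma mul_four (x y z w x' y' z' w' : B) :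
    x * x' * (y * y') * (z * z') * (w * w') = x * y * z * w * (x' * y' * z' * w') := by
  rw [mul_mul_mul_comm x x', mul_mul_mul_comm (x * y), mul_mul_mul_comm (x * y * z)]

/-- The weight of `w_χ` is `χ`. -/
lemma weight_identity {n : ℕ} [NeZero n] {χ : Fin (n + n) → (M →* B)} {sw : M →* B}
    (hχ : ∀ i z, χ i z * χ (Fin.rev i) z = sw z) (t : Fin (n + n) → M)
    (h1 : ∀ i : Fin (n - 1), i.1 + 1 ≤ n + n) :
    χ (idxN1 n) (∏ i, t i) *
      (∏ i : Fin (n - 1),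
        χ (idx i) ((∏ a : Fin (i.1 + 1), t (Fin.castLE (h1 i) a)) *
          ∏ a : Fin (i.1 + 1), (t (Fin.rev (Fin.castLE (h1 i) a)))⁻¹) /
        χ (idxS i) ((∏ a : Fin (i.1 + 1), t (Fin.castLE (h1 i) a)) *
          ∏ a : Fin (i.1 + 1), (t (Fin.rev (Fin.castLE (h1 i) a)))⁻¹)) *
      (χ (idxN1 n) (∏ a : Fin n, t (Fin.castLE (Nat.le_add_left n n) a)))⁻¹ *
      χ (idxN n) (∏ a : Fin n, t (Fin.castLE (Nat.le_add_left n n) a)) = ∏ i, χ i (t i) := by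
  have hn : n - 1 + 1 = n := Nat.succ_pred (NeZero.ne n)
  -- With `s k = t_k / t_{2n+1-k}` (counting from one), the product of the first `i` of these is the
  -- character `α_i` of `t`, so the weights of the `v_(i)` are partial products of one sequence.
  let s : ℕ → M := fun k => if h : k < n + n then t ⟨k, h⟩ * (t (Fin.rev ⟨k, h⟩))⁻¹ else 1
  let X : ℕ → M →* B := fun k => if h : k < n + n then χ ⟨k, h⟩ else 1
  have hs : ∀ m (hm : m ≤ n + n), ∏ k ∈ Finset.range m, s k =
      (∏ a : Fin m, t (Fin.castLE hm a)) * ∏ a : Fin m, (t (Fin.rev (Fin.castLE hm a)))⁻¹ :=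
    fun m hm => by
      rw [← Finset.prod_mul_distrib, Finset.prod_range]
      exact Finset.prod_congr rfl fun a _ => dif_pos (a.2.trans_le hm)
  have hXi : ∀ i : Fin (n - 1), X i.1 = χ (idx i) := fun i => dif_pos (by omega)
  have hXs : ∀ i : Fin (n - 1), X (i.1 + 1) = χ (idxS i) := fun i => dif_pos (by omega)
  have hXN : X (n - 1) = χ (idxN n) :=
    (dif_pos (by omega)).trans (congrArg χ (Fin.ext (idxN_val n).symm))
  have key := prod_div_telescope X s (n - 1)
  rw [hn, hs n (Nat.le_add_left n n), Finset.prod_range, Finset.prod_range, hXN] at key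
  have e1 : ∏ i : Fin (n - 1), X i (∏ k ∈ Finset.range (i.1 + 1), s k) /
      X (i.1 + 1) (∏ k ∈ Finset.range (i.1 + 1), s k) = ∏ i : Fin (n - 1),
        χ (idx i) ((∏ a : Fin (i.1 + 1), t (Fin.castLE (h1 i) a)) *
          ∏ a : Fin (i.1 + 1), (t (Fin.rev (Fin.castLE (h1 i) a)))⁻¹) /
        χ (idxS i) ((∏ a : Fin (i.1 + 1), t (Fin.castLE (h1 i) a)) *
          ∏ a : Fin (i.1 + 1), (t (Fin.rev (Fin.castLE (h1 i) a)))⁻¹) :=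
    Finset.prod_congr rfl fun i _ => by rw [hs _ (h1 i), hXi, hXs]
  rw [e1] at key
  -- This is where purity enters: `χ_a(t_a/t_{a'}) · sw(t_{a'}) = χ_a(t_a) χ_{a'}(t_{a'})`, where
  -- `a'` is the index opposite to `a`.
  have e2 : ∀ a : Fin n, X a (s a) * sw (t (Fin.rev (Fin.castAdd n a))) =
      χ (Fin.castAdd n a) (t (Fin.castAdd n a)) *
        χ (Fin.rev (Fin.castAdd n a)) (t (Fin.rev (Fin.castAdd n a))) := fun a => by
    have hX : X a = χ (Fin.castAdd n a) := dif_pos (by omega)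
    have hsa : s a = t (Fin.castAdd n a) * (t (Fin.rev (Fin.castAdd n a)))⁻¹ := dif_pos (by omega)
    rw [hX, hsa, ← hχ (Fin.castAdd n a), map_mul, map_inv, ← mul_assoc, inv_mul_cancel_right]
  have e3 : (∏ a : Fin n, X a (s a)) * sw (∏ a : Fin n, t (Fin.rev (Fin.castAdd n a))) =
      ∏ i, χ i (t i) := by
    rw [prod_univ_add_rev fun i => χ i (t i), map_prod, ← Finset.prod_mul_distrib,
      ← Finset.prod_mul_distrib]
    exact Finset.prod_congr rfl fun a _ => e2 a
  obtain ⟨T, hT⟩ : ∃ T, T = ∏ i : Fin (n - 1),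
        χ (idx i) ((∏ a : Fin (i.1 + 1), t (Fin.castLE (h1 i) a)) *
          ∏ a : Fin (i.1 + 1), (t (Fin.rev (Fin.castLE (h1 i) a)))⁻¹) /
        χ (idxS i) ((∏ a : Fin (i.1 + 1), t (Fin.castLE (h1 i) a)) *
          ∏ a : Fin (i.1 + 1), (t (Fin.rev (Fin.castLE (h1 i) a)))⁻¹) := ⟨_, rfl⟩
  rw [← hT] at key ⊢
  rw [← e3, ← key, ← hχ (idxN n), ← idxN1_eq, prod_univ_add_rev t, Finset.prod_inv_distrib]
  -- Let `a` and `b` be the products of the first and of the last `n` entries of `t`. What remains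
  -- is `χ_{n+1}(ab) χ_{n+1}(a)⁻¹ χ_n(a) = χ_n(a b⁻¹) χ_n(b) χ_{n+1}(b)`.
  change χ (idxN1 n) ((∏ a : Fin n, t (Fin.castAdd n a)) * _) * T *
    (χ (idxN1 n) (∏ a : Fin n, t (Fin.castAdd n a)))⁻¹ *
      χ (idxN n) (∏ a : Fin n, t (Fin.castAdd n a)) = T * χ (idxN n)
        ((∏ a : Fin n, t (Fin.castAdd n a)) * (∏ a : Fin n, t (Fin.rev (Fin.castAdd n a)))⁻¹) * _
  generalize (∏ a : Fin n, t (Fin.castAdd n a)) = a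
  generalize (∏ a : Fin n, t (Fin.rev (Fin.castAdd n a))) = b
  rw [map_mul, map_mul, map_inv]
  generalize χ (idxN1 n) a = x
  generalize χ (idxN1 n) b = y
  generalize χ (idxN n) a = z
  generalize χ (idxN n) b = w
  calc x * y * T * x⁻¹ * z = T * z * y * (x * x⁻¹) := by
        simp only [mul_comm, mul_left_comm, mul_assoc]
    _ = T * z * y * (w * w⁻¹) := by rw [mul_inv_cancel, mul_inv_cancel]
    _ = _ := by simp only [mul_comm, mul_left_comm, mul_assoc]

end Weights

/-! ### Equivariance of w_χ. -/

section WChar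

variable {p : ℕ} [Fact p.Prime] {n : ℕ}

lemma toUnit_coe (z : ℤ_[p]ˣ) : toUnit ((z : ℤ_[p]) : ℚ_[p]) = z := by
  have h : ‖((z : ℤ_[p]) : ℚ_[p])‖ = 1 := PadicInt.isUnit_iff.1 z.isUnit
  rw [toUnit, dif_pos h]
  exact Units.ext rfl

/-- A unit of `ℤ_p`, as an element of `ℤ_p^×` (and `1` for non-units). -/
def unitOf (z : ℤ_[p]) : ℤ_[p]ˣ := toUnit (z : ℚ_[p])

lemma unitOf_coe (z : ℤ_[p]ˣ) : unitOf (z : ℤ_[p]) = z := toUnit_coe z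

lemma coe_unitOf {z : ℤ_[p]} (hz : IsUnit z) : (unitOf z : ℤ_[p]) = z := by
  obtain ⟨u, rfl⟩ := hz
  rw [unitOf_coe]

lemma unitOf_mul (u : ℤ_[p]ˣ) {z : ℤ_[p]} (hz : IsUnit z) : unitOf ((u : ℤ_[p]) * z) = u * unitOf z := by
  obtain ⟨v, rfl⟩ := hz
  rw [← Units.val_mul, unitOf_coe, unitOf_coe]

lemma det_lower_mul {k : G p n} (hk : k ∈ lowerUnip p n 0) (t : Fin (n + n) → ℤ_[p]ˣ) (g : G p n) :
    (k * torus t * g).det = (∏ i, t i) * g.det := by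
  have h1 := lower_mul_torus_apply hk t
  rw [map_mul]
  congr 1
  refine Units.ext ?_
  change (k * torus t).1.det = _
  rw [Matrix.det_of_isLowerTriangular _ fun i j h => h1.1 i j h, Units.coe_prod]
  exact Finset.prod_congr rfl fun i _ => h1.2 i

lemma det_iota (h : Gn p n × Gn p n) : (iota h).det = h.1.det * h.2.det := by
  refine Units.ext ?_
  change (Matrix.reindex finSumFinEquiv finSumFinEquiv
    (Matrix.fromBlocks h.1.1 0 0 h.2.1)).det = h.1.1.det * h.2.1.det
  rw [Matrix.det_reindex_self, Matrix.det_fromBlocks_zero₂₁]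

lemma vMinor_lower_mul (i) {k : G p n} (hk : k ∈ lowerUnip p n 0)
    (t : Fin (n + n) → ℤ_[p]ˣ) (g : G p n) :
    vMinor i (k * torus t * g) = (((∏ a, t (Fin.castLE
      ((succ_le_of_fin_pred i).trans (Nat.le_add_left n n)) a)) * ∏ a, (t (Fin.rev (Fin.castLE
      ((succ_le_of_fin_pred i).trans (Nat.le_add_left n n)) a)))⁻¹ : ℤ_[p]ˣ) : ℤ_[p]) *
        vMinor i g :=
  cornerMinor_lower_mul _ _ hk t g

lemma vMinor_mul_iota (i) (g : G p n) (h : Gn p n × Gn p n) :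
    vMinor i (g * iota h) = vMinor i g := cornerMinor_mul_iota _ _ g h

/-- On Iw^1 each minor is a unit times its value on N^1, and that value is congruent to `1` mod `p`.
Characters may therefore be evaluated on the minors, and the default value of `toUnit` never occurs
there. -/
lemma isUnit_minors {g : G p n} (hg : g ∈ iwSet p n 1) :
    (∀ i, IsUnit (vMinor i g)) ∧ IsUnit (leftMinor g) ∧ IsUnit (rightMinor g) := by
  obtain ⟨k, hk, t, m, hm, rfl⟩ := hg
  have hk' : k ∈ lowerUnip p n 0 := ⟨hk.1, hk.2.1, fun i j _ => by simp⟩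
  obtain ⟨h1, h2, h3⟩ := minors_unipCoset hm
  have key : ∀ z : ℤ_[p], (p : ℤ_[p]) ^ 1 ∣ z - 1 → IsUnit z := fun z hz => by
    rw [isUnit_iff_not_dvd]
    intro h
    rw [pow_one] at hz
    have h1 : (p : ℤ_[p]) ∣ 1 := by simpa using dvd_sub h hz
    exact (isUnit_iff_not_dvd _).1 isUnit_one h1
  refine ⟨fun i => ?_, ?_, ?_⟩
  · rw [vMinor_lower_mul i hk']
    exact (Units.isUnit _).mul (key _ (h1 _ _ (succ_le_of_fin_pred i)))
  · rw [leftMinor_lower_mul hk']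
    exact (Units.isUnit _).mul (key _ h2)
  · rw [rightMinor_lower_mul hk']
    exact (Units.isUnit _).mul (key _ h3)

variable {A : Type*} [NormedCommRing A] [NeZero n]


/-- The monomial defining `w_χ`. -/
def wMon (χ : Fin (n + n) → (ℤ_[p]ˣ →* Aˣ)) (v : Fin (n - 1) → ℤ_[p]ˣ) (a b d : ℤ_[p]ˣ) : Aˣ :=
  χ (idxN1 n) d * (∏ i, χ (idx i) (v i) / χ (idxS i) (v i)) * (χ (idxN1 n) a)⁻¹ * χ (idxN n) b

lemma wMon_mul (χ : Fin (n + n) → (ℤ_[p]ˣ →* Aˣ)) (v v' : Fin (n - 1) → ℤ_[p]ˣ)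
    (a b d a' b' d' : ℤ_[p]ˣ) : wMon χ (fun i => v i * v' i) (a * a') (b * b') (d * d') =
      wMon χ v a b d * wMon χ v' a' b' d' := by
  have h : ∏ i, χ (idx i) (v i * v' i) / χ (idxS i) (v i * v' i) =
      (∏ i, χ (idx i) (v i) / χ (idxS i) (v i)) * ∏ i, χ (idx i) (v' i) / χ (idxS i) (v' i) := by
    rw [← Finset.prod_mul_distrib]
    exact Finset.prod_congr rfl fun i _ => by rw [map_mul, map_mul, mul_div_mul_comm]
  rw [wMon, h, map_mul, map_mul, map_mul, mul_inv, mul_four]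
  rfl

lemma wChar_eq (χ : Fin (n + n) → (ℤ_[p]ˣ →* Aˣ)) (g : G p n) :
    wChar (branchingVectors p n) χ g = wMon χ (fun i => unitOf (vMinor i g))
      (unitOf (leftMinor g)) (unitOf (rightMinor g)) g.det := rfl

/-- Each ingredient is multiplied by its own weight, and `weight_identity` says that these weights
combine to `χ`. -/
lemma wChar_lower_mul {χ : Fin (n + n) → (ℤ_[p]ˣ →* Aˣ)} {sw : ℤ_[p]ˣ →* Aˣ}
    (hχ : ∀ i z, χ i z * χ (Fin.rev i) z = sw z) {k : G p n} (hk : k ∈ lowerUnip p n 0)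
    (t : Fin (n + n) → ℤ_[p]ˣ) {g : G p n} (hg : g ∈ iwSet p n 1) :
    wChar (branchingVectors p n) χ (k * torus t * g) =
      (∏ i, χ i (t i)) * wChar (branchingVectors p n) χ g := by
  obtain ⟨h1, h2, h3⟩ := isUnit_minors hg
  rw [wChar_eq, wChar_eq, det_lower_mul hk, leftMinor_lower_mul hk, rightMinor_lower_mul hk,
    unitOf_mul _ h2, unitOf_mul _ h3, ← weight_identity hχ t
      fun i => (succ_le_of_fin_pred i).trans (Nat.le_add_left n n)]
  simp only [vMinor_lower_mul _ hk, unitOf_mul _ (h1 _)]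
  rw [wMon_mul]
  rfl

/-- The factor `χ_{n+1}(det h₁)` coming from `det` cancels against the left minor. For `h₂` the
factors `χ_{n+1}` from `det` and `χ_n` from the right minor combine to `sw` by purity. -/
lemma wChar_mul_iota {χ : Fin (n + n) → (ℤ_[p]ˣ →* Aˣ)} {sw : ℤ_[p]ˣ →* Aˣ}
    (hχ : ∀ i z, χ i z * χ (Fin.rev i) z = sw z) {g : G p n} (hg : g ∈ iwSet p n 1)
    (h : Gn p n × Gn p n) : wChar (branchingVectors p n) χ (g * iota h) =
      sw h.2.det * wChar (branchingVectors p n) χ g := by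
  obtain ⟨-, h2, h3⟩ := isUnit_minors hg
  rw [wChar_eq, wChar_eq, wMon, wMon, map_mul, det_iota, leftMinor_mul_iota, rightMinor_mul_iota,
    unitOf_mul _ h2, unitOf_mul _ h3, ← hχ (idxN n), ← idxN1_eq]
  simp only [vMinor_mul_iota, map_mul, mul_inv]
  obtain ⟨T, hT⟩ : ∃ T, T = ∏ i, χ (idx i) (unitOf (vMinor i g)) /
    χ (idxS i) (unitOf (vMinor i g)) := ⟨_, rfl⟩
  rw [← hT]
  generalize χ (idxN1 n) (Matrix.GeneralLinearGroup.det h.1) = x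
  generalize χ (idxN1 n) (Matrix.GeneralLinearGroup.det h.2) = y
  generalize χ (idxN n) (Matrix.GeneralLinearGroup.det h.2) = z
  generalize χ (idxN1 n) (Matrix.GeneralLinearGroup.det g) = x2
  generalize (χ (idxN1 n) (unitOf (leftMinor g)))⁻¹ = x3
  generalize χ (idxN n) (unitOf (rightMinor g)) = x4
  calc x2 * (x * y) * T * (x⁻¹ * x3) * (z * x4) = (x * x⁻¹) * (z * y * (x2 * T * x3 * x4)) := by
        simp only [mul_comm, mul_left_comm, mul_assoc]
    _ = _ := by rw [mul_inv_cancel, one_mul]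

end WChar

/-! ### The classical vectors v_{λ,j}. -/

section Classical

variable {p : ℕ} [Fact p.Prime] {n : ℕ} [NeZero n] {L : Type*} [NormedField L]
  [NormedAlgebra ℚ_[p] L]

lemma coe_algChar (m : ℤ) (z : ℤ_[p]ˣ) : (algChar p L m z : L) = intHom p L z ^ m := by
  rw [algChar, MonoidHom.comp_apply, zpowGroupHom_apply, Units.val_zpow_eq_zpow_val]
  rfl

lemma intHom_unit_ne_zero (z : ℤ_[p]ˣ) : intHom p L z ≠ 0 := Units.ne_zero (unitsHom p L z)

lemma algChar_pure {lam : Fin (n + n) → ℤ} {w : ℤ} (h : IsPureDominant lam w) (i) (z : ℤ_[p]ˣ) :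
    algChar p L (lam i) z * algChar p L (lam (Fin.rev i)) z = algChar p L w z := by
  refine Units.ext ?_
  rw [Units.val_mul, coe_algChar, coe_algChar, coe_algChar, ← zpow_add₀ (intHom_unit_ne_zero z),
    h.2]

variable (p L) in
/-- The monomial defining `v_{λ,j}`. -/
def classicalMon (lam : Fin (n + n) → ℤ) (j : ℤ) (v : Fin (n - 1) → ℤ_[p]) (a b d : ℤ_[p]) : L :=
  (∏ i, intHom p L (v i) ^ (lam (idx i) - lam (idxS i))) *
    intHom p L a ^ (-lam (idxN1 n) - j) *
    intHom p L b ^ (lam (idxN n) + j) * intHom p L d ^ lam (idxN1 n)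

lemma classicalMon_mul (lam : Fin (n + n) → ℤ) (j : ℤ) (v v' : Fin (n - 1) → ℤ_[p])
    (a b d a' b' d' : ℤ_[p]) :
    classicalMon p L lam j (fun i => v i * v' i) (a * a') (b * b') (d * d') =
      classicalMon p L lam j v a b d * classicalMon p L lam j v' a' b' d' := by
  simp only [classicalMon, map_mul, mul_zpow, Finset.prod_mul_distrib]
  ring

/-- Separates the dependence on `j`: the monomial of `v_{λ,j}` is the monomial of `w_λ` times the
`j`-th power of `b / a`. The weight computation for `w_χ` can then be reused. -/
lemma classicalMon_unit (lam : Fin (n + n) → ℤ) (j : ℤ) (v : Fin (n - 1) → ℤ_[p]ˣ)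
    (a b d : ℤ_[p]ˣ) : classicalMon p L lam j (fun i => (v i : ℤ_[p])) a b d =
      ((algChar p L (lam (idxN1 n)) d * (∏ i, algChar p L (lam (idx i)) (v i) /
        algChar p L (lam (idxS i)) (v i)) * (algChar p L (lam (idxN1 n)) a)⁻¹ *
        algChar p L (lam (idxN n)) b * (algChar p L j b / algChar p L j a) : Lˣ) : L) := by
  have ha := intHom_unit_ne_zero (L := L) a
  have hb := intHom_unit_ne_zero (L := L) b
  have hv := fun i => intHom_unit_ne_zero (L := L) (v i)
  simp only [Units.val_mul, Units.coe_prod, Units.val_div_eq_div_val, Units.val_inv_eq_inv_val,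
    coe_algChar, classicalMon, zpow_sub₀ ha, zpow_add₀ hb, zpow_sub₀ (hv _), zpow_neg]
  ring

variable (p L) in
/-- The classical vector `v_{λ,j}` over `L`. -/
def classicalFn (lam : Fin (n + n) → ℤ) (j : ℤ) (g : G p n) : L :=
  classicalMon p L lam j (fun i => vMinor i g) (leftMinor g) (rightMinor g) g.det

lemma algebraMap_classicalVec (lam : Fin (n + n) → ℤ) (j : ℤ) (g : G p n) :
    algebraMap ℚ_[p] L (classicalVec (branchingVectors p n) lam j g) = classicalFn p L lam j g := by
  simp only [classicalVec, map_mul, map_prod, map_zpow₀]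
  rfl

lemma algFn_zpow {f : G p n → L} (hf : f ∈ algFn p n L) {m : ℤ} (hm : 0 ≤ m) :
    (fun g => f g ^ m) ∈ algFn p n L := by
  lift m to ℕ using hm
  convert pow_mem hf m using 1
  funext g
  simp

/-- Dominance makes the exponents of the `v_(i)` nonnegative, and `j ∈ crit lam` is exactly
nonnegativity of the exponents of the other two minors. The determinant may carry a negative
exponent, being invertible. -/
lemma classicalFn_mem_algFn {lam : Fin (n + n) → ℤ} {w : ℤ} (hl : IsPureDominant lam w) {j : ℤ}
    (hj : j ∈ crit lam) : classicalFn p L lam j ∈ algFn p n L := by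
  have h1 : ∀ i, 0 ≤ lam (idx i) - lam (idxS i) := fun i =>
    sub_nonneg.2 (hl.1 (Fin.le_def.2 (Nat.le_succ _)))
  have e : classicalFn p L lam j =
      (∏ i, fun g => intHom p L (vMinor i g) ^ (lam (idx i) - lam (idxS i))) *
      (fun g => intHom p L (leftMinor g) ^ (-lam (idxN1 n) - j)) *
      (fun g => intHom p L (rightMinor g) ^ (lam (idxN n) + j)) *
      fun g => intHom p L (g.det : ℤ_[p]) ^ lam (idxN1 n) := by
    funext g
    simp only [Pi.mul_apply, Finset.prod_apply]
    rfl
  rw [e]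
  refine mul_mem (mul_mem (mul_mem (prod_mem fun i _ => ?_) ?_) ?_) (algFn_det_zpow _)
  · exact algFn_zpow (algFn_cornerMinor _ _) (h1 i)
  · exact algFn_zpow algFn_leftMinor (sub_nonneg.2 hj.2)
  · exact algFn_zpow algFn_rightMinor (by linarith [hj.1])

/-- The left and the right minor have the same weight, so the quotient whose `j`-th power appears is
left invariant and the weight does not depend on `j`. -/
lemma classicalFn_lower_mul {lam : Fin (n + n) → ℤ} {w : ℤ} (hl : IsPureDominant lam w) (j : ℤ)
    {k : G p n} (hk : k ∈ lowerUnip p n 0) (t : Fin (n + n) → ℤ_[p]ˣ) (g : G p n) :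
    classicalFn p L lam j (k * torus t * g) =
      ((∏ i, algChar p L (lam i) (t i) : Lˣ) : L) * classicalFn p L lam j g := by
  rw [← weight_identity (algChar_pure (L := L) hl) t
      fun i => (succ_le_of_fin_pred i).trans (Nat.le_add_left n n)]
  simp only [classicalFn, det_lower_mul hk, leftMinor_lower_mul hk, rightMinor_lower_mul hk,
    vMinor_lower_mul _ hk, Units.val_mul _ (Matrix.GeneralLinearGroup.det g)]
  rw [classicalMon_mul, classicalMon_unit, div_self', mul_one]

/-- The exponent of `det h₁` is `(-λ_{n+1} - j) + λ_{n+1}`. That of `det h₂` is `(λ_n + j) +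
λ_{n+1}`, where `λ_n + λ_{n+1} = w`. -/
lemma classicalFn_mul_iota {lam : Fin (n + n) → ℤ} {w : ℤ} (hl : IsPureDominant lam w) (j : ℤ)
    (g : G p n) (h : Gn p n × Gn p n) : classicalFn p L lam j (g * iota h) =
      ((algChar p L (-j) h.1.det * algChar p L (w + j) h.2.det : Lˣ) : L) *
        classicalFn p L lam j g := by
  have hw : w = lam (idxN n) + lam (idxN1 n) := by rw [idxN1_eq, hl.2]
  have n1 := intHom_unit_ne_zero (L := L) h.1.det
  have n2 := intHom_unit_ne_zero (L := L) h.2.det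
  have e1 : -j = (-lam (idxN1 n) - j) + lam (idxN1 n) := by ring
  have e2 : w + j = (lam (idxN n) + j) + lam (idxN1 n) := by rw [hw]; ring
  rw [Units.val_mul, coe_algChar, coe_algChar, e1, e2, zpow_add₀ n1, zpow_add₀ n2]
  simp only [classicalFn, classicalMon, vMinor_mul_iota, leftMinor_mul_iota, rightMinor_mul_iota, map_mul, det_iota,
    Units.val_mul, mul_zpow]
  ring

lemma classicalFn_uElt (lam : Fin (n + n) → ℤ) (j : ℤ) :
    classicalFn p L lam j (uElt p n) = 1 := by
  have h1 : ((uElt p n).det : ℤ_[p]) = 1 := by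
    change (Matrix.reindex finSumFinEquiv finSumFinEquiv
      (Matrix.fromBlocks 1 (antidiag p n) 0 1)).det = 1
    rw [Matrix.det_reindex_self, Matrix.det_fromBlocks_zero₂₁, Matrix.det_one, mul_one]
  have h2 : ∀ i, vMinor i (uElt p n) = 1 := fun i => cornerMinor_uElt _ _ (succ_le_of_fin_pred i)
  simp [classicalFn, classicalMon, h1, h2, leftMinor_uElt, rightMinor_uElt]

/-- On `Iw^1`, the classical vector is the value of `v_λ` at `z ↦ z^j`. -/
lemma classicalFn_eq_wChar (lam : Fin (n + n) → ℤ) (j : ℤ) {g : G p n} (hg : g ∈ iwSet p n 1) :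
    classicalFn p L lam j g =
      (wChar (branchingVectors p n) (fun i => algChar p L (lam i)) g : L) *
        (algChar p L j (unitOf (rightMinor g) / unitOf (leftMinor g)) : L) := by
  obtain ⟨h1, h2, h3⟩ := isUnit_minors hg
  rw [wChar_eq, wMon, map_div, ← Units.val_mul, ← classicalMon_unit, classicalFn, coe_unitOf h2,
    coe_unitOf h3]
  simp only [coe_unitOf (h1 _)]

end Classical
end BranchingLaw
end

noncomputable section
namespace BranchingLaw

/-! ### Locally analytic functions on `Iw` -/

section IwAnalytic

variable {p : ℕ} [Fact p.Prime] {n : ℕ}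

lemma isCompact_range_zpCoord : IsCompact (Set.range (zpCoord p)) := by
  have : Set.range (zpCoord p) = Metric.sphere (0 : ℚ_[p]) 1 := by
    ext x
    rw [mem_sphere_zero_iff_norm]
    constructor
    · rintro ⟨z, rfl⟩
      exact PadicInt.isUnit_iff.1 z.isUnit
    · exact fun h => ⟨PadicInt.mkUnits h, rfl⟩
  rw [this]
  exact isCompact_sphere 0 1

/-- Inside the compact space of integral matrices, Iw is cut out by closed conditions on norms: the
determinant has norm one and the entries below the diagonal have norm at most `p⁻¹`. -/
lemma isCompact_range_iwCoord : IsCompact (Set.range (iwCoord (p := p) (n := n))) := by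
  let K : Set (Matrix (Fin (n + n)) (Fin (n + n)) ℤ_[p]) :=
    {M | ‖M.det‖ = 1} ∩ ⋂ i, ⋂ j, {M | j < i → ‖M i j‖ ≤ (p : ℝ) ^ (-(1 : ℕ) : ℤ)}
  have hK : IsClosed K := by
    refine IsClosed.inter (isClosed_eq (continuous_id.matrix_det).norm continuous_const) ?_
    refine isClosed_iInter fun i => isClosed_iInter fun j => ?_
    by_cases hij : j < i
    · simp only [hij, true_imp_iff]
      exact isClosed_le (continuous_id.matrix_elem i j).norm continuous_const
    · simp only [hij, false_imp_iff, Set.ofPred_true, isClosed_univ]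
  have : CompactSpace (Matrix (Fin (n + n)) (Fin (n + n)) ℤ_[p]) :=
    inferInstanceAs (CompactSpace (Fin (n + n) → Fin (n + n) → ℤ_[p]))
  have hc : Continuous fun (M : Matrix (Fin (n + n)) (Fin (n + n)) ℤ_[p]) i j =>
      ((M i j : ℤ_[p]) : ℚ_[p]) :=
    continuous_pi fun i => continuous_pi fun j =>
      continuous_subtype_val.comp (continuous_id.matrix_elem i j)
  convert hK.isCompact.image hc using 1
  have hdvd : ∀ z : ℤ_[p], ‖z‖ ≤ (p : ℝ) ^ (-(1 : ℕ) : ℤ) ↔ (p : ℤ_[p]) ∣ z := fun z => by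
    rw [PadicInt.norm_le_pow_iff_mem_span_pow, pow_one, Ideal.mem_span_singleton]
  ext f
  constructor
  · rintro ⟨g, rfl⟩
    refine ⟨g.1.1, ⟨?_, Set.mem_iInter₂.2 fun i j hij => ?_⟩, rfl⟩
    · exact PadicInt.isUnit_iff.1 ((Matrix.isUnit_iff_isUnit_det _).1 g.1.isUnit)
    · exact (hdvd _).2 ((mem_Iw_iff _).1 g.2 i j hij)
  · rintro ⟨M, ⟨h1, h2⟩, rfl⟩
    refine ⟨⟨Matrix.GeneralLinearGroup.mk'' M (PadicInt.isUnit_iff.2 h1), (mem_Iw_iff _).2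
      fun i j hij => (hdvd _).1 (Set.mem_iInter₂.1 h2 i j hij)⟩, rfl⟩

instance : Nonempty (Iw p n) := ⟨1⟩

/-- Elements of `Iw` which are close are congruent mod `p`. -/
lemma iwCoord_near (x : Iw p n) : ∀ᶠ z in 𝓝 (iwCoord x), ∀ y : Iw p n, iwCoord y = z →
    ∀ i j, (p : ℤ_[p]) ∣ y.1.1 i j - x.1.1 i j := by
  have h0 : (0 : ℝ) < (p : ℝ) ^ (-(1 : ℕ) : ℤ) :=
    zpow_pos (by exact_mod_cast (Fact.out : p.Prime).pos) _
  filter_upwards [Metric.ball_mem_nhds (iwCoord x) h0] with z hz y hy i j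
  rw [← hy, Metric.mem_ball, dist_eq_norm] at hz
  have h1 : ‖(y.1.1 i j - x.1.1 i j : ℤ_[p])‖ ≤ (p : ℝ) ^ (-(1 : ℕ) : ℤ) := by
    refine le_trans ?_ hz.le
    refine le_trans ?_ ((norm_le_pi_norm ((iwCoord y - iwCoord x) i) j).trans
      (norm_le_pi_norm (iwCoord y - iwCoord x) i))
    exact le_of_eq rfl
  rwa [PadicInt.norm_le_pow_iff_mem_span_pow, pow_one, Ideal.mem_span_singleton] at h1

/-- Membership in Iw^1 depends only on `g` mod `p`, so Iw^1 is open and closed and extension by zero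
preserves local analyticity. -/
lemma iwSet_near (x : Iw p n) : ∀ᶠ z in 𝓝 (iwCoord x), ∀ y : Iw p n, iwCoord y = z →
    (y.1 ∈ iwSet p n 1 ↔ x.1 ∈ iwSet p n 1) := by
  filter_upwards [iwCoord_near x] with z hz y hy
  have h := hz y hy
  have h1 : ∀ i j, (p : ℤ_[p]) ∣ (y.1 * (uElt p n)⁻¹).1 i j - (x.1 * (uElt p n)⁻¹).1 i j :=
    fun i j => by
      rw [Units.val_mul, Units.val_mul, Matrix.mul_apply, Matrix.mul_apply,
        ← Finset.sum_sub_distrib]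
      refine Finset.dvd_sum fun l _ => ?_
      rw [← sub_mul]
      exact (h i l).mul_right _
  rw [mem_iwSet_iff, mem_iwSet_iff]
  refine forall₃_congr fun i j _ => ?_
  exact dvd_iff_dvd_of_dvd_sub (h1 i j)

variable {L : Type*} [NormedField L] [NormedAlgebra ℚ_[p] L]

/-- An algebraic function is a polynomial divided by a power of the determinant, which does not
vanish on Iw. -/
lemma LocAnAt.of_algFn {f : G p n → L} (hf : f ∈ algFn p n L) (x : Iw p n) :
    LocAnAt p (iwCoord (p := p) (n := n)) (fun g : Iw p n => f g.1) x := by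
  obtain ⟨P, m, hP⟩ := hf
  have hcoord : ∀ ij : Fin (n + n) × Fin (n + n), AnalyticAt ℚ_[p]
      (fun z : Fin (n + n) → Fin (n + n) → ℚ_[p] => algebraMap ℚ_[p] L (z ij.1 ij.2))
      (iwCoord x) := fun ij => by
    let T : (Fin (n + n) → Fin (n + n) → ℚ_[p]) →L[ℚ_[p]] L :=
      (algebraMapCLM ℚ_[p] L).comp ((ContinuousLinearMap.proj (R := ℚ_[p])
        (φ := fun _ : Fin (n + n) => ℚ_[p]) ij.2).comp (ContinuousLinearMap.proj (R := ℚ_[p])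
          (φ := fun _ : Fin (n + n) => Fin (n + n) → ℚ_[p]) ij.1))
    exact T.analyticAt _
  have h1 : LocAnAt p (iwCoord (p := p) (n := n)) (fun g : Iw p n =>
      f g.1 * (unitsHom p L g.1.det : L) ^ m) x :=
    .of_eventually (AnalyticAt.aeval_mvPolynomial hcoord P) fun g => by
      rw [hP, MvPolynomial.aeval_eq_eval]
      rfl
  have h2 : LocAnAt p (iwCoord (p := p) (n := n)) (fun g : Iw p n =>
      (unitsHom p L g.1.det : L)) x :=
    .of_eventually (AnalyticAt.aeval_mvPolynomial hcoord
      (Matrix.det (Matrix.of fun i j =>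
        (MvPolynomial.X (i, j) : MvPolynomial (Fin (n + n) × Fin (n + n)) L)))) fun g => by
      rw [AlgHom.map_det]
      change intHom p L g.1.1.det = _
      rw [RingHom.map_det]
      congr 1
      ext i j
      simp only [RingHom.mapMatrix_apply, AlgHom.mapMatrix_apply, Matrix.map_apply, Matrix.of_apply,
        MvPolynomial.aeval_X]
      rfl
  have h3 := h2.comp_analytic (F := fun z : L => (z⁻¹) ^ m)
    (((analyticAt_inv (Units.ne_zero _))).pow m)
  convert h1.mul h3 using 2 with g
  rw [mul_assoc, ← mul_pow, mul_inv_cancel₀ (Units.ne_zero _), one_pow, mul_one]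

variable {X E A : Type*} [NormedAddCommGroup E] [NormedSpace ℚ_[p] E] [NormedCommRing A]
  [NormedAlgebra ℚ_[p] A] {e : X → E}

lemma LocAnAt.char [CompleteSpace A] {χ : ℤ_[p]ˣ →* Aˣ} (hχ : Continuous χ) {φ : X → ℤ_[p]ˣ} {x : X}
    (hφ : LocAnAt p e (fun y => zpCoord p (φ y)) x) : LocAnAt p e (fun y => (χ (φ y) : A)) x :=
  (LocAnAt.of_continuous_char χ (Units.continuous_val.comp hχ) (φ x)).comp
    (f := fun z => (χ z : A)) hφ

lemma LocAnAt.char_inv [CompleteSpace A] {χ : ℤ_[p]ˣ →* Aˣ} (hχ : Continuous χ) {φ : X → ℤ_[p]ˣ}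
    {x : X} (hφ : LocAnAt p e (fun y => zpCoord p (φ y)) x) :
    LocAnAt p e (fun y => (((χ (φ y))⁻¹ : Aˣ) : A)) x :=
  LocAnAt.char (χ := χ⁻¹) hχ.inv hφ

lemma LocAnAt.units_inv {φ : X → ℤ_[p]ˣ} {x : X} (hφ : LocAnAt p e (fun y => zpCoord p (φ y)) x) :
    LocAnAt p e (fun y => zpCoord p (φ y)⁻¹) x := by
  have h : ∀ z : ℤ_[p]ˣ, zpCoord p z⁻¹ = (zpCoord p z)⁻¹ := fun z =>
    eq_inv_of_mul_eq_one_left (by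
      rw [zpCoord, zpCoord, ← PadicInt.coe_mul, ← Units.val_mul, inv_mul_cancel]
      rfl)
  simp only [h]
  refine hφ.comp_analytic (F := fun z : ℚ_[p] => z⁻¹) (analyticAt_inv ?_)
  exact intHom_unit_ne_zero (L := ℚ_[p]) (φ x)

lemma LocAnAt.units_mul {φ ψ : X → ℤ_[p]ˣ} {x : X}
    (hφ : LocAnAt p e (fun y => zpCoord p (φ y)) x)
    (hψ : LocAnAt p e (fun y => zpCoord p (ψ y)) x) :
    LocAnAt p e (fun y => zpCoord p (φ y * ψ y)) x := by
  simpa only [zpCoord, Units.val_mul, PadicInt.coe_mul] using hφ.mul hψ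

lemma LocAnAt.units_div {φ ψ : X → ℤ_[p]ˣ} {x : X}
    (hφ : LocAnAt p e (fun y => zpCoord p (φ y)) x)
    (hψ : LocAnAt p e (fun y => zpCoord p (ψ y)) x) :
    LocAnAt p e (fun y => zpCoord p (φ y / ψ y)) x := by
  simpa only [div_eq_mul_inv] using hφ.units_mul hψ.units_inv

lemma LocAnAt.unitOf {f : X → ℤ_[p]} {x : X} (hf : LocAnAt p e (fun y => (f y : ℚ_[p])) x)
    (h : ∀ᶠ z in 𝓝 (e x), ∀ y, e y = z → IsUnit (f y)) :
    LocAnAt p e (fun y => zpCoord p (unitOf (f y))) x := by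
  refine hf.congr ?_
  filter_upwards [h] with z hz y hy
  rw [zpCoord, coe_unitOf (hz y hy)]

lemma continuous_algChar (m : ℤ) : Continuous (algChar p L m) := by
  have h : Continuous (unitsHom p L) := by
    refine Continuous.units_map _ ?_
    exact (algebraMapCLM ℚ_[p] L).continuous.comp continuous_subtype_val
  exact (continuous_zpow m).comp h

end IwAnalytic
end BranchingLaw
end

noncomputable section
namespace BranchingLaw

/-! ### Specialisation of distributions -/

section Specialisation

variable {p : ℕ} [Fact p.Prime] {X E L A : Type*} [NormedAddCommGroup E] [NormedSpace ℚ_[p] E]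
  [NormedField L] [NormedAlgebra ℚ_[p] L] [NormedCommRing A] [NormedAlgebra ℚ_[p] A]
  [NormedAlgebra L A] [IsScalarTower ℚ_[p] L A] {e : X → E}

/-- A bounded `ℚ_p`-linear change of coefficients. -/
lemma AnalyticBound.clm {B : Type*} [NormedCommRing B] [NormedAlgebra ℚ_[p] B] (T : B →L[ℚ_[p]] A)
    {k : ℕ} {C : ℝ} {f : X → B} (h : AnalyticBound p e k C f) :
    AnalyticBound p e k (‖T‖ * C) (fun y => T (f y)) := by
  intro x
  obtain ⟨q, h1, h2, h3⟩ := h x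
  have key : ∀ m, ‖T.compFormalMultilinearSeries q m‖ * (((p : ℝ)⁻¹) ^ k) ^ m ≤
      ‖T‖ * (‖q m‖ * (((p : ℝ)⁻¹) ^ k) ^ m) := fun m => by
    rw [← mul_assoc]
    gcongr
    exact T.norm_compContinuousMultilinearMap_le (q m)
  refine ⟨T.compFormalMultilinearSeries q, fun m => (key m).trans (by gcongr; exact h1 m),
    squeeze_zero (fun m => by positivity) key (by simpa using h2.const_mul ‖T‖), fun y hy => ?_⟩
  exact (h3 y hy).map T T.continuous

variable (p L A) in
/-- The structure map `L → A` as a `ℚ_p`-linear map. -/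
def algCLM : L →L[ℚ_[p]] A :=
  LinearMap.mkContinuous (IsScalarTower.toAlgHom ℚ_[p] L A).toLinearMap ‖(1 : A)‖ fun a => by
    rw [mul_comm]
    exact (norm_algebraMap A a).le

variable (p e A) in
/-- Extension of scalars from `L` to `A` of locally analytic functions. -/
def locAnExtend (f : locAn p e L) : locAn p e A := ⟨fun y => algebraMap L A (f.1 y), by
  obtain ⟨k, C, h⟩ := f.2
  exact ⟨k, _, h.clm (algCLM p L A)⟩⟩

variable [CompleteSpace A]

/-- Continuity is automatic for a character of a complete normed algebra. It makes the kernel of a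
classical point a closed ideal. -/
lemma continuous_algHom (x : A →ₐ[L] L) : Continuous x :=
  AddMonoidHomClass.continuous_of_bound x ‖(1 : A)‖ fun a => by
    rw [mul_comm]
    exact AlgHom.norm_apply_le_self_mul_norm_one x a

/-- Let `P` be a bounded projector from the locally analytic functions onto `S`, such that `S'` is
the fibre of `S` at the point `x`. Then the specialisation map at `x` is well defined. -/
theorem existsUnique_specialisation [IsUltrametricDist E] [FiniteDimensional ℚ_[p] E]
    (hc : IsCompact (Set.range e)) {S : Submodule A (X → A)} {S' : Submodule L (X → L)}
    (hS : S ≤ locAn p e A) (hS' : S' ≤ locAn p e L) (P : locAn p e A →ₗ[A] S)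
    (hP : ∀ k, ∃ k' : ℕ, ∃ C : ℝ, 0 ≤ C ∧ ∀ (f : locAn p e A) B, AnalyticBound p e k B f.1 →
      AnalyticBound p e k' (C * B) (P f).1)
    (hPS : ∀ F : S, P ⟨F.1, hS F.2⟩ = F) (x : A →ₐ[L] L)
    (hx : ∀ (f : S') y, f.1 y = x ((P (locAnExtend p A e ⟨f.1, hS' f.2⟩)).1 y)) :
    (∃! sp : Dist p e S →ₛₗ[(x : A →+* L)] Dist p e S', IsSpecialisation (x : A →+* L) sp) ∧
    ∀ sp : Dist p e S →ₛₗ[(x : A →+* L)] Dist p e S', IsSpecialisation (x : A →+* L) sp →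
      ∀ μ (f : S'), (sp μ).1 f = x (μ.1 (P (locAnExtend p A e ⟨f.1, hS' f.2⟩))) := by
  have h2 : ∀ sp : Dist p e S →ₛₗ[(x : A →+* L)] Dist p e S', IsSpecialisation (x : A →+* L) sp →
      ∀ μ (f : S'), (sp μ).1 f = x (μ.1 (P (locAnExtend p A e ⟨f.1, hS' f.2⟩))) :=
    fun sp hsp μ f => hsp μ _ f (hx f)
  refine ⟨?_, h2⟩
  -- A canonical lift of `f`: extend scalars and project to `S`. By `hx` it specialises to `f`, so
  -- the defining property forces the value of `sp μ` at `f`; this gives uniqueness and the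
  -- candidate for existence.
  let ext : S' → S := fun f => P (locAnExtend p A e ⟨f.1, hS' f.2⟩)
  have ext_add : ∀ f f', ext (f + f') = ext f + ext f' := fun f f' => by
    rw [← map_add]
    exact congrArg P (Subtype.ext (funext fun y => map_add (algebraMap L A) _ _))
  have ext_smul : ∀ (c : L) f, ext (c • f) = algebraMap L A c • ext f := fun c f => by
    rw [← map_smul]
    exact congrArg P (Subtype.ext (funext fun y => map_mul (algebraMap L A) _ _))
  let sp : Dist p e S →ₛₗ[(x : A →+* L)] Dist p e S' :=
    { toFun := fun μ => ⟨
        { toFun := fun f => x (μ.1 (ext f))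
          map_add' := fun f f' => by rw [ext_add, map_add, map_add]
          map_smul' := fun c f => by
            rw [ext_smul, map_smul, smul_eq_mul, map_mul, AlgHom.commutes]
            rfl }, fun k => by
          obtain ⟨k', C, hC, H⟩ := hP k
          obtain ⟨Cμ, hμ⟩ := μ.2 k'
          refine ⟨Cμ * (C * ‖algCLM p L A‖) * ‖(1 : A)‖, fun f B hB => ?_⟩
          have h1 := H (locAnExtend p A e ⟨f.1, hS' f.2⟩) _ (hB.clm (algCLM p L A))
          have h3 := hμ (ext f) _ h1
          refine (AlgHom.norm_apply_le_self_mul_norm_one x _).trans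
            ((mul_le_mul_of_nonneg_right h3 (norm_nonneg _)).trans (le_of_eq ?_))
          ring⟩
      map_add' := fun μ ν => Subtype.ext (LinearMap.ext fun f => map_add x _ _)
      map_smul' := fun a μ => Subtype.ext (LinearMap.ext fun f => map_mul x _ _) }
  let xQ : A →L[ℚ_[p]] L :=
    { toFun := x
      map_add' := map_add x
      map_smul' := fun c a => by
        have := map_smul x (algebraMap ℚ_[p] L c) a
        rwa [algebraMap_smul, algebraMap_smul] at this
      cont := continuous_algHom x }
  -- The projection `a ↦ a - x(a)` of `A` onto `ker x` along the scalars.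
  let π : A →L[ℚ_[p]] A := ContinuousLinearMap.id ℚ_[p] A - (algCLM p L A).comp xQ
  have hπ : ∀ a, π a = a - algebraMap L A (x a) := fun _ => rfl
  have hsp : IsSpecialisation (x : A →+* L) sp := by
    intro μ F f hF
    -- An arbitrary lift `F` differs from the constant extension of `f` by a function with values in
    -- `ker x`. Since `P` fixes `F`, the value `x(μ F)` agrees with the one at the canonical lift.
    have h3 := Dist.apply_mem_of_ideal_valued hc P hP (RingHom.ker (x : A →+* L))
      (isClosed_singleton.preimage (continuous_algHom x)) π (fun a => by
        rw [RingHom.mem_ker, hπ, map_sub]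
        exact sub_eq_zero.2 (x.commutes _).symm)
      (⟨F.1, hS F.2⟩ - locAnExtend p A e ⟨f.1, hS' f.2⟩) (fun y => by
        have h4 : x (F.1 y - algebraMap L A (f.1 y)) = 0 := by
          rw [map_sub, AlgHom.commutes, hF y]
          exact sub_self _
        change π (F.1 y - algebraMap L A (f.1 y)) = F.1 y - algebraMap L A (f.1 y)
        rw [hπ, h4, map_zero, sub_zero]) μ
    rw [map_sub, map_sub, hPS, RingHom.mem_ker, map_sub, sub_eq_zero] at h3
    exact h3.symm
  exact ⟨sp, hsp, fun sp' hsp' => LinearMap.ext fun μ => Subtype.ext (LinearMap.ext fun f =>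
    (h2 sp' hsp' μ f).trans (h2 sp hsp μ f).symm)⟩

end Specialisation
end BranchingLaw
end

noncomputable section
namespace BranchingLaw

/-! ### The Iwahori coordinates are locally analytic -/

section Coordinates

variable {p : ℕ} [Fact p.Prime] {n : ℕ}

/-- The minor in the first `i` rows, with columns `c`. -/
def topMinor {i : ℕ} (hi : i ≤ n + n) (c : Fin i → Fin (n + n)) (g : G p n) : ℤ_[p] :=
  (g.1.submatrix (Fin.castLE hi) c).det

/-- The leading minor of size `i`. -/
def leadMinor (i : ℕ) (hi : i ≤ n + n) (g : G p n) : ℤ_[p] := topMinor hi (Fin.castLE hi) g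

/-- The minor in the first `i + 1` rows, the first `i` columns and the column `j`. -/
def colMinor (i j : Fin (n + n)) (g : G p n) : ℤ_[p] :=
  topMinor i.2 (Fin.snoc (fun a : Fin i.1 => Fin.castLE i.2.le a) j) g

lemma topMinor_lower_mul {i : ℕ} (hi : i ≤ n + n) (c : Fin i → Fin (n + n)) {k : G p n}
    (hk : k ∈ lowerUnip p n 0) (t : Fin (n + n) → ℤ_[p]ˣ) (g : G p n) :
    topMinor hi c (k * torus t * g) =
      ((∏ a : Fin i, t (Fin.castLE hi a) : ℤ_[p]ˣ) : ℤ_[p]) * topMinor hi c g := by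
  have h1 := lower_mul_torus_apply hk t
  rw [topMinor, Units.val_mul (k * torus t), det_submatrix_lower_mul _ h1.1, Units.coe_prod]
  simp only [h1.2]
  rfl

lemma leadMinor_upper {m : G p n} (hm : m ∈ upperUnip p n 0) (i : ℕ) (hi : i ≤ n + n) :
    leadMinor i hi m = 1 := by
  rw [leadMinor, topMinor, Matrix.det_of_isUpperTriangular]
  · exact Finset.prod_eq_one fun a _ => hm.1 _
  · exact fun a b hab => hm.2.1 _ _ hab

/-- The chosen submatrix is again upper triangular, with diagonal entries `1` except for the last,
which is the entry `(i, j)`. -/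
lemma colMinor_upper {m : G p n} (hm : m ∈ upperUnip p n 0) (i j : Fin (n + n)) :
    colMinor i j m = m.1 i j := by
  rw [colMinor, topMinor, Matrix.det_of_isUpperTriangular]
  · rw [Fin.prod_univ_castSucc]
    simp only [Matrix.submatrix_apply, Fin.snoc_castSucc, Fin.snoc_last]
    rw [Finset.prod_eq_one fun a _ => ?_, one_mul]
    · rfl
    · exact hm.1 _
  · intro a b hab
    induction b using Fin.lastCases with
    | last => exact absurd (show Fin.last i.1 < a from hab) (not_lt.2 (Fin.le_last a))
    | cast b =>
      simp only [Matrix.submatrix_apply, Fin.snoc_castSucc]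
      exact hm.2.1 _ _ hab

/-- The torus part of the Iwahori decomposition. -/
def torusPart (g : G p n) (i : Fin (n + n)) : ℤ_[p]ˣ :=
  unitOf (leadMinor (i.1 + 1) i.2 g) / unitOf (leadMinor i.1 i.2.le g)

/-- Leading minors ignore the upper unipotent factor and see only products of initial entries of
`t`, so their successive quotients recover `t`. -/
lemma torusPart_decomp {k : G p n} (hk : k ∈ lowerUnip p n 0) (t : Fin (n + n) → ℤ_[p]ˣ)
    {m : G p n} (hm : m ∈ upperUnip p n 0) : torusPart (k * torus t * m) = t := by
  funext i
  rw [torusPart, leadMinor, leadMinor, topMinor_lower_mul _ _ hk, topMinor_lower_mul _ _ hk]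
  change unitOf (_ * leadMinor _ _ m) / unitOf (_ * leadMinor _ _ m) = _
  rw [leadMinor_upper hm, leadMinor_upper hm, mul_one, mul_one, unitOf_coe, unitOf_coe,
    Fin.prod_univ_castSucc, div_eq_iff_eq_mul, mul_comm]
  rfl

lemma lowerUnip_one_subset {k : G p n} (hk : k ∈ lowerUnip p n 1) : k ∈ lowerUnip p n 0 :=
  ⟨hk.1, hk.2.1, fun _ _ _ => by simp⟩

/-- The upper unipotent part of the Iwahori decomposition. -/
def upperPart (g : Iw p n) : Iw p n :=
  ⟨(exists_iwahori g.2).choose_spec.2.choose_spec.choose,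
    mem_Iw_of_upper (exists_iwahori g.2).choose_spec.2.choose_spec.choose_spec.1.2.1⟩

lemma upperPart_mem (g : Iw p n) : (upperPart g).1 ∈ upperUnip p n 0 :=
  (exists_iwahori g.2).choose_spec.2.choose_spec.choose_spec.1

lemma exists_decomp (g : Iw p n) :
    ∃ k ∈ lowerUnip p n 1, g.1 = k * torus (torusPart g.1) * (upperPart g).1 := by
  have h := exists_iwahori g.2
  have hk := h.choose_spec.1
  have e : g.1 = h.choose * torus h.choose_spec.2.choose * (upperPart g).1 :=
    h.choose_spec.2.choose_spec.choose_spec.2.1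
  refine ⟨_, hk, ?_⟩
  have h2 := torusPart_decomp (lowerUnip_one_subset hk) h.choose_spec.2.choose (upperPart_mem g)
  rw [← e] at h2
  rw [h2]
  exact e

lemma isUnit_leadMinor (g : Iw p n) (i hi) : IsUnit (leadMinor i hi g.1) := by
  obtain ⟨k, hk, e⟩ := exists_decomp g
  rw [e, leadMinor, topMinor_lower_mul _ _ (lowerUnip_one_subset hk)]
  change IsUnit (_ * leadMinor _ _ _)
  rw [leadMinor_upper (upperPart_mem g), mul_one]
  exact Units.isUnit _

/-- A formula of Cramer type: the entries of the upper factor are quotients of minors of `g`.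
Although `upperPart` is defined by a choice, it is thus a rational function of the entries of `g`,
and both its analyticity and its left invariance follow. -/
lemma upperPart_apply (g : Iw p n) (i j) : (upperPart g).1.1 i j =
    ((unitOf (leadMinor (i.1 + 1) i.2 g.1))⁻¹ : ℤ_[p]ˣ) * colMinor i j g.1 := by
  obtain ⟨k, hk, e⟩ := exists_decomp g
  have hk' := lowerUnip_one_subset hk
  have hm := upperPart_mem g
  have h1 : leadMinor (i.1 + 1) i.2 g.1 =
      ((∏ a : Fin (i.1 + 1), torusPart g.1 (Fin.castLE i.2 a) : ℤ_[p]ˣ) : ℤ_[p]) := by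
    conv_lhs => rw [e]
    rw [leadMinor, topMinor_lower_mul _ _ hk']
    exact (congrArg _ (leadMinor_upper hm _ i.2)).trans (mul_one _)
  have h2 : colMinor i j g.1 = ((∏ a : Fin (i.1 + 1), torusPart g.1 (Fin.castLE i.2 a) : ℤ_[p]ˣ) :
      ℤ_[p]) * (upperPart g).1.1 i j := by
    conv_lhs => rw [e]
    rw [colMinor, topMinor_lower_mul _ _ hk']
    exact congrArg _ (colMinor_upper hm _ _)
  rw [h1, h2, unitOf_coe, Units.inv_mul_cancel_left]

lemma torusPart_lower_mul {k : G p n} (hk : k ∈ lowerUnip p n 1) (t : Fin (n + n) → ℤ_[p]ˣ)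
    {g g' : Iw p n} (e : g'.1 = k * torus t * g.1) :
    torusPart g'.1 = t * torusPart g.1 := by
  have hk' := lowerUnip_one_subset hk
  funext i
  rw [e, Pi.mul_apply, torusPart, torusPart, leadMinor, leadMinor, topMinor_lower_mul _ _ hk',
    topMinor_lower_mul _ _ hk']
  change unitOf (_ * leadMinor _ _ _) / unitOf (_ * leadMinor _ _ _) = _
  rw [unitOf_mul _ (isUnit_leadMinor g _ _), unitOf_mul _ (isUnit_leadMinor g _ _),
    mul_div_mul_comm]
  congr 1
  rw [Fin.prod_univ_castSucc, div_eq_iff_eq_mul, mul_comm]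
  rfl

lemma upperPart_lower_mul {k : G p n} (hk : k ∈ lowerUnip p n 1) (t : Fin (n + n) → ℤ_[p]ˣ)
    {g g' : Iw p n} (e : g'.1 = k * torus t * g.1) : upperPart g' = upperPart g := by
  have hk' := lowerUnip_one_subset hk
  refine Subtype.ext (Units.ext (Matrix.ext fun i j => ?_))
  rw [upperPart_apply, upperPart_apply, e, leadMinor, colMinor, topMinor_lower_mul _ _ hk',
    topMinor_lower_mul _ _ hk']
  change ((unitOf (_ * leadMinor _ _ _))⁻¹ : ℤ_[p]ˣ) * (_ * colMinor i j g.1) = _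
  rw [unitOf_mul _ (isUnit_leadMinor g _ _), mul_inv, mul_comm _ (unitOf _)⁻¹, Units.val_mul,
    mul_assoc, Units.inv_mul_cancel_left]

lemma locAnAt_topMinor {i : ℕ} (hi : i ≤ n + n) (c : Fin i → Fin (n + n)) (x : Iw p n) :
    LocAnAt p (iwCoord (p := p) (n := n)) (fun g : Iw p n => (topMinor hi c g.1 : ℚ_[p])) x :=
  LocAnAt.of_algFn (L := ℚ_[p]) (algFn_det (M := fun g => g.1.submatrix (Fin.castLE hi) c)
    fun _ _ => algFn_entry _ _) x

lemma locAnAt_unitOf_leadMinor (i hi) (x : Iw p n) : LocAnAt p (iwCoord (p := p) (n := n))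
    (fun g : Iw p n => zpCoord p (unitOf (leadMinor i hi g.1))) x :=
  (locAnAt_topMinor hi _ x).unitOf (Eventually.of_forall fun _ g _ => isUnit_leadMinor g i hi)

lemma locAnAt_torusPart (i) (x : Iw p n) : LocAnAt p (iwCoord (p := p) (n := n))
    (fun g : Iw p n => zpCoord p (torusPart g.1 i)) x :=
  (locAnAt_unitOf_leadMinor _ i.2 x).units_div (locAnAt_unitOf_leadMinor _ i.2.le x)

lemma locAnAt_upperPart (x : Iw p n) : LocAnAt p (iwCoord (p := p) (n := n))
    (fun g : Iw p n => iwCoord (upperPart g)) x := by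
  refine LocAnAt.pi fun i => LocAnAt.pi fun j => ?_
  simp only [iwCoord, upperPart_apply, PadicInt.coe_mul]
  exact (locAnAt_unitOf_leadMinor _ i.2 x).units_inv.mul (locAnAt_topMinor _ _ x)

variable {A : Type*} [NormedCommRing A] [NormedAlgebra ℚ_[p] A]

/-- Elements of the induction are determined by their restriction to `N(ℤ_p)`. -/
lemma anInd_apply {χ : Fin (n + n) → (ℤ_[p]ˣ →* Aˣ)} {f : Iw p n → A} (hf : f ∈ anInd χ)
    (g : Iw p n) : f g = ((∏ i, χ i (torusPart g.1 i) : Aˣ) : A) * f (upperPart g) := by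
  obtain ⟨k, hk, e⟩ := exists_decomp g
  exact hf.2 k hk _ _ _ e

/-- The projector `F ↦ (g ↦ χ(t) F(m))`, for `g = k t m`, onto `𝒜_χ`. -/
theorem exists_projector [CompleteSpace A] (χ : Fin (n + n) → (ℤ_[p]ˣ →* Aˣ))
    (hχ : ∀ i, Continuous (χ i)) :
    ∃ P : locAn p (iwCoord (p := p) (n := n)) A →ₗ[A] anInd χ,
      (∀ k, ∃ k' : ℕ, ∃ C : ℝ, 0 ≤ C ∧ ∀ (f : locAn p (iwCoord (p := p) (n := n)) A) B,
        AnalyticBound p iwCoord k B f.1 → AnalyticBound p iwCoord k' (C * B) (P f).1) ∧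
      ∀ F g, (P F).1 g = ((∏ i, χ i (torusPart g.1 i) : Aˣ) : A) * F.1 (upperPart g) := by
  have hw : ∀ x, LocAnAt p (iwCoord (p := p) (n := n))
      (fun g : Iw p n => ((∏ i, χ i (torusPart g.1 i) : Aˣ) : A)) x := fun x => by
    simp only [Units.coe_prod]
    exact LocAnAt.prod fun i => LocAnAt.char (hχ i) (locAnAt_torusPart i x)
  -- The projector is the weighted composition operator with weight `χ(t)` and substitution `g ↦ m`,
  -- both locally analytic in `g`.
  have H := exists_analyticBound_weighted_comp (p := p) (A := A) isCompact_range_iwCoord hw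
    locAnAt_upperPart
  refine ⟨{ toFun := fun F => ⟨fun g => ((∏ i, χ i (torusPart g.1 i) : Aˣ) : A) *
      F.1 (upperPart g), ?_, ?_⟩, map_add' := ?_, map_smul' := ?_ }, ?_, fun F g => rfl⟩
  · obtain ⟨k, C, hF⟩ := F.2
    obtain ⟨k', C', -, H⟩ := H k
    exact ⟨k', _, H F.1 C hF⟩
  · intro k hk t g g' e
    beta_reduce
    rw [torusPart_lower_mul hk t e, upperPart_lower_mul hk t e]
    simp only [Pi.mul_apply, map_mul, Finset.prod_mul_distrib, Units.val_mul, mul_assoc]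
  · exact fun F F' => Subtype.ext (funext fun g => mul_add _ _ _)
  · exact fun a F => Subtype.ext (funext fun g => mul_left_comm _ _ _)
  · intro k
    obtain ⟨k', C', h0, H⟩ := H k
    exact ⟨k', C', h0, fun f B hf => H f.1 B hf⟩

end Coordinates
end BranchingLaw
end

noncomputable section
namespace BranchingLaw

/-! ### The map `v_Ω` and its dual -/

section BranchingMap

variable {p : ℕ} [Fact p.Prime] {n : ℕ}

open Classical in
/-- The quotient `v_(n),2 / v_(n),1` on `Iw^1`, extended by `1`. -/
def minorQuot (g : G p n) : ℤ_[p]ˣ :=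
  if g ∈ iwSet p n 1 then unitOf (rightMinor g) / unitOf (leftMinor g) else 1

lemma locAnAt_intCast {f : G p n → ℤ_[p]} (hf : (fun g => intHom p ℚ_[p] (f g)) ∈ algFn p n ℚ_[p])
    (x : Iw p n) :
    LocAnAt p (iwCoord (p := p) (n := n)) (fun g : Iw p n => (f g.1 : ℚ_[p])) x :=
  LocAnAt.of_algFn hf x

lemma locAnAt_unitOf_of_iwSet {f : G p n → ℤ_[p]}
    (hf : (fun g => intHom p ℚ_[p] (f g)) ∈ algFn p n ℚ_[p])
    (hu : ∀ g ∈ iwSet p n 1, IsUnit (f g)) {x : Iw p n} (hx : x.1 ∈ iwSet p n 1) :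
    LocAnAt p (iwCoord (p := p) (n := n)) (fun g : Iw p n => zpCoord p (unitOf (f g.1))) x := by
  refine (locAnAt_intCast hf x).unitOf ?_
  filter_upwards [iwSet_near x] with z hz y hy
  exact hu _ ((hz y hy).2 hx)

lemma locAnAt_minorQuot (x : Iw p n) : LocAnAt p (iwCoord (p := p) (n := n))
    (fun g : Iw p n => zpCoord p (minorQuot g.1)) x := by
  by_cases hx : x.1 ∈ iwSet p n 1
  · refine ((locAnAt_unitOf_of_iwSet algFn_rightMinor (fun g hg => (isUnit_minors hg).2.2)
      hx).units_div (locAnAt_unitOf_of_iwSet algFn_leftMinor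
        (fun g hg => (isUnit_minors hg).2.1) hx)).congr ?_
    filter_upwards [iwSet_near x] with z hz y hy
    rw [minorQuot, if_pos ((hz y hy).2 hx)]
  · refine (LocAnAt.const (zpCoord p 1)).congr ?_
    filter_upwards [iwSet_near x] with z hz y hy
    rw [minorQuot, if_neg (mt (hz y hy).1 hx)]

/-- Both minors acquire the same factor, the product of the first `n` entries of `t`. -/
lemma minorQuot_lower_mul {k : G p n} (hk : k ∈ lowerUnip p n 0) (t : Fin (n + n) → ℤ_[p]ˣ)
    {g : G p n} (hg : g ∈ iwSet p n 1) (hg' : k * torus t * g ∈ iwSet p n 1) :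
    minorQuot (k * torus t * g) = minorQuot g := by
  obtain ⟨-, h2, h3⟩ := isUnit_minors hg
  rw [minorQuot, minorQuot, if_pos hg, if_pos hg', leftMinor_lower_mul hk, rightMinor_lower_mul hk,
    unitOf_mul _ h2, unitOf_mul _ h3, mul_div_mul_left_eq_div]

lemma minorQuot_mul_iota {g : G p n} (hg : g ∈ iwSet p n 1) {h : Gn p n × Gn p n}
    (hh : h ∈ iwH p n 1) :
    minorQuot (g * iota h) = h.2.det / h.1.det * minorQuot g := by
  obtain ⟨-, h2, h3⟩ := isUnit_minors hg
  rw [minorQuot, minorQuot, if_pos hg, if_pos ((iwSet_mul_iota hh g).2 hg), leftMinor_mul_iota,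
    rightMinor_mul_iota, unitOf_mul _ h2, unitOf_mul _ h3, mul_div_mul_comm]

lemma iwSet_lower_mul {k : G p n} (hk : k ∈ lowerUnip p n 1) (t : Fin (n + n) → ℤ_[p]ˣ)
    (g : G p n) : k * torus t * g ∈ iwSet p n 1 ↔ g ∈ iwSet p n 1 := by
  rw [mem_iwSet_iff, mem_iwSet_iff, mul_assoc (k * torus t)]
  exact Subgroup.mul_mem_cancel_left _
    (mul_mem (lowerUnip_mem_diagMod hk) (torus_mem_diagMod t))

variable {A : Type*} [NormedCommRing A] [NeZero n]

open Classical in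
/-- The function `w_χ` on `Iw^1`, extended by zero. -/
def wFun (χ : Fin (n + n) → (ℤ_[p]ˣ →* Aˣ)) (g : G p n) : A :=
  if g ∈ iwSet p n 1 then (wChar (branchingVectors p n) χ g : A) else 0

lemma wFun_of_mem (χ : Fin (n + n) → (ℤ_[p]ˣ →* Aˣ)) {g : G p n} (hg : g ∈ iwSet p n 1) :
    wFun χ g = (wChar (branchingVectors p n) χ g : A) := if_pos hg

lemma wFun_of_not_mem (χ : Fin (n + n) → (ℤ_[p]ˣ →* Aˣ)) {g : G p n} (hg : g ∉ iwSet p n 1) :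
    wFun χ g = 0 := if_neg hg

variable [NormedAlgebra ℚ_[p] A]

lemma locAnAt_wFun [CompleteSpace A] {χ : Fin (n + n) → (ℤ_[p]ˣ →* Aˣ)} (hχ : ∀ i, Continuous (χ i)) (x : Iw p n) :
    LocAnAt p (iwCoord (p := p) (n := n)) (fun g : Iw p n => wFun χ g.1) x := by
  by_cases hx : x.1 ∈ iwSet p n 1
  · have hv : ∀ i, LocAnAt p (iwCoord (p := p) (n := n))
        (fun g : Iw p n => zpCoord p (unitOf (vMinor i g.1))) x := fun i =>
      locAnAt_unitOf_of_iwSet (algFn_cornerMinor _ _) (fun g hg => (isUnit_minors hg).1 i) hx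
    have hl := locAnAt_unitOf_of_iwSet algFn_leftMinor (fun g hg => (isUnit_minors hg).2.1) hx
    have hr := locAnAt_unitOf_of_iwSet algFn_rightMinor (fun g hg => (isUnit_minors hg).2.2) hx
    have hd : LocAnAt p (iwCoord (p := p) (n := n)) (fun g : Iw p n => zpCoord p g.1.det) x :=
      locAnAt_intCast (f := fun g => g.det) (algFn_det (M := fun g => g.1) algFn_entry) x
    refine LocAnAt.congr (f := fun g : Iw p n => (wChar (branchingVectors p n) χ g.1 : A)) ?_ ?_
    · simp only [wChar_eq, wMon, Units.val_mul, Units.coe_prod, div_eq_mul_inv]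
      exact (((LocAnAt.char (hχ _) hd).mul (LocAnAt.prod fun i =>
        (LocAnAt.char (hχ _) (hv i)).mul (LocAnAt.char_inv (hχ _) (hv i)))).mul
          (LocAnAt.char_inv (hχ _) hl)).mul (LocAnAt.char (hχ _) hr)
    · filter_upwards [iwSet_near x] with z hz y hy
      exact wFun_of_mem χ ((hz y hy).2 hx)
  · refine (LocAnAt.const 0).congr ?_
    filter_upwards [iwSet_near x] with z hz y hy
    exact wFun_of_not_mem χ (mt (hz y hy).1 hx)

/-- The map `v_Ω`. -/
theorem exists_branchingMap [CompleteSpace A] {χ : Fin (n + n) → (ℤ_[p]ˣ →* Aˣ)}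
    (hχ : ∀ i, Continuous (χ i))
    {sw : ℤ_[p]ˣ →* Aˣ} (hsw : ∀ i z, χ i z * χ (Fin.rev i) z = sw z) :
    ∃ v : AnZp p A →ₗ[A] anInd χ,
      (∀ k, ∃ k' : ℕ, ∃ C : ℝ, 0 ≤ C ∧ ∀ (f : AnZp p A) B,
        AnalyticBound p (zpCoord p) k B f.1 → AnalyticBound p iwCoord k' (C * B) (v f).1) ∧
      ∀ f g, (v f).1 g = wFun χ g.1 * f.1 (minorQuot g.1) := by
  have : Nonempty ℤ_[p]ˣ := ⟨1⟩
  have H := exists_analyticBound_weighted_comp (p := p) (A := A) isCompact_range_iwCoord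
    (locAnAt_wFun hχ) locAnAt_minorQuot
  refine ⟨{ toFun := fun f => ⟨fun g => wFun χ g.1 * f.1 (minorQuot g.1), ?_, ?_⟩
            map_add' := ?_
            map_smul' := ?_ }, ?_, fun f g => rfl⟩
  · obtain ⟨k, C, hF⟩ := f.2
    obtain ⟨k', C', -, H⟩ := H k
    exact ⟨k', _, H f.1 C hF⟩
  · intro k hk t g g' e
    have hk' := lowerUnip_one_subset hk
    beta_reduce
    rw [e]
    by_cases hg : g.1 ∈ iwSet p n 1
    · have hg' := (iwSet_lower_mul hk t g.1).2 hg
      rw [wFun_of_mem χ hg, wFun_of_mem χ hg', wChar_lower_mul hsw hk' t hg,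
        minorQuot_lower_mul hk' t hg hg', Units.val_mul, mul_assoc]
    · rw [wFun_of_not_mem χ hg, wFun_of_not_mem χ (mt (iwSet_lower_mul hk t g.1).1 hg), zero_mul,
        zero_mul, mul_zero]
  · exact fun F F' => Subtype.ext (funext fun g => mul_add _ _ _)
  · exact fun a F => Subtype.ext (funext fun g => mul_left_comm _ _ _)
  · intro k
    obtain ⟨k', C', h0, H⟩ := H k
    exact ⟨k', C', h0, fun f B hf => H f.1 B hf⟩

/-- The definition prescribes values only on `N(ℤ_p)`. Left equivariance of both sides carries the
formula to all of Iw, and on `N(ℤ_p)` the sets N^1 and Iw^1 coincide. Uniqueness of `v_Ω` is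
immediate from the formula. -/
lemma isBranchingMap_iff {χ : Fin (n + n) → (ℤ_[p]ˣ →* Aˣ)}
    {sw : ℤ_[p]ˣ →* Aˣ} (hsw : ∀ i z, χ i z * χ (Fin.rev i) z = sw z)
    (v : AnZp p A →ₗ[A] anInd χ) : IsBranchingMap (branchingVectors p n) χ v ↔
      ∀ f g, (v f).1 g = wFun χ g.1 * f.1 (minorQuot g.1) := by
  have hq : ∀ g ∈ iwSet p n 1, minorQuot g = toUnit ((branchingVectors p n).v2.1 g) /
      toUnit ((branchingVectors p n).v1.1 g) := fun g hg => if_pos hg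
  have key : IsBranchingMap (branchingVectors p n) χ v ↔ ∀ (f : AnZp p A) (g : Iw p n),
      g.1 ∈ upperUnip p n 0 → (v f).1 g = wFun χ g.1 * f.1 (minorQuot g.1) := by
    refine forall₃_congr fun f g hg => ?_
    rw [mem_unipCoset_iff hg]
    by_cases h : g.1 ∈ iwSet p n 1
    · simp only [h, true_imp_iff, not_true, false_imp_iff, and_true, wFun_of_mem χ h, hq _ h]
    · simp only [h, true_imp_iff, not_false_iff, false_imp_iff, true_and, wFun_of_not_mem χ h,
        zero_mul]
  rw [key]
  refine ⟨fun h f g => ?_, fun h f g _ => h f g⟩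
  obtain ⟨k, hk, e⟩ := exists_decomp g
  have hk' := lowerUnip_one_subset hk
  have hiff := iwSet_lower_mul hk (torusPart g.1) (upperPart g).1
  rw [anInd_apply (v f).2 g, h f _ (upperPart_mem g)]
  rw [← e] at hiff
  by_cases hg : (upperPart g).1 ∈ iwSet p n 1
  · have hg' := hiff.2 hg
    have h1 : wFun χ g.1 = ((∏ i, χ i (torusPart g.1 i) : Aˣ) : A) * wFun χ (upperPart g).1 := by
      rw [wFun_of_mem χ hg, wFun_of_mem χ hg', ← Units.val_mul, ← wChar_lower_mul hsw hk' _ hg, ← e]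
    have h2 : minorQuot g.1 = minorQuot (upperPart g).1 := by
      have := minorQuot_lower_mul hk' (torusPart g.1) hg (by rw [← e]; exact hg')
      rwa [← e] at this
    rw [h1, h2, mul_assoc]
  · rw [wFun_of_not_mem χ hg, wFun_of_not_mem χ (mt hiff.1 hg), zero_mul, zero_mul, mul_zero]

theorem existsUnique_branchingMap [CompleteSpace A] {χ : Fin (n + n) → (ℤ_[p]ˣ →* Aˣ)}
    (hχ : ∀ i, Continuous (χ i))
    {sw : ℤ_[p]ˣ →* Aˣ} (hsw : ∀ i z, χ i z * χ (Fin.rev i) z = sw z) :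
    ∃! v : AnZp p A →ₗ[A] anInd χ, IsBranchingMap (branchingVectors p n) χ v := by
  obtain ⟨v, -, hv⟩ := exists_branchingMap hχ hsw
  refine ⟨v, (isBranchingMap_iff hsw v).2 hv, fun v' hv' => LinearMap.ext fun f =>
    Subtype.ext (funext fun g => ?_)⟩
  rw [hv, (isBranchingMap_iff hsw v').1 hv']

theorem existsUnique_kappa [CompleteSpace A] {χ : Fin (n + n) → (ℤ_[p]ˣ →* Aˣ)}
    (hχ : ∀ i, Continuous (χ i))
    {sw : ℤ_[p]ˣ →* Aˣ} (hsw : ∀ i z, χ i z * χ (Fin.rev i) z = sw z) :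
    ∃! κ : DistIw χ →ₗ[A] DistZp p A, IsKappa (branchingVectors p n) χ κ := by
  obtain ⟨v, hb, hv⟩ := exists_branchingMap hχ hsw
  have hv' := (isBranchingMap_iff hsw v).2 hv
  -- Boundedness of `v` on each Banach space of `p^k`-analytic functions is what makes `μ ∘ v` a
  -- continuous functional.
  obtain ⟨κ₀, hκ₀⟩ : ∃ κ₀ : DistIw χ →ₗ[A] DistZp p A, ∀ μ f, (κ₀ μ).1 f = μ.1 (v f) := by
    refine ⟨{ toFun := fun μ => ⟨μ.1 ∘ₗ v, fun k => ?_⟩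
              map_add' := fun _ _ => rfl
              map_smul' := fun _ _ => rfl }, fun _ _ => rfl⟩
    obtain ⟨k', C, -, H⟩ := hb k
    obtain ⟨Cμ, hμ⟩ := μ.2 k'
    refine ⟨Cμ * C, fun f B hf => ?_⟩
    have h1 := hμ (v f) _ (H f B hf)
    rw [← mul_assoc] at h1
    exact h1
  refine ⟨κ₀, ⟨v, hv', hκ₀⟩, ?_⟩
  rintro κ ⟨v₁, hv₁, hκ⟩
  have e : v₁ = v := (existsUnique_branchingMap hχ hsw).unique hv₁ hv'
  refine LinearMap.ext fun μ => Subtype.ext (LinearMap.ext fun f => ?_)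
  rw [hκ μ f, e, hκ₀ μ f]

/-- `κ_Ω` is determined by the formula for `v_Ω`. -/
lemma kappa_apply {χ : Fin (n + n) → (ℤ_[p]ˣ →* Aˣ)} {sw : ℤ_[p]ˣ →* Aˣ}
    (hsw : ∀ i z, χ i z * χ (Fin.rev i) z = sw z) {κ : DistIw χ →ₗ[A] DistZp p A}
    (hκ : IsKappa (branchingVectors p n) χ κ) (μ : DistIw χ) (f : AnZp p A) :
    ∃ F : anInd χ, (∀ g, F.1 g = wFun χ g.1 * f.1 (minorQuot g.1)) ∧ (κ μ).1 f = μ.1 F := by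
  obtain ⟨v, hv, h⟩ := hκ
  exact ⟨v f, (isBranchingMap_iff hsw v).1 hv f, h μ f⟩

theorem kappa_equivariant {χ : Fin (n + n) → (ℤ_[p]ˣ →* Aˣ)} {sw : ℤ_[p]ˣ →* Aˣ}
    (hsw : ∀ i z, χ i z * χ (Fin.rev i) z = sw z) {κ : DistIw χ →ₗ[A] DistZp p A}
    (hκ : IsKappa (branchingVectors p n) χ κ) (h : iwH p n 1) (μ : DistIw χ) :
    κ (iwHActDist χ h μ) = zpActDist sw h.1 (κ μ) := by
  refine Subtype.ext (LinearMap.ext fun f => ?_)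
  obtain ⟨F, hF, e1⟩ := kappa_apply hsw hκ (iwHActDist χ h μ) f
  obtain ⟨F', hF', e2⟩ := kappa_apply hsw hκ μ (zpAct sw h.1⁻¹ f)
  have e3 : (zpActDist sw h.1 (κ μ)).1 f = (κ μ).1 (zpAct sw h.1⁻¹ f) := rfl
  have e4 : (iwHActDist χ h μ).1 F = μ.1 (iwAct χ (⟨iota h.1, iota_mem_Iw h.2⟩ : Iw p n)⁻¹ F) := rfl
  rw [e1, e3, e2, e4]
  congr 1
  refine Subtype.ext (funext fun g => ?_)
  change F.1 (g * (⟨iota h.1, iota_mem_Iw h.2⟩ : Iw p n)⁻¹) = F'.1 g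
  have hh := iwH_inv h.2
  have e5 : (g * (⟨iota h.1, iota_mem_Iw h.2⟩ : Iw p n)⁻¹).1 = g.1 * iota h.1⁻¹ := by
    rw [iota_inv]
    rfl
  rw [hF, hF', e5]
  change _ = _ * ((sw h.1⁻¹.2.det : A) * f.1 (h.1⁻¹.2.det / h.1⁻¹.1.det * minorQuot g.1))
  -- On Iw^1 the factor `sw(det h₂)` comes from `w_χ` and the scaling of the variable from the
  -- quotient of minors. Off Iw^1 both sides vanish, as translation by Iw_H^1 preserves the
  -- complement.
  by_cases hg : g.1 ∈ iwSet p n 1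
  · rw [wFun_of_mem χ hg, wFun_of_mem χ ((iwSet_mul_iota hh _).2 hg), wChar_mul_iota hsw hg,
      minorQuot_mul_iota hg hh, Units.val_mul]
    ring
  · rw [wFun_of_not_mem χ hg, wFun_of_not_mem χ (mt (iwSet_mul_iota hh _).1 hg), zero_mul, zero_mul]

end BranchingMap
end BranchingLaw
end

noncomputable section
namespace BranchingLaw

/-! ### Specialisation at classical points -/

section ClassicalPoints

variable {p : ℕ} [Fact p.Prime] {n : ℕ} {L : Type*} [NormedField L] [NormedAlgebra ℚ_[p] L]

lemma algChar_add (m m' : ℤ) (z : ℤ_[p]ˣ) :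
    algChar p L (m + m') z = algChar p L m z * algChar p L m' z :=
  zpow_add (unitsHom p L z) m m'

lemma algChar_neg (m : ℤ) (z : ℤ_[p]ˣ) : algChar p L (-m) z = (algChar p L m z)⁻¹ :=
  zpow_neg (unitsHom p L z) m

/-- The power `z ↦ z^j` as a locally analytic function. -/
def zpPow (p : ℕ) [Fact p.Prime] (L : Type*) [NormedField L] [NormedAlgebra ℚ_[p] L]
    [CompleteSpace L] (j : ℤ) : AnZp p L :=
  ⟨fun z => (algChar p L j z : L), LocAnAt.mem_locAn isCompact_range_zpCoord fun _ =>
    LocAnAt.char (φ := fun z => z) (continuous_algChar j)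
      (.of_eventually analyticAt_id fun _ => rfl)⟩

/-- The power `z^j` is an eigenvector. The dual action uses `h⁻¹`, which turns `det(h₂)^w (det h₂ /
det h₁)^j` into `det(h₁)^j det(h₂)^{-w-j}`. -/
lemma zpActDist_zpPow [CompleteSpace L] (w j : ℤ) (h : Gn p n × Gn p n) (μ : DistZp p L) :
    (zpActDist (algChar p L w) h μ).1 (zpPow p L j) =
      ((algChar p L j h.1.det * algChar p L (-w - j) h.2.det : Lˣ) : L) * μ.1 (zpPow p L j) := by
  have e : zpAct (algChar p L w) h⁻¹ (zpPow p L j) =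
      ((algChar p L j h.1.det * algChar p L (-w - j) h.2.det : Lˣ) : L) • zpPow p L j := by
    refine Subtype.ext (funext fun z => ?_)
    change (algChar p L w h⁻¹.2.det : L) * (algChar p L j (h⁻¹.2.det / h⁻¹.1.det * z) : L) =
      ((algChar p L j h.1.det * algChar p L (-w - j) h.2.det : Lˣ) : L) * (algChar p L j z : L)
    rw [← Units.val_mul, ← Units.val_mul, Prod.fst_inv, Prod.snd_inv, map_inv, map_inv, map_mul,
      map_div, map_inv, map_inv, map_inv, sub_eq_add_neg, algChar_add, algChar_neg, algChar_neg,
      div_inv_eq_mul]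
    congr 1
    simp only [mul_comm, mul_left_comm, mul_assoc]
  change μ.1 (zpAct (algChar p L w) h⁻¹ (zpPow p L j)) = _
  rw [e, map_smul, smul_eq_mul]

/-- The restriction `V_λ(L) → 𝒜_λ`. -/
def resIw [CompleteSpace L] (lam : Fin (n + n) → ℤ) :
    algInd p L lam →ₗ[L] anInd (fun i => algChar p L (lam i)) where
  toFun f := ⟨fun g => f.1 g.1, LocAnAt.mem_locAn isCompact_range_iwCoord
    fun x => LocAnAt.of_algFn f.2.1 x, fun k hk t g g' e => by
      beta_reduce
      rw [e]
      exact f.2.2 k (lowerUnip_one_subset hk) t g.1⟩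
  map_add' _ _ := rfl
  map_smul' _ _ := rfl

theorem existsUnique_restrictionDual [CompleteSpace L] (lam : Fin (n + n) → ℤ) :
    ∃! r : DistIw (fun i => algChar p L (lam i)) →ₗ[L] Module.Dual L (algInd p L lam),
      IsRestrictionDual lam r := by
  refine ⟨{ toFun := fun μ => μ.1 ∘ₗ resIw lam
            map_add' := fun _ _ => rfl
            map_smul' := fun _ _ => rfl }, ⟨resIw lam, fun _ _ => rfl, fun _ _ => rfl⟩, ?_⟩
  rintro r ⟨inc, hinc, hr⟩
  have e : inc = resIw lam := LinearMap.ext fun f => Subtype.ext (funext fun g => hinc f g)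
  refine LinearMap.ext fun μ => LinearMap.ext fun f => (hr μ f).trans ?_
  rw [e]
  rfl

lemma restrictionDual_apply [CompleteSpace L] {lam : Fin (n + n) → ℤ}
    {r : DistIw (fun i => algChar p L (lam i)) →ₗ[L] Module.Dual L (algInd p L lam)}
    (h : IsRestrictionDual lam r) (μ f) : r μ f = μ.1 (resIw lam f) := by
  obtain ⟨inc, hinc, hr⟩ := h
  rw [hr]
  exact congrArg μ.1 (Subtype.ext (funext fun g => hinc f g))

lemma restrictionDual_equivariant [CompleteSpace L] {lam : Fin (n + n) → ℤ}
    {r : DistIw (fun i => algChar p L (lam i)) →ₗ[L] Module.Dual L (algInd p L lam)}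
    (hr : IsRestrictionDual lam r) (h : iwH p n 1) (μ) :
    r (iwHActDist _ h μ) = algActDual lam h.1 (r μ) := by
  refine LinearMap.ext fun f => ?_
  refine (restrictionDual_apply hr _ f).trans
    (Eq.trans ?_ (restrictionDual_apply hr μ (algAct lam (iota h.1)⁻¹ f)).symm)
  exact congrArg μ.1 (Subtype.ext (funext fun g => rfl))

lemma isSupportedOn_iwHActDist {A : Type*} [NormedCommRing A] [NormedAlgebra ℚ_[p] A]
    {χ : Fin (n + n) → (ℤ_[p]ˣ →* Aˣ)} (h : iwH p n 1) {μ : DistIw χ} (hμ : IsSupportedOn χ 1 μ) :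
    IsSupportedOn χ 1 (iwHActDist χ h μ) := by
  intro f f' h1 h2
  have key : ∀ g : Iw p n, (g * (⟨iota h.1, iota_mem_Iw h.2⟩ : Iw p n)⁻¹).1 ∈ iwSet p n 1 ↔
      g.1 ∈ iwSet p n 1 := fun g => by
    have e : (g * (⟨iota h.1, iota_mem_Iw h.2⟩ : Iw p n)⁻¹).1 = g.1 * iota h.1⁻¹ := by
      rw [iota_inv]
      rfl
    rw [e, iwSet_mul_iota (iwH_inv h.2)]
  exact hμ (iwAct χ (⟨iota h.1, iota_mem_Iw h.2⟩ : Iw p n)⁻¹ f)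
    (iwAct χ (⟨iota h.1, iota_mem_Iw h.2⟩ : Iw p n)⁻¹ f')
    (fun g hg => h1 _ ((key g).2 hg)) (fun g hg => h2 _ (mt (key g).1 hg))

variable {A : Type*} [NormedCommRing A] [NormedAlgebra ℚ_[p] A] [NormedAlgebra L A]
  [IsScalarTower ℚ_[p] L A]

/-- On ℤ_p^× no equivariance is imposed, so the identity serves as projector. -/
theorem existsUnique_specialisation_zp [CompleteSpace A] (x : A →ₐ[L] L) :
    ∃! sp : DistZp p A →ₛₗ[(x : A →+* L)] DistZp p L, IsSpecialisation (x : A →+* L) sp := by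
  refine (existsUnique_specialisation isCompact_range_zpCoord le_rfl le_rfl LinearMap.id
    (fun k => ⟨k, 1, zero_le_one, fun f B hB => by rwa [one_mul]⟩) (fun F => rfl) x
    fun f y => ?_).1
  exact (x.commutes (f.1 y)).symm

/-- Since `x ∘ χ = λ`, the fibre of `𝒜_χ` at `x` is `𝒜_λ`. The explicit lift in the second part is
recorded because it vanishes wherever `f ∘ upperPart` does, which controls supports. -/
theorem specialisation_iw [CompleteSpace A] {χ : Fin (n + n) → (ℤ_[p]ˣ →* Aˣ)}
    (hχ : ∀ i, Continuous (χ i)) {lam : Fin (n + n) → ℤ} (x : A →ₐ[L] L)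
    (hx : ∀ i z, x (χ i z : A) = (algChar p L (lam i) z : L)) :
    (∃! sp : DistIw χ →ₛₗ[(x : A →+* L)] DistIw (fun i => algChar p L (lam i)),
      IsSpecialisation (x : A →+* L) sp) ∧
    ∀ f : anInd (fun i => algChar p L (lam i)), ∃ F : anInd χ,
      (∀ g, f.1 g = x (F.1 g)) ∧
      ∀ g : Iw p n, F.1 g = ((∏ i, χ i (torusPart g.1 i) : Aˣ) : A) *
        algebraMap L A (f.1 (upperPart g)) := by
  obtain ⟨P, hP, hPF⟩ := exists_projector χ hχ
  have h1 : ∀ (f : anInd (fun i => algChar p L (lam i))) g, f.1 g =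
      x ((P (locAnExtend p A (iwCoord (p := p) (n := n)) ⟨f.1, f.2.1⟩)).1 g) := fun f g => by
    rw [hPF, map_mul, Units.coe_prod, map_prod, anInd_apply f.2 g, Units.coe_prod]
    exact congrArg₂ _ (Finset.prod_congr rfl fun i _ => (hx i _).symm)
      (x.commutes (f.1 (upperPart g))).symm
  refine ⟨(existsUnique_specialisation isCompact_range_iwCoord (S := anInd χ)
    (S' := anInd fun i => algChar p L (lam i)) (fun F hF => hF.1) (fun F hF => hF.1) P hP (fun F => Subtype.ext (funext fun g => ?_)) x h1).1,
    fun f => ⟨_, h1 f, fun g => hPF _ g⟩⟩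
  rw [hPF]
  exact (anInd_apply F.2 g).symm

/-- Lifting is compatible with restriction to Iw^1, because an element lies in Iw^1 exactly when its
upper unipotent part does. -/
lemma isSupportedOn_specialisation [CompleteSpace A] {χ : Fin (n + n) → (ℤ_[p]ˣ →* Aˣ)}
    (hχ : ∀ i, Continuous (χ i)) {lam : Fin (n + n) → ℤ} {x : A →ₐ[L] L}
    (hx : ∀ i z, x (χ i z : A) = (algChar p L (lam i) z : L))
    {sp : DistIw χ →ₛₗ[(x : A →+* L)] DistIw (fun i => algChar p L (lam i))}
    (hsp : IsSpecialisation (x : A →+* L) sp) {μ : DistIw χ} (hμ : IsSupportedOn χ 1 μ) :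
    IsSupportedOn _ 1 (sp μ) := by
  intro f f' h1 h2
  obtain ⟨F, hF, hF1⟩ := (specialisation_iw hχ x hx).2 f
  obtain ⟨F', hF', hF1'⟩ := (specialisation_iw hχ x hx).2 f'
  have key : ∀ g : Iw p n, (upperPart g).1 ∈ iwSet p n 1 ↔ g.1 ∈ iwSet p n 1 := fun g => by
    obtain ⟨k, hk, e⟩ := exists_decomp g
    conv_rhs => rw [e]
    exact (iwSet_lower_mul hk _ _).symm
  rw [hsp μ F f hF, hsp μ F' f' hF']
  refine congrArg _ (hμ F F' (fun g hg => ?_) fun g hg => ?_)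
  · rw [hF1, hF1', h1 _ ((key g).2 hg)]
  · rw [hF1', h2 _ (mt (key g).1 hg), map_zero, mul_zero]

/-- A translate of a lift of `f` is a lift of the translate of `f`, and any lift may be used to
compute `sp`. -/
lemma specialisation_iwHActDist [CompleteSpace A] {χ : Fin (n + n) → (ℤ_[p]ˣ →* Aˣ)}
    (hχ : ∀ i, Continuous (χ i)) {lam : Fin (n + n) → ℤ} {x : A →ₐ[L] L}
    (hx : ∀ i z, x (χ i z : A) = (algChar p L (lam i) z : L))
    {sp : DistIw χ →ₛₗ[(x : A →+* L)] DistIw (fun i => algChar p L (lam i))}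
    (hsp : IsSpecialisation (x : A →+* L) sp) (h : iwH p n 1) (μ : DistIw χ) :
    sp (iwHActDist χ h μ) = iwHActDist _ h (sp μ) := by
  refine Subtype.ext (LinearMap.ext fun f => ?_)
  obtain ⟨F, hF, -⟩ := (specialisation_iw hχ x hx).2 f
  refine (hsp _ F f hF).trans (Eq.symm ?_)
  exact hsp μ (iwAct χ (⟨iota h.1, iota_mem_Iw h.2⟩ : Iw p n)⁻¹ F)
    (iwAct _ (⟨iota h.1, iota_mem_Iw h.2⟩ : Iw p n)⁻¹ f) fun g => hF _

lemma specialisation_zpActDist {sw : ℤ_[p]ˣ →* Aˣ} {w : ℤ} {x : A →ₐ[L] L}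
    (hx : ∀ z, x (sw z : A) = (algChar p L w z : L))
    {sp : DistZp p A →ₛₗ[(x : A →+* L)] DistZp p L} (hsp : IsSpecialisation (x : A →+* L) sp)
    (h : Gn p n × Gn p n) (μ : DistZp p A) :
    sp (zpActDist sw h μ) = zpActDist (algChar p L w) h (sp μ) := by
  refine Subtype.ext (LinearMap.ext fun f => ?_)
  have hF : ∀ z, f.1 z = x ((locAnExtend p A (zpCoord p) f).1 z) := fun z => (x.commutes _).symm
  refine (hsp _ _ f hF).trans (Eq.symm ?_)
  refine hsp μ (zpAct sw h⁻¹ (locAnExtend p A (zpCoord p) f)) (zpAct (algChar p L w) h⁻¹ f)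
    fun z => ?_
  change (algChar p L w h⁻¹.2.det : L) * f.1 _ = x ((sw h⁻¹.2.det : A) * _)
  rw [map_mul, hx, hF]

variable [NeZero n]

lemma wFun_specialisation {χ : Fin (n + n) → (ℤ_[p]ˣ →* Aˣ)} {lam : Fin (n + n) → ℤ}
    {x : A →ₐ[L] L} (hx : ∀ i z, x (χ i z : A) = (algChar p L (lam i) z : L)) (g : G p n) :
    x (wFun χ g) = wFun (fun i => algChar p L (lam i)) g := by
  by_cases hg : g ∈ iwSet p n 1
  · rw [wFun_of_mem _ hg, wFun_of_mem _ hg]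
    have h1 : ∀ i z, Units.map (x : A →* L) (χ i z) = algChar p L (lam i) z := fun i z =>
      Units.ext (hx i z)
    have h2 : Units.map (x : A →* L) (wChar (branchingVectors p n) χ g) =
        wChar (branchingVectors p n) (fun i => algChar p L (lam i)) g := by
      simp only [wChar_eq, wMon, map_mul, map_inv, map_prod, map_div, h1]
    exact congrArg Units.val h2
  · rw [wFun_of_not_mem _ hg, wFun_of_not_mem _ hg, map_zero]

/-- Extend `f` by constants from `L` to `A`. The image of this extension under `v_Ω` specialises
pointwise to `v_λ(f)`, because `x` carries `w_χ` to `w_λ` and the quotient of minors does not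
involve the coefficients. -/
lemma specialisation_kappa {χ : Fin (n + n) → (ℤ_[p]ˣ →* Aˣ)} {sw : ℤ_[p]ˣ →* Aˣ}
    (hχ : ∀ i z, χ i z * χ (Fin.rev i) z = sw z) {lam : Fin (n + n) → ℤ} {w : ℤ}
    (hl : IsPureDominant lam w) {x : A →ₐ[L] L}
    (hx : ∀ i z, x (χ i z : A) = (algChar p L (lam i) z : L))
    {κ : DistIw χ →ₗ[A] DistZp p A} (hκ : IsKappa (branchingVectors p n) χ κ)
    {κl : DistIw (fun i => algChar p L (lam i)) →ₗ[L] DistZp p L}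
    (hκl : IsKappa (branchingVectors p n) (fun i => algChar p L (lam i)) κl)
    {spIw : DistIw χ →ₛₗ[(x : A →+* L)] DistIw (fun i => algChar p L (lam i))}
    (hIw : IsSpecialisation (x : A →+* L) spIw)
    {spZp : DistZp p A →ₛₗ[(x : A →+* L)] DistZp p L} (hZp : IsSpecialisation (x : A →+* L) spZp)
    (μ : DistIw χ) : spZp (κ μ) = κl (spIw μ) := by
  refine Subtype.ext (LinearMap.ext fun f => ?_)
  have hf : ∀ z, f.1 z = x ((locAnExtend p A (zpCoord p) f).1 z) := fun z => (x.commutes _).symm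
  obtain ⟨F, hF, e1⟩ := kappa_apply hχ hκ μ (locAnExtend p A (zpCoord p) f)
  obtain ⟨F', hF', e2⟩ := kappa_apply (algChar_pure hl) hκl (spIw μ) f
  rw [hZp _ _ f hf, e1, e2]
  refine (hIw μ F F' fun g => ?_).symm
  rw [hF', hF, ← wFun_specialisation hx, hf]
  exact (map_mul x _ _).symm

/-- The classical vector `v_{λ,j}` in `V_λ(L)`. -/
def classicalElt {lam : Fin (n + n) → ℤ} {w : ℤ} (hl : IsPureDominant lam w) {j : ℤ}
    (hj : j ∈ crit lam) : algInd p L lam :=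
  ⟨classicalFn p L lam j, classicalFn_mem_algFn hl hj, fun _ hk t g =>
    classicalFn_lower_mul hl j hk t g⟩

lemma algAct_classicalElt {lam : Fin (n + n) → ℤ} {w : ℤ} (hl : IsPureDominant lam w) {j : ℤ}
    (hj : j ∈ crit lam) (h : Gn p n × Gn p n) :
    algAct lam (iota h) (classicalElt (p := p) (L := L) hl hj) =
      ((algChar p L (-j) h.1.det * algChar p L (w + j) h.2.det : Lˣ) : L) • classicalElt hl hj :=
  Subtype.ext (funext fun g => classicalFn_mul_iota hl j g h)

/-- The classical branching law. -/
theorem eigen_iff_mem_span {lam : Fin (n + n) → ℤ} {w : ℤ} (hl : IsPureDominant lam w) {j : ℤ}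
    (hj : j ∈ crit lam) (f : algInd p L lam) :
    (∀ h : Gn p n × Gn p n, algAct lam (iota h) f =
      ((algChar p L (-j) h.1.det * algChar p L (w + j) h.2.det : Lˣ) : L) • f) ↔
      f ∈ Submodule.span L {classicalElt (p := p) (L := L) hl hj} := by
  rw [Submodule.mem_span_singleton]
  constructor
  · refine fun hf => ⟨f.1 (uElt p n), (algInd_eq_of_eigen hf (fun h => ?_) ?_).symm⟩
    · rw [map_smul, algAct_classicalElt, smul_comm]
    · change _ = f.1 (uElt p n) * classicalFn p L lam j (uElt p n)
      rw [classicalFn_uElt, mul_one]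
  · rintro ⟨c, rfl⟩ h
    rw [map_smul, algAct_classicalElt, smul_comm]

lemma algActDual_classicalElt {lam : Fin (n + n) → ℤ} {w : ℤ} (hl : IsPureDominant lam w) {j : ℤ}
    (hj : j ∈ crit lam) (h : Gn p n × Gn p n) (ν : Module.Dual L (algInd p L lam)) :
    algActDual lam h ν (classicalElt hl hj) =
      ((algChar p L j h.1.det * algChar p L (-w - j) h.2.det : Lˣ) : L) *
        ν (classicalElt hl hj) := by
  change ν (algAct lam (iota h)⁻¹ (classicalElt hl hj)) = _
  have e : -w - j = -(w + j) := by ring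
  rw [← iota_inv, algAct_classicalElt, map_smul, smul_eq_mul, Prod.fst_inv, Prod.snd_inv, map_inv,
    map_inv, map_inv, map_inv, algChar_neg, inv_inv, e, algChar_neg (w + j)]

/-- The right-hand square. -/
lemma kappa_zpPow [CompleteSpace L] {lam : Fin (n + n) → ℤ} {w : ℤ} (hl : IsPureDominant lam w)
    {j : ℤ} (hj : j ∈ crit lam) {κl : DistIw (fun i => algChar p L (lam i)) →ₗ[L] DistZp p L}
    (hκl : IsKappa (branchingVectors p n) (fun i => algChar p L (lam i)) κl)
    {r : DistIw (fun i => algChar p L (lam i)) →ₗ[L] Module.Dual L (algInd p L lam)}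
    (hr : IsRestrictionDual lam r) {μ : DistIw (fun i => algChar p L (lam i))}
    (hμ : IsSupportedOn (fun i => algChar p L (lam i)) 1 μ) :
    (κl μ).1 (zpPow p L j) = r μ (classicalElt hl hj) := by
  obtain ⟨F, hF, e⟩ := kappa_apply (algChar_pure hl) hκl μ (zpPow p L j)
  rw [e, restrictionDual_apply hr]
  -- The test function `v_λ(z^j)` is the restriction of `v_{λ,j}` to Iw^1 extended by zero. This is
  -- why the support condition on `μ` is needed for the right-hand square.
  refine (hμ (resIw lam (classicalElt hl hj)) F (fun g hg => ?_) fun g hg => ?_).symm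
  · rw [hF, wFun_of_mem _ hg, minorQuot, if_pos hg]
    exact (classicalFn_eq_wChar lam j hg).symm
  · rw [hF, wFun_of_not_mem _ hg, zero_mul]

lemma norm_le_of_dvd {β : ℕ} {z : ℤ_[p]} (h : (p : ℤ_[p]) ^ β ∣ z - 1) :
    ‖intHom p ℚ_[p] z - 1‖ ≤ ((p : ℝ)⁻¹) ^ β := by
  have h1 := (PadicInt.norm_le_pow_iff_mem_span_pow (z - 1) β).2 (Ideal.mem_span_singleton.2 h)
  rw [zpow_neg, zpow_natCast, ← inv_pow] at h1
  have e : intHom p ℚ_[p] z - 1 = ((z - 1 : ℤ_[p]) : ℚ_[p]) := by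
    rw [PadicInt.coe_sub, PadicInt.coe_one]
    rfl
  rwa [e]

end ClassicalPoints
end BranchingLaw
end

/-! ### Assembly of the theorem. -/

theorem mainTheorem8 (p : ℕ) [Fact p.Prime] (n : ℕ) [NeZero n]
    {L : Type*} [NormedField L] [NormedAlgebra ℚ_[p] L] [CompleteSpace L]
    {A : Type*} [NormedCommRing A] [NormedAlgebra ℚ_[p] A] [NormedAlgebra L A]
    [IsScalarTower ℚ_[p] L A] [CompleteSpace A] [IsUltrametricDist A]
    (hA : IsAffinoidAlgebra L A)
    (χ : Fin (n + n) → (ℤ_[p]ˣ →* Aˣ)) (hχc : ∀ i, Continuous (χ i))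
    (sw : ℤ_[p]ˣ →* Aˣ) (hχ : ∀ i z, χ i z * χ (Fin.rev i) z = sw z) :
    -- the normalised branching vectors exist and are unique
    Nonempty (Unique (BranchingVectors p n)) ∧
    ∀ V : BranchingVectors p n,
    -- they take values in `1 + p^β ℤ_p` on `N^β(ℤ_p)`
    (∀ β : ℕ, 1 ≤ β → ∀ g ∈ unipCoset p n β,
      (∀ i, ‖(V.v i).1 g - 1‖ ≤ ((p : ℝ)⁻¹) ^ β) ∧
      ‖V.v1.1 g - 1‖ ≤ ((p : ℝ)⁻¹) ^ β ∧ ‖V.v2.1 g - 1‖ ≤ ((p : ℝ)⁻¹) ^ β) ∧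
    -- classical branching law: `v_{λ,j}` spans the line of vectors in `V_λ(L)` on which `H(ℤ_p)`
    -- acts by `det(h₁)^{-j} det(h₂)^{w+j}`
    (∀ (lam : Fin (n + n) → ℤ) (w : ℤ), IsPureDominant lam w → ∀ j ∈ crit lam,
      ∃ e : algInd p L lam, (∀ g, e.1 g = algebraMap ℚ_[p] L (classicalVec V lam j g)) ∧ e ≠ 0 ∧
        ∀ f : algInd p L lam,
          (∀ h : Gn p n × Gn p n, algAct lam (iota h) f =
            ((algChar p L (-j) h.1.det * algChar p L (w + j) h.2.det : Lˣ) : L) • f) ↔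
          f ∈ Submodule.span L {e}) ∧
    -- `v_Ω` and `κ_Ω` are well defined, and `κ_Ω` is equivariant for `Iw_H^1`
    (∃! v : AnZp p A →ₗ[A] anInd χ, IsBranchingMap V χ v) ∧
    (∃! κ : DistIw χ →ₗ[A] DistZp p A, IsKappa V χ κ) ∧
    (∀ κ : DistIw χ →ₗ[A] DistZp p A, IsKappa V χ κ → ∀ (h : iwH p n 1) (μ : DistIw χ),
      κ (iwHActDist χ h μ) = zpActDist sw h.1 (κ μ)) ∧
    -- for every classical point `λ` of `Ω`, with specialisation map `x`
    ∀ (lam : Fin (n + n) → ℤ) (w : ℤ), IsPureDominant lam w →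
    ∀ x : A →ₐ[L] L, (∀ i z, x (χ i z : A) = (algChar p L (lam i) z : L)) →
      -- the maps `κ_λ`, `sp_λ` (twice) and `r_λ` are well defined
      (∃! κ : DistIw (fun i => algChar p L (lam i)) →ₗ[L] DistZp p L,
        IsKappa V (fun i => algChar p L (lam i)) κ) ∧
      (∃! sp : DistIw χ →ₛₗ[(x : A →+* L)] DistIw (fun i => algChar p L (lam i)),
        IsSpecialisation (x : A →+* L) sp) ∧
      (∃! sp : DistZp p A →ₛₗ[(x : A →+* L)] DistZp p L, IsSpecialisation (x : A →+* L) sp) ∧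
      (∃! r : DistIw (fun i => algChar p L (lam i)) →ₗ[L] Module.Dual L (algInd p L lam),
        IsRestrictionDual lam r) ∧
      ∀ (κΩ : DistIw χ →ₗ[A] DistZp p A)
        (κl : DistIw (fun i => algChar p L (lam i)) →ₗ[L] DistZp p L)
        (spIw : DistIw χ →ₛₗ[(x : A →+* L)] DistIw (fun i => algChar p L (lam i)))
        (spZp : DistZp p A →ₛₗ[(x : A →+* L)] DistZp p L)
        (r : DistIw (fun i => algChar p L (lam i)) →ₗ[L] Module.Dual L (algInd p L lam)),
        IsKappa V χ κΩ → IsKappa V (fun i => algChar p L (lam i)) κl →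
        IsSpecialisation (x : A →+* L) spIw → IsSpecialisation (x : A →+* L) spZp →
        IsRestrictionDual lam r →
          -- `sp_λ` maps `𝒟_Ω^1` to `𝒟_λ^1`
          (∀ μ, IsSupportedOn χ 1 μ → IsSupportedOn _ 1 (spIw μ)) ∧
          -- the left-hand square commutes
          (∀ μ, spZp (κΩ μ) = κl (spIw μ)) ∧
          -- `Iw_H^1` preserves `𝒟_Ω^1` and `𝒟_λ^1`, and `κ_λ`, `sp_λ`, `r_λ` are equivariant
          (∀ h : iwH p n 1,
            (∀ μ, IsSupportedOn χ 1 μ → IsSupportedOn χ 1 (iwHActDist χ h μ)) ∧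
            (∀ μ, IsSupportedOn (fun i => algChar p L (lam i)) 1 μ →
              IsSupportedOn _ 1 (iwHActDist _ h μ)) ∧
            (∀ μ, κl (iwHActDist _ h μ) = zpActDist (algChar p L w) h.1 (κl μ)) ∧
            (∀ μ, spIw (iwHActDist χ h μ) = iwHActDist _ h (spIw μ)) ∧
            (∀ μ, spZp (zpActDist sw h.1 μ) = zpActDist (algChar p L w) h.1 (spZp μ)) ∧
            (∀ μ, r (iwHActDist _ h μ) = algActDual lam h.1 (r μ))) ∧
          -- for `j ∈ Crit(λ)`, with `e = v_{λ,j}` (so `κ_{λ,j}` is evaluation at `e`) and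
          -- `zj` the function `z ↦ z^j`
          ∀ j ∈ crit lam, ∃ (e : algInd p L lam) (zj : AnZp p L),
            (∀ g, e.1 g = algebraMap ℚ_[p] L (classicalVec V lam j g)) ∧
            (∀ z, zj.1 z = (algChar p L j z : L)) ∧
            -- the right-hand square and the whole diagram commute
            (∀ μ, IsSupportedOn (fun i => algChar p L (lam i)) 1 μ → (κl μ).1 zj = r μ e) ∧
            (∀ μ, IsSupportedOn χ 1 μ → (spZp (κΩ μ)).1 zj = r (spIw μ) e) ∧
            -- `κ_{λ,j}` and evaluation at `z^j` are equivariant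
            (∀ (h : Gn p n × Gn p n) (ν : Module.Dual L (algInd p L lam)),
              algActDual lam h ν e =
                ((algChar p L j h.1.det * algChar p L (-w - j) h.2.det : Lˣ) : L) * ν e) ∧
            (∀ (h : Gn p n × Gn p n) (μ : DistZp p L),
              (zpActDist (algChar p L w) h μ).1 zj =
                ((algChar p L j h.1.det * algChar p L (-w - j) h.2.det : Lˣ) : L) * μ.1 zj) := by
  refine ⟨⟨⟨branchingVectors p n⟩, fun V => V.eq _⟩, fun V => ?_⟩
  -- By uniqueness, any choice of branching vectors is the explicit one given by minors.
  obtain rfl := V.eq (branchingVectors p n)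
  refine ⟨fun β _ g hg => ?_, fun lam w hl j hj => ⟨classicalElt hl hj, fun g =>
    (algebraMap_classicalVec lam j g).symm, fun h => ?_, eigen_iff_mem_span hl hj⟩,
    existsUnique_branchingMap hχc hχ, existsUnique_kappa hχc hχ,
    fun κ hκ h μ => kappa_equivariant hχ hκ h μ, fun lam w hl x hx => ?_⟩
  · obtain ⟨h1, h2, h3⟩ := minors_unipCoset hg
    exact ⟨fun i => norm_le_of_dvd (h1 _ _ (succ_le_of_fin_pred i)), norm_le_of_dvd h2,
      norm_le_of_dvd h3⟩
  · have h1 : classicalFn p L lam j (uElt p n) = 0 :=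
      congrFun (congrArg Subtype.val h) (uElt p n)
    rw [classicalFn_uElt] at h1
    exact one_ne_zero h1
  · have hpure := algChar_pure (p := p) (L := L) hl
    -- The specialisation of `sw` is not assumed; purity for `χ` and for `λ`, at the index `n`,
    -- identifies it with `z ↦ z^w`.
    have hsw : ∀ z, x (sw z : A) = (algChar p L w z : L) := fun z => by
      rw [← hχ (idxN n) z, Units.val_mul, map_mul, hx, hx, ← hpure (idxN n) z, Units.val_mul]
    refine ⟨existsUnique_kappa (fun i => continuous_algChar (lam i)) hpure,
      (specialisation_iw hχc x hx).1, existsUnique_specialisation_zp x,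
      existsUnique_restrictionDual lam, fun κΩ κl spIw spZp r hκΩ hκl hIw hZp hr => ?_⟩
    have hleft := specialisation_kappa hχ hl hx hκΩ hκl hIw hZp
    refine ⟨fun μ hμ => isSupportedOn_specialisation hχc hx hIw hμ, hleft, fun h =>
      ⟨fun μ hμ => isSupportedOn_iwHActDist h hμ, fun μ hμ => isSupportedOn_iwHActDist h hμ,
        kappa_equivariant hpure hκl h, specialisation_iwHActDist hχc hx hIw h,
        specialisation_zpActDist hsw hZp h.1, restrictionDual_equivariant hr h⟩,
      fun j hj => ⟨classicalElt hl hj, zpPow p L j, fun g =>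
        (algebraMap_classicalVec lam j g).symm, fun z => rfl,
        fun μ hμ => kappa_zpPow hl hj hκl hr hμ, fun μ hμ => ?_,
        algActDual_classicalElt hl hj, zpActDist_zpPow w j⟩⟩
    rw [hleft]
    exact kappa_zpPow hl hj hκl hr (isSupportedOn_specialisation hχc hx hIw hμ)
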